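/- Let $\nu>0$ and let $\rho\in C_c^\infty(\mathbb R^3)$ be non-negative and even with $\int\rho=1$; for $\varepsilon>0$ put $\rho_\varepsilon(x)=\varepsilon^{-3}\rho(x/\varepsilon)$ and $\overline U=\rho_\varepsilon\star U$. Let $A\in C_b(\mathbb R_+,L^\infty(\mathbb R^3))$ satisfy $A\ge 0$, and suppose that $A$ has compact support in space uniformly in time, i.e. there is $R_0>0$ such that $A(t,x)=0$ for all $t\ge0$ and $|x|\ge R_0$. Let $u_0\in L^2(\mathbb R^3)^3$ with $\operatorname{div}u_0=0$ in the sense of distributions. Consider the regularized Navier--Stokes system $$\partial_t u+\overline u\cdot\nabla u-\nu\Delta u-\operatorname{div}\bigl(\overline{A\nabla\overline u}\bigr)+\nabla p=0,\qquad \operatorname{div}u=0,\qquad u|_{t=0}=\overline{u_0}.$$ For $0<T\le\infty$, a regular solution on $[0,T[$ is a pair $(u,p)$ such that $u,\partial_tu,\nabla u,D^2u,p,\nabla p$ exist and are continuous on $]0,T[\times\mathbb R^3$ and satisfy the two equations there; $u|_{t=0}=\overline{u_0}$; $u\in L^\infty([0,\tau],L^2(\mathbb R^3)^3)\cap L^\infty([0,\tau]\times\mathbb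 R^3)^3$ for every $\tau<T$; and $u(t,\cdot)\to\overline{u_0}$ uniformly and in $H^1(\mathbb R^3)^3$ as $t\to0^+$. Then for every $\varepsilon_0>0$ there is a continuous non-decreasing function $\varphi:[0,\infty[\to\mathbb R$, independent of $\varepsilon$, such that for every $\varepsilon\in\,]0,\varepsilon_0]$, every $T\in\,]0,\infty]$, every regular solution $(u,p)$ on $[0,T[$ of the regularized system with parameter $\varepsilon$, all $0<R_1<R_2$ and all $t\in[0,T[$, $$\frac12\int_{|x|\ge R_2}|u(t,x)|^2\,dx\le\frac12\int_{|x|\ge R_1}|u_0(x)|^2\,dx+\frac{\varphi(t)}{R_2-R_1}.$$ -/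

import Mathlib

open MeasureTheory Filter Topology Set
open scoped ContDiff

noncomputable section

/-- The physical space `ℝ³` with its Euclidean norm. -/
abbrev R3 : Type := EuclideanSpace ℝ (Fin 3)

/-- The `i`-th vector of the canonical basis of `ℝ³`. -/
def stdVec (i : Fin 3) : R3 := EuclideanSpace.single i (1 : ℝ)

/-- The divergence of a vector field: `div u = ∑ i, ∂ᵢ uᵢ`. -/
def vecDiv (u : R3 → R3) (x : R3) : ℝ :=
  ∑ i : Fin 3, (fderiv ℝ u x (stdVec i)) i

/-- The divergence of a tensor field `V`, where the matrix of `V x` is `V x e_j = ∑ i, V_ij e_i`: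
`[div V]_i = ∑ j, ∂_j V_ij`. -/
def tensorDiv (V : R3 → (R3 →L[ℝ] R3)) (x : R3) : R3 :=
  ∑ j : Fin 3, (fderiv ℝ V x (stdVec j)) (stdVec j)

/-- `div u = 0` in the sense of distributions. -/
def IsWeaklyDivFree (u : R3 → R3) : Prop :=
  ∀ ψ : R3 → ℝ, ContDiff ℝ ∞ ψ → HasCompactSupport ψ →
    ∫ x, inner ℝ (u x) (gradient ψ x) = 0

/-- A mollifying kernel: smooth, compactly supported, nonnegative, even, of integral one. -/
structure IsMollifier (ρ : R3 → ℝ) : Prop where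
  smooth : ContDiff ℝ ∞ ρ
  compactSupport : HasCompactSupport ρ
  nonneg : ∀ x, 0 ≤ ρ x
  integral_eq_one : ∫ x, ρ x = 1
  even : ∀ x, ρ (-x) = ρ x

/-- The rescaled kernel `ρ_ε(x) = ε⁻³ ρ(x / ε)`. -/
def scaledKernel (ρ : R3 → ℝ) (ε : ℝ) (x : R3) : ℝ :=
  (ε ^ 3)⁻¹ * ρ (ε⁻¹ • x)

/-- The regularization `ρ_ε ⋆ U`, i.e. `x ↦ ∫ ρ_ε(x - y) U(y) dy`. -/
def mollify {F : Type*} [NormedAddCommGroup F] [NormedSpace ℝ F]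
    (ρ : R3 → ℝ) (ε : ℝ) (U : R3 → F) (x : R3) : F :=
  ∫ y, scaledKernel ρ ε (x - y) • U y

/-- The eddy viscosity `A` is (a family of representatives of) an element of
`C_b(ℝ₊, L^∞(ℝ³))` with `A ≥ 0`. -/
structure IsEddyViscosity (A : ℝ → R3 → ℝ) : Prop where
  memLp : ∀ t, 0 ≤ t → MemLp (A t) ⊤ volume
  bounded : ∃ M : ℝ, ∀ t, 0 ≤ t → eLpNorm (A t) ⊤ volume ≤ ENNReal.ofReal M
  continuous : ∀ t₀, 0 ≤ t₀ →
    Tendsto (fun t => eLpNorm (A t - A t₀) ⊤ volume) (𝓝[Ici 0] t₀) (𝓝 0)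
  nonneg : ∀ t, 0 ≤ t → ∀ᵐ x ∂(volume : Measure R3), 0 ≤ A t x

/-- `A` has compact support in space, uniformly in time. -/
def HasUniformCompactSupport (A : ℝ → R3 → ℝ) : Prop :=
  ∃ R₀ : ℝ, 0 < R₀ ∧ ∀ t, 0 ≤ t → ∀ᵐ x ∂(volume : Measure R3), R₀ ≤ ‖x‖ → A t x = 0

/-- The open space-time slab `]0, T[ × ℝ³`, where `T` may be `+∞`. -/
def slab (T : EReal) : Set (ℝ × R3) := {z | 0 < z.1 ∧ (z.1 : EReal) < T}

/-- `(u, p)` is a regular solution, over the time interval `[0, T[` (`T = +∞` is allowed), of the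
regularized Navier-Stokes equations with viscosity `ν`, eddy viscosity `A`, mollifying kernel `ρ`
at scale `ε` and initial datum `ρ_ε ⋆ u₀`. -/
structure IsRegularSolution (ν : ℝ) (A : ℝ → R3 → ℝ) (ρ : R3 → ℝ) (ε : ℝ) (u₀ : R3 → R3)
    (T : EReal) (u : ℝ → R3 → R3) (p : ℝ → R3 → ℝ) : Prop where
  /-- `∂ₜu` exists on the open slab. -/
  diff_time : ∀ z ∈ slab T, DifferentiableAt ℝ (fun s => u s z.2) z.1
  /-- `∇u` and `D²u` exist. -/
  diff_space : ∀ t : ℝ, 0 < t → (t : EReal) < T → ContDiff ℝ 2 (u t)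
  /-- `∇p` exists. -/
  diff_pressure : ∀ t : ℝ, 0 < t → (t : EReal) < T → ContDiff ℝ 1 (p t)
  /-- `u, ∂ₜu, ∇u, D²u, p, ∇p` are jointly continuous in time and space. -/
  cont_u : ContinuousOn (fun z : ℝ × R3 => u z.1 z.2) (slab T)
  cont_dt : ContinuousOn (fun z : ℝ × R3 => deriv (fun s => u s z.2) z.1) (slab T)
  cont_grad : ContinuousOn (fun z : ℝ × R3 => fderiv ℝ (u z.1) z.2) (slab T)
  cont_hess : ContinuousOn (fun z : ℝ × R3 => fderiv ℝ (fderiv ℝ (u z.1)) z.2) (slab T)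
  cont_p : ContinuousOn (fun z : ℝ × R3 => p z.1 z.2) (slab T)
  cont_grad_p : ContinuousOn (fun z : ℝ × R3 => gradient (p z.1) z.2) (slab T)
  /-- The momentum equation
  `∂ₜu + (ū · ∇)u - ν Δu - div (ρ_ε ⋆ (A ∇ū)) + ∇p = 0`, where `ū = ρ_ε ⋆ u`. -/
  momentum : ∀ t : ℝ, 0 < t → (t : EReal) < T → ∀ x : R3,
    deriv (fun s => u s x) t
      + fderiv ℝ (u t) x (mollify ρ ε (u t) x)
      - ν • Laplacian.laplacian (u t) x
      - tensorDiv (mollify ρ ε (fun y => A t y • fderiv ℝ (mollify ρ ε (u t)) y)) x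
      + gradient (p t) x = 0
  /-- The incompressibility equation. -/
  divFree : ∀ t : ℝ, 0 < t → (t : EReal) < T → ∀ x : R3, vecDiv (u t) x = 0
  /-- The initial condition. -/
  initial : u 0 = mollify ρ ε u₀
  /-- `u ∈ L^∞([0, τ], L²)` for all `τ < T`. -/
  bound_L2 : ∀ τ : ℝ, 0 ≤ τ → (τ : EReal) < T →
    ∃ M : ℝ, ∀ t ∈ Icc 0 τ, eLpNorm (u t) 2 volume ≤ ENNReal.ofReal M
  /-- `u ∈ L^∞([0, τ] × ℝ³)` for all `τ < T`. -/
  bound_Linfty : ∀ τ : ℝ, 0 ≤ τ → (τ : EReal) < T →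
    ∃ M : ℝ, ∀ t ∈ Icc 0 τ, ∀ x, ‖u t x‖ ≤ M
  /-- `u(t)` converges to the initial datum, uniformly and in `H¹`, as `t → 0⁺`. -/
  unif_initial : TendstoUniformly u (mollify ρ ε u₀) (𝓝[>] 0)
  L2_initial : Tendsto (fun t => eLpNorm (u t - mollify ρ ε u₀) 2 volume) (𝓝[>] 0) (𝓝 0)
  H1_initial : Tendsto
    (fun t => eLpNorm (fun x => fderiv ℝ (u t) x - fderiv ℝ (mollify ρ ε u₀) x) 2 volume)
    (𝓝[>] 0) (𝓝 0)

end

set_option linter.unusedSectionVars false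

/-! Test the momentum equation with `χ u`, where `χ` is an exterior cutoff
(`exists_exterior_cutoff`) whose gradient is at most L = C / (R₂ - R₁). Viscosity and eddy viscosity
dissipate up to terms in which `χ` is differentiated or commuted with a mollifier; transport and
pressure produce only such terms. With N = ‖u₀‖₂, G = ∑ ‖∂ⱼu‖₂, Q = ‖|u|²‖₂, A ≤ MA and κ the first
moment of ∇ρ, the weighted energy grows at rate at most L N ((ν + MA + MA κ) G + 4 Q). The Sobolev
inequality `exists_sobolev` bounds Q by K (N + G)², so the rate is at most L times an affine
function of ‖∇u‖₂² (`IsEvolution.weighted_rate_le`). The global energy inequality bounds the time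
integral of ‖∇u‖₂² by N² / (2ν) (`IsEvolution.lintegral_gradEnergy_le`), which makes φ affine in t.

Uniformity in ε. The mollified stress is moved onto the test field by adjunction; what remains
besides a nonnegative dissipation is the commutator of `ζ` with the differentiated mollifier, of
size L ∫ |∂ⱼρ_ε| |z| (`IsSlice.commutator_bound`). This moment is invariant under scaling
(`gradMoment_scaledKernel`). Mollifying the datum costs L ε ∫ ρ |z| N² (`integral_weight_kconv_le`),
whence the role of ε₀.

Pressure. No decay or normalization of p is given. Testing with gradients and using ‖D²ψ‖₂ = ‖Δψ‖₂
yields |∫ p Δψ| ≤ F ‖Δψ‖₂, where F is the L² norm of the flux. This does not see a harmonic part of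
p, so it does not by itself bound ∫ p div (ζu). The harmonic part is excluded by the equation
(`IsEvolution.abs_integral_pressure_vecDiv_kconv_le`): approximate ζu in L² by Laplacians of test
fields, mollify, and test the momentum equation with the remainders. Their pairings with u tend to
zero while the time derivatives converge uniformly to the possible defect, which therefore vanishes.
Density of Laplacians in L² (`exists_lap_approx`) rests on the vanishing of square integrable
harmonic functions, proved by the Caccioppoli inequality.

Gradient. The gradient of u(t) is not assumed square integrable for t > 0. The global energy
inequality is therefore first derived with cutoffs and constants depending on everything, which
disappear as the cutoff radius grows, and the rate bound is stated in [0, ∞]. -/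

noncomputable section

/-! ### Partial derivatives and the divergence theorem on ℝ³. -/

section PartialDerivatives

variable {E : Type*} [NormedAddCommGroup E] [InnerProductSpace ℝ E]

/-- The `j`-th partial derivative. -/
def pd (j : Fin 3) (f : R3 → E) (x : R3) : E := fderiv ℝ f x (stdVec j)

/-- The Laplacian as the sum of the second partial derivatives. -/
def lap (f : R3 → E) (x : R3) : E := ∑ j : Fin 3, pd j (pd j f) x

@[simp] lemma norm_stdVec (j : Fin 3) : ‖stdVec j‖ = 1 := by
  simp [stdVec]

lemma norm_pd_le (j : Fin 3) (f : R3 → E) (x : R3) : ‖pd j f x‖ ≤ ‖fderiv ℝ f x‖ := by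
  simpa [pd] using (fderiv ℝ f x).le_opNorm (stdVec j)

lemma contDiff_pd {m n : WithTop ℕ∞} {f : R3 → E} (hf : ContDiff ℝ n f) (h : m + 1 ≤ n)
    (j : Fin 3) : ContDiff ℝ m (pd j f) :=
  (hf.fderiv_right h).clm_apply contDiff_const

lemma continuous_pd {f : R3 → E} (hf : ContDiff ℝ 1 f) (j : Fin 3) : Continuous (pd j f) :=
  (contDiff_pd (m := 0) hf (by norm_num) j).continuous

lemma contDiff_pd_top {f : R3 → E} (hf : ContDiff ℝ ∞ f) (j : Fin 3) : ContDiff ℝ ∞ (pd j f) :=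
  contDiff_pd hf (by simp) j

lemma contDiff_pd_one {f : R3 → E} (hf : ContDiff ℝ 2 f) (j : Fin 3) : ContDiff ℝ 1 (pd j f) :=
  contDiff_pd hf (by norm_num) j

lemma contDiff_lap_top {f : R3 → E} (hf : ContDiff ℝ ∞ f) : ContDiff ℝ ∞ (lap f) :=
  ContDiff.sum fun j _ => contDiff_pd_top (contDiff_pd_top hf j) j

lemma continuous_lap {f : R3 → E} (hf : ContDiff ℝ 2 f) : Continuous (lap f) :=
  continuous_finsetSum _ fun j _ => continuous_pd (contDiff_pd_one hf j) j

lemma hasCompactSupport_pd {f : R3 → E} (hf : HasCompactSupport f) (j : Fin 3) :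
    HasCompactSupport (pd j f) :=
  hf.fderiv_apply ℝ (stdVec j)

lemma hasCompactSupport_finset_sum {ι X F : Type*} [TopologicalSpace X] [AddCommMonoid F]
    (s : Finset ι) {f : ι → X → F} (h : ∀ i ∈ s, HasCompactSupport (f i)) :
    HasCompactSupport (fun x => ∑ i ∈ s, f i x) := by
  classical
  induction s using Finset.induction_on with
  | empty => exact (HasCompactSupport.zero : HasCompactSupport (0 : X → F))
  | insert a s ha ih =>
    simp only [Finset.sum_insert ha]
    exact (h a (by simp)).add (ih fun i hi => h i (by simp [hi]))

lemma hasCompactSupport_lap {f : R3 → E} (hf : HasCompactSupport f) :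
    HasCompactSupport (lap f) :=
  hasCompactSupport_finset_sum _ fun j _ => hasCompactSupport_pd (hasCompactSupport_pd hf j) j

lemma pd_add {f g : R3 → E} {x : R3} (hf : DifferentiableAt ℝ f x) (hg : DifferentiableAt ℝ g x)
    (j : Fin 3) : pd j (fun y => f y + g y) x = pd j f x + pd j g x := by
  simp [pd, fderiv_fun_add hf hg]

lemma pd_sub {f g : R3 → E} {x : R3} (hf : DifferentiableAt ℝ f x) (hg : DifferentiableAt ℝ g x)
    (j : Fin 3) : pd j (fun y => f y - g y) x = pd j f x - pd j g x := by
  simp [pd, fderiv_fun_sub hf hg]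

lemma pd_sum {ι : Type*} {s : Finset ι} {f : ι → R3 → E} {x : R3}
    (hf : ∀ i ∈ s, DifferentiableAt ℝ (f i) x)
    (j : Fin 3) : pd j (fun y => ∑ i ∈ s, f i y) x = ∑ i ∈ s, pd j (f i) x := by
  simp [pd, fderiv_fun_sum hf]

lemma pd_smul {c : R3 → ℝ} {f : R3 → E} {x : R3} (hc : DifferentiableAt ℝ c x)
    (hf : DifferentiableAt ℝ f x) (j : Fin 3) :
    pd j (fun y => c y • f y) x = c x • pd j f x + pd j c x • f x := by
  simp [pd, fderiv_fun_smul hc hf]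

lemma pd_mul {c d : R3 → ℝ} {x : R3} (hc : DifferentiableAt ℝ c x)
    (hd : DifferentiableAt ℝ d x) (j : Fin 3) :
    pd j (fun y => c y * d y) x = c x * pd j d x + pd j c x * d x :=
  pd_smul hc hd j

lemma pd_inner {f g : R3 → E} {x : R3} (hf : DifferentiableAt ℝ f x)
    (hg : DifferentiableAt ℝ g x) (j : Fin 3) :
    pd j (fun y => inner ℝ (f y) (g y)) x = inner ℝ (f x) (pd j g x) + inner ℝ (pd j f x) (g x) := by
  simp [pd, fderiv_inner_apply ℝ hf hg]

lemma pd_const (c : E) (j : Fin 3) (x : R3) : pd j (fun _ => c) x = 0 := by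
  simp [pd]

lemma pd_apply {f : R3 → R3} {x : R3} (hf : DifferentiableAt ℝ f x) (i j : Fin 3) :
    pd j (fun y => f y i) x = pd j f x i := by
  have h := (EuclideanSpace.proj (𝕜 := ℝ) i).hasFDerivAt.comp x hf.hasFDerivAt
  have h2 : HasFDerivAt (fun y => f y i) ((EuclideanSpace.proj (𝕜 := ℝ) i).comp (fderiv ℝ f x)) x := h
  simp [pd, h2.fderiv]

lemma pd_clm_comp {F : Type*} [NormedAddCommGroup F] [InnerProductSpace ℝ F] (l : E →L[ℝ] F)
    {f : R3 → E} {x : R3} (hf : DifferentiableAt ℝ f x) (j : Fin 3) :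
    pd j (fun y => l (f y)) x = l (pd j f x) := by
  have h : HasFDerivAt (fun y => l (f y)) (l.comp (fderiv ℝ f x)) x :=
    l.hasFDerivAt.comp x hf.hasFDerivAt
  simp [pd, h.fderiv]

lemma sum_smul_stdVec (v : R3) : ∑ j, v j • stdVec j = v := by
  ext i
  simp [stdVec, Finset.sum_apply, Pi.single_apply]

lemma fderiv_apply_eq_sum_pd (f : R3 → E) (x v : R3) :
    fderiv ℝ f x v = ∑ j, v j • pd j f x := by
  conv_lhs => rw [← sum_smul_stdVec v]
  simp [map_sum, pd]

lemma vecDiv_eq_sum_pd (u : R3 → R3) (x : R3) : vecDiv u x = ∑ j, pd j u x j := rfl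

lemma pd_pd_eq {f : R3 → E} (hf : ContDiff ℝ 2 f) (i j : Fin 3) (x : R3) :
    pd i (pd j f) x = fderiv ℝ (fderiv ℝ f) x (stdVec i) (stdVec j) := by
  have h : DifferentiableAt ℝ (fderiv ℝ f) x :=
    ((hf.fderiv_right (m := 1) (by norm_num)).differentiable (by norm_num)) x
  have := (h.hasFDerivAt.clm_apply (hasFDerivAt_const (stdVec j) x)).fderiv
  show fderiv ℝ (fun y => fderiv ℝ f y (stdVec j)) x (stdVec i) = _
  rw [this]; simp

lemma pd_comm {f : R3 → E} (hf : ContDiff ℝ 2 f) (i j : Fin 3) (x : R3) :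
    pd i (pd j f) x = pd j (pd i f) x := by
  rw [pd_pd_eq hf, pd_pd_eq hf]
  exact (hf.contDiffAt.isSymmSndFDerivAt (by simp)) _ _

lemma laplacian_eq_lap {f : R3 → E} (hf : ContDiff ℝ 2 f) (x : R3) :
    Laplacian.laplacian f x = lap f x := by
  rw [InnerProductSpace.laplacian_eq_iteratedFDeriv_orthonormalBasis f (EuclideanSpace.basisFun (Fin 3) ℝ)]
  simp only [lap]
  refine Finset.sum_congr rfl fun j _ => ?_
  rw [pd_pd_eq hf, iteratedFDeriv_two_apply]
  simp [stdVec]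

lemma gradient_apply_eq_pd {p : R3 → ℝ} (x : R3) (j : Fin 3) :
    gradient p x j = pd j p x := by
  have : inner ℝ (gradient p x) (stdVec j) = fderiv ℝ p x (stdVec j) := by
    simp [gradient]
  rw [pd, ← this, stdVec, EuclideanSpace.inner_single_right]
  simp

lemma integral_pd_eq_zero [CompleteSpace E] {f : R3 → E} (hf : ContDiff ℝ 1 f)
    (hc : HasCompactSupport f) (j : Fin 3) : ∫ x, pd j f x = 0 := by
  have h := integral_smul_fderiv_eq_neg_fderiv_smul_of_integrable (μ := (volume : Measure R3))
    (f := fun _ => (1 : ℝ)) (g := f) (v := stdVec j) (by simp)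
    (by
      simp only [one_smul]
      exact (continuous_pd hf j).integrable_of_hasCompactSupport (hasCompactSupport_pd hc j))
    (by simpa using hf.continuous.integrable_of_hasCompactSupport hc)
    (fun x _ => differentiableAt_const _) (fun x _ => (hf.differentiable (by norm_num)) x)
  simpa [pd] using h

/-- The divergence theorem for compactly supported fields. -/
lemma integral_sum_pd_eq_zero {f : Fin 3 → R3 → ℝ} (hf : ∀ j, ContDiff ℝ 1 (f j))
    (hc : ∀ j, HasCompactSupport (f j)) : ∫ x, ∑ j, pd j (f j) x = 0 := by
  rw [integral_finsetSum]
  · simp [integral_pd_eq_zero (hf _) (hc _)]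
  · exact fun j _ => (continuous_pd (hf j) j).integrable_of_hasCompactSupport
      (hasCompactSupport_pd (hc j) j)

end PartialDerivatives

/-! ### Real-valued L² norms and the Cauchy-Schwarz inequality. -/

section SquareIntegrable

variable {E : Type*} [NormedAddCommGroup E] [InnerProductSpace ℝ E]
variable {F : Type*} [NormedAddCommGroup F] [InnerProductSpace ℝ F]

/-- The `L²` norm, as a real number. -/
def l2 (f : R3 → E) : ℝ := (eLpNorm f 2 volume).toReal

lemma l2_nonneg (f : R3 → E) : 0 ≤ l2 f := ENNReal.toReal_nonneg

lemma l2_eq_norm {f : R3 → E} (hf : MemLp f 2 volume) : l2 f = ‖hf.toLp f‖ :=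
  (Lp.norm_toLp f hf).symm

lemma integrable_norm_sq {f : R3 → E} (hf : MemLp f 2 volume) :
    Integrable (fun x => ‖f x‖ ^ 2) :=
  (memLp_two_iff_integrable_sq_norm hf.1).1 hf

lemma integrable_inner {f g : R3 → E} (hf : MemLp f 2 volume) (hg : MemLp g 2 volume) :
    Integrable (fun x => (inner ℝ (f x) (g x) : ℝ)) := by
  refine (L2.integrable_inner (𝕜 := ℝ) (hf.toLp f) (hg.toLp g)).congr ?_
  filter_upwards [hf.coeFn_toLp, hg.coeFn_toLp] with x h1 h2
  rw [h1, h2]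

lemma inner_toLp_toLp {f g : R3 → E} (hf : MemLp f 2 volume) (hg : MemLp g 2 volume) :
    (inner ℝ (hf.toLp f) (hg.toLp g) : ℝ) = ∫ x, inner ℝ (f x) (g x) := by
  rw [L2.inner_def]
  refine integral_congr_ae ?_
  filter_upwards [hf.coeFn_toLp, hg.coeFn_toLp] with x h1 h2
  rw [h1, h2]

lemma l2_sq {f : R3 → E} (hf : MemLp f 2 volume) : l2 f ^ 2 = ∫ x, ‖f x‖ ^ 2 := by
  rw [l2_eq_norm hf, ← real_inner_self_eq_norm_sq, inner_toLp_toLp]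
  simp

lemma abs_integral_inner_le {f g : R3 → E} (hf : MemLp f 2 volume) (hg : MemLp g 2 volume) :
    |∫ x, (inner ℝ (f x) (g x) : ℝ)| ≤ l2 f * l2 g := by
  rw [← inner_toLp_toLp hf hg, l2_eq_norm hf, l2_eq_norm hg]
  exact abs_real_inner_le_norm _ _

lemma l2_norm (f : R3 → E) : l2 (fun x => ‖f x‖) = l2 f := by
  simp [l2]

lemma l2_mono {f : R3 → E} {g : R3 → F} (hg : MemLp g 2 volume)
    (h : ∀ᵐ x ∂(volume : Measure R3), ‖f x‖ ≤ ‖g x‖) : l2 f ≤ l2 g :=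
  ENNReal.toReal_mono hg.2.ne (eLpNorm_mono_ae h)

lemma integrable_norm_mul_norm {f : R3 → E} {g : R3 → F} (hf : MemLp f 2 volume)
    (hg : MemLp g 2 volume) : Integrable (fun x => ‖f x‖ * ‖g x‖) := by
  simpa [mul_comm] using integrable_inner hf.norm hg.norm

lemma integral_norm_mul_norm_le {f : R3 → E} {g : R3 → F} (hf : MemLp f 2 volume)
    (hg : MemLp g 2 volume) : ∫ x, ‖f x‖ * ‖g x‖ ≤ l2 f * l2 g := by
  have := (le_abs_self _).trans (abs_integral_inner_le hf.norm hg.norm)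
  rw [l2_norm, l2_norm] at this
  simpa [mul_comm] using this

lemma l2_add_le {f g : R3 → E} (hf : MemLp f 2 volume) (hg : MemLp g 2 volume) :
    l2 (fun x => f x + g x) ≤ l2 f + l2 g := by
  have h : l2 (fun x => f x + g x) = ‖(hf.add hg).toLp (f + g)‖ := l2_eq_norm (hf.add hg)
  rw [h, l2_eq_norm hf, l2_eq_norm hg, MemLp.toLp_add]
  exact norm_add_le _ _

lemma l2_sub_le {f g : R3 → E} (hf : MemLp f 2 volume) (hg : MemLp g 2 volume) :
    l2 (fun x => f x - g x) ≤ l2 f + l2 g := by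
  have h : l2 (fun x => f x - g x) = ‖(hf.sub hg).toLp (f - g)‖ := l2_eq_norm (hf.sub hg)
  rw [h, l2_eq_norm hf, l2_eq_norm hg, MemLp.toLp_sub]
  exact norm_sub_le _ _

lemma abs_l2_sub_l2_le {f g : R3 → E} (hf : MemLp f 2 volume) (hg : MemLp g 2 volume) :
    |l2 f - l2 g| ≤ l2 (fun x => f x - g x) := by
  have h : l2 (fun x => f x - g x) = ‖(hf.sub hg).toLp (f - g)‖ := l2_eq_norm (hf.sub hg)
  rw [h, l2_eq_norm hf, l2_eq_norm hg, MemLp.toLp_sub]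
  exact abs_norm_sub_norm_le _ _

lemma l2_sum_le {ι : Type*} (s : Finset ι) {f : ι → R3 → E}
    (hf : ∀ i ∈ s, MemLp (f i) 2 volume) :
    l2 (fun x => ∑ i ∈ s, f i x) ≤ ∑ i ∈ s, l2 (f i) := by
  classical
  induction s using Finset.induction_on with
  | empty => simp [l2]
  | insert a s ha ih =>
    simp only [Finset.sum_insert ha]
    have hs : MemLp (fun x => ∑ i ∈ s, f i x) 2 volume :=
      memLp_finsetSum s fun i hi => hf i (by simp [hi])
    exact (l2_add_le (hf a (by simp)) hs).trans
      (by gcongr; exact ih fun i hi => hf i (by simp [hi]))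

lemma l2_const_mul (c : ℝ) (f : R3 → E) : l2 (fun x => c • f x) = |c| * l2 f := by
  have : eLpNorm (fun x => c • f x) 2 volume = _ := eLpNorm_const_smul c f 2 (volume : Measure R3)
  rw [l2, this]
  simp [l2, ENNReal.toReal_mul]

/-- A pointwise bound by a multiple of a square integrable function. -/
lemma l2_le_of_norm_le {f : R3 → E} {g : R3 → F} {c : ℝ} (hc : 0 ≤ c) (hg : MemLp g 2 volume)
    (h : ∀ᵐ x ∂(volume : Measure R3), ‖f x‖ ≤ c * ‖g x‖) : l2 f ≤ c * l2 g := by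
  have h1 : l2 f ≤ l2 (fun x => c • g x) := by
    refine l2_mono (hg.const_smul c) ?_
    filter_upwards [h] with x hx
    rwa [norm_smul, Real.norm_of_nonneg hc]
  rwa [l2_const_mul, abs_of_nonneg hc] at h1

lemma l2_le_of_eLpNorm_le {f : R3 → E} {M : ℝ} (h : eLpNorm f 2 volume ≤ ENNReal.ofReal M) :
    l2 f ≤ max M 0 := by
  have := ENNReal.toReal_mono ENNReal.ofReal_ne_top h
  rwa [ENNReal.toReal_ofReal'] at this

lemma memLp_of_compactSupport {f : R3 → E} (hf : Continuous f) (hc : HasCompactSupport f) :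
    MemLp f 2 volume :=
  hf.memLp_of_hasCompactSupport hc

lemma locallyIntegrable_of_memLp {f : R3 → E} (hf : MemLp f 2 volume) :
    LocallyIntegrable f volume :=
  hf.locallyIntegrable (by norm_num)

lemma l2_le_of_sq_le {f : R3 → E} (hf : MemLp f 2 volume) {c : ℝ} (hc : 0 ≤ c)
    (h : ∫ x, ‖f x‖ ^ 2 ≤ c ^ 2) : l2 f ≤ c := by
  rw [← l2_sq hf] at h
  exact (sq_le_sq₀ (l2_nonneg f) hc).1 h

end SquareIntegrable

/-! ### Convolution of a scalar kernel with a vector-valued function. -/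

section Convolution

variable {E : Type*} [NormedAddCommGroup E] [NormedSpace ℝ E]

/-- The convolution of a scalar kernel with a vector-valued function. -/
def kconv (k : R3 → ℝ) (U : R3 → E) (x : R3) : E := ∫ y, k (x - y) • U y

lemma mollify_eq_kconv (ρ : R3 → ℝ) (ε : ℝ) (U : R3 → E) :
    mollify ρ ε U = kconv (scaledKernel ρ ε) U := rfl

lemma kconv_eq_convolution (k : R3 → ℝ) (U : R3 → E) :
    kconv k U = convolution U k (ContinuousLinearMap.lsmul ℝ ℝ).flip volume := by
  ext x; simp [kconv, convolution]

lemma integrable_kconv {k : R3 → ℝ} (hk : Continuous k) (hkc : HasCompactSupport k)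
    {U : R3 → E} (hU : LocallyIntegrable U volume) (x : R3) :
    Integrable (fun y => k (x - y) • U y) :=
  hkc.convolutionExists_right (ContinuousLinearMap.lsmul ℝ ℝ).flip hU hk x

lemma continuous_kconv {k : R3 → ℝ} (hk : Continuous k) (hkc : HasCompactSupport k)
    {U : R3 → E} (hU : LocallyIntegrable U volume) : Continuous (kconv k U) := by
  rw [kconv_eq_convolution]
  exact hkc.continuous_convolution_right _ hU hk

lemma contDiff_kconv {n : ℕ∞} {k : R3 → ℝ} (hk : ContDiff ℝ n k) (hkc : HasCompactSupport k)
    {U : R3 → E} (hU : LocallyIntegrable U volume) : ContDiff ℝ n (kconv k U) := by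
  rw [kconv_eq_convolution]
  exact hkc.contDiff_convolution_right _ hU hk

end Convolution

/-! ### Derivatives, L² bounds and adjoints of convolution operators. -/

section ConvolutionInequalities

variable {E : Type*} [NormedAddCommGroup E] [InnerProductSpace ℝ E]

lemma pd_kconv {k : R3 → ℝ} (hk : ContDiff ℝ 1 k) (hkc : HasCompactSupport k)
    {U : R3 → E} (hU : LocallyIntegrable U volume) (j : Fin 3) :
    pd j (kconv k U) = kconv (pd j k) U := by
  ext x
  rw [kconv_eq_convolution k, kconv_eq_convolution (pd j k), pd,
    (hkc.hasFDerivAt_convolution_right (ContinuousLinearMap.lsmul ℝ ℝ).flip hU hk x).fderiv,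
    convolution_precompR_apply _ hU (hkc.fderiv ℝ) (hk.continuous_fderiv (by norm_num))]
  rfl

lemma kconv_eq_swap (k : R3 → ℝ) (U : R3 → E) (x : R3) : kconv k U x = ∫ z, k z • U (x - z) := by
  rw [kconv, ← integral_sub_left_eq_self _ volume x]
  simp

lemma kconv_sub {k : R3 → ℝ} (hk : Continuous k) (hkc : HasCompactSupport k)
    {U W : R3 → E} (hU : LocallyIntegrable U volume) (hW : LocallyIntegrable W volume) (x : R3) :
    kconv k (fun y => U y - W y) x = kconv k U x - kconv k W x := by
  simp only [kconv, smul_sub]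
  exact integral_sub (integrable_kconv hk hkc hU x) (integrable_kconv hk hkc hW x)

lemma hasCompactSupport_kconv {k : R3 → ℝ} (hkc : HasCompactSupport k)
    {U : R3 → E} (hU : HasCompactSupport U) : HasCompactSupport (kconv k U) := by
  rw [kconv_eq_convolution]
  exact hU.convolution _ hkc

/-- Differentiation may be moved to the second factor. -/
lemma kconv_pd_right [CompleteSpace E] {k : R3 → ℝ} (hk : ContDiff ℝ 1 k)
    (hkc : HasCompactSupport k) {U : R3 → E} (hU : ContDiff ℝ 1 U) (j : Fin 3) (x : R3) :
    kconv k (pd j U) x = kconv (pd j k) U x := by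
  have hkx : ContDiff ℝ 1 fun y => k (x - y) := hk.comp (contDiff_const.sub contDiff_id)
  have hkxc : HasCompactSupport fun y => k (x - y) :=
    hkc.comp_homeomorph (Homeomorph.subLeft x)
  have h0 := integral_pd_eq_zero (hkx.smul hU) (hkxc.smul_right (f' := U)) j
  have hpd : ∀ y, pd j (fun y => k (x - y)) y = - pd j k (x - y) := by
    intro y
    have h1 := (hk.differentiable (by norm_num) (x - y)).hasFDerivAt.comp y
      ((hasFDerivAt_const x y).sub (hasFDerivAt_id y))
    have h2 : fderiv ℝ (fun y => k (x - y)) y = _ := h1.fderiv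
    simp [pd, h2]
  have h1 : ∀ y, pd j ((fun y => k (x - y)) • U) y
      = k (x - y) • pd j U y - pd j k (x - y) • U y := by
    intro y
    have := pd_smul (hkx.differentiable (by norm_num) y) (hU.differentiable (by norm_num) y) j
    rw [hpd] at this
    rw [sub_eq_add_neg, ← neg_smul]; exact this
  simp only [h1] at h0
  rw [integral_sub (integrable_kconv hk.continuous hkc
      (continuous_pd hU j).locallyIntegrable x)
    (integrable_kconv (continuous_pd hk j) (hasCompactSupport_pd hkc j)
      hU.continuous.locallyIntegrable x), sub_eq_zero] at h0
  exact h0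

lemma integrable_of_compactSupport {F : Type*} [NormedAddCommGroup F] {f : R3 → F}
    (hf : Continuous f) (hc : HasCompactSupport f) : Integrable f :=
  hf.integrable_of_hasCompactSupport hc

/-- The convolution of integrable functions. -/
lemma integrable_integral_kconv {k g : R3 → ℝ} (hk : Integrable k) (hg : Integrable g) :
    Integrable (kconv k g) ∧ ∫ x, kconv k g x = (∫ x, k x) * ∫ x, g x := by
  rw [kconv_eq_convolution]
  refine ⟨hg.integrable_convolution _ hk, ?_⟩
  rw [integral_convolution _ hg hk]
  simp

/-- The Cauchy-Schwarz inequality for an average with respect to a kernel. -/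
lemma sq_kconv_norm_le {k : R3 → ℝ} (hk : Continuous k) (hkc : HasCompactSupport k)
    (hk0 : ∀ x, 0 ≤ k x) {U : R3 → E} (hU : MemLp U 2 volume) (x : R3) :
    kconv k (fun y => ‖U y‖) x ^ 2 ≤ (∫ z, k z) * kconv k (fun y => ‖U y‖ ^ 2) x := by
  -- Write k = √k · √k and apply Cauchy-Schwarz to √k and √k |U|, so that only the mass of `k`
  -- appears in the bound.
  have hs : Continuous fun y => Real.sqrt (k (x - y)) := by fun_prop
  have hkxc : HasCompactSupport fun y => k (x - y) := hkc.comp_homeomorph (Homeomorph.subLeft x)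
  have hsc : HasCompactSupport fun y => Real.sqrt (k (x - y)) :=
    hkxc.comp_left (g := Real.sqrt) Real.sqrt_zero
  have h1 : MemLp (fun y => Real.sqrt (k (x - y))) 2 volume := memLp_of_compactSupport hs hsc
  obtain ⟨C, hC⟩ := hs.bounded_above_of_compact_support hsc
  have h2 : MemLp (fun y => Real.sqrt (k (x - y)) • ‖U y‖) 2 volume := by
    refine hU.norm.of_le_mul (c := C) (hs.aestronglyMeasurable.smul hU.norm.1)
      (Eventually.of_forall fun y => ?_)
    rw [norm_smul]; gcongr; exact hC y
  have h3 := integral_norm_mul_norm_le h1 h2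
  have e1 : ∀ y, ‖Real.sqrt (k (x - y))‖ * ‖Real.sqrt (k (x - y)) • ‖U y‖‖
      = k (x - y) • ‖U y‖ := by
    intro y
    rw [norm_smul, norm_norm, ← mul_assoc, Real.norm_of_nonneg (Real.sqrt_nonneg _),
      Real.mul_self_sqrt (hk0 _), smul_eq_mul]
  simp only [e1] at h3
  have h4 : 0 ≤ kconv k (fun y => ‖U y‖) x :=
    integral_nonneg fun y => smul_nonneg (hk0 _) (norm_nonneg _)
  have h5 := pow_le_pow_left₀ h4 h3 2
  rw [mul_pow, l2_sq h1, l2_sq h2] at h5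
  have e2 : ∀ y, ‖Real.sqrt (k (x - y))‖ ^ 2 = k (x - y) := by
    intro y
    rw [Real.norm_of_nonneg (Real.sqrt_nonneg _), Real.sq_sqrt (hk0 _)]
  have e3 : ∀ y, ‖Real.sqrt (k (x - y)) • ‖U y‖‖ ^ 2 = k (x - y) • ‖U y‖ ^ 2 := by
    intro y
    rw [norm_smul, mul_pow, e2, norm_norm, smul_eq_mul]
  simp only [e2, e3] at h5
  rwa [integral_sub_left_eq_self k volume x] at h5

/-- Young's inequality in `L²` for a function dominated by a convolution. -/
lemma memLp_of_le_kconv {F : Type*} [NormedAddCommGroup F] [InnerProductSpace ℝ F]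
    {k : R3 → ℝ} (hk : Continuous k) (hkc : HasCompactSupport k)
    (hk0 : ∀ x, 0 ≤ k x) {U : R3 → E} (hU : MemLp U 2 volume) {h : R3 → F}
    (hm : AEStronglyMeasurable h volume) (hle : ∀ x, ‖h x‖ ≤ kconv k (fun y => ‖U y‖) x) :
    MemLp h 2 volume ∧ l2 h ≤ (∫ z, k z) * l2 U := by
  have hki := integrable_of_compactSupport hk hkc
  obtain ⟨hi, he⟩ := integrable_integral_kconv hki (integrable_norm_sq hU)
  -- Integrating this pointwise bound factors the convolution into a product of integrals and gives
  -- the square of the mass of `k`.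
  have hsq : ∀ x, ‖h x‖ ^ 2 ≤ (∫ z, k z) * kconv k (fun y => ‖U y‖ ^ 2) x := fun x =>
    (pow_le_pow_left₀ (norm_nonneg _) (hle x) 2).trans (sq_kconv_norm_le hk hkc hk0 hU x)
  have hint : Integrable fun x => ‖h x‖ ^ 2 := by
    refine (hi.const_mul (∫ z, k z)).mono' (hm.norm.pow 2) (Eventually.of_forall fun x => ?_)
    rw [Real.norm_of_nonneg (by positivity)]; exact hsq x
  have hL : MemLp h 2 volume := (memLp_two_iff_integrable_sq_norm hm).2 hint
  refine ⟨hL, l2_le_of_sq_le hL (mul_nonneg (integral_nonneg hk0) (l2_nonneg _)) ?_⟩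
  calc ∫ x, ‖h x‖ ^ 2 ≤ ∫ x, (∫ z, k z) * kconv k (fun y => ‖U y‖ ^ 2) x :=
        integral_mono hint (hi.const_mul _) hsq
    _ = ((∫ z, k z) * l2 U) ^ 2 := by
        rw [integral_const_mul, he, mul_pow, l2_sq hU]; ring

lemma norm_kconv_le (k : R3 → ℝ) (U : R3 → E) (x : R3) :
    ‖kconv k U x‖ ≤ kconv (fun z => |k z|) (fun y => ‖U y‖) x := by
  refine (norm_integral_le_integral_norm _).trans (le_of_eq ?_)
  simp [kconv, norm_smul]

lemma memLp_kconv {k : R3 → ℝ} (hk : Continuous k) (hkc : HasCompactSupport k)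
    {U : R3 → E} (hU : MemLp U 2 volume) :
    MemLp (kconv k U) 2 volume ∧ l2 (kconv k U) ≤ (∫ z, |k z|) * l2 U :=
  memLp_of_le_kconv hk.abs (hkc.comp_left (g := fun t : ℝ => |t|) abs_zero) (fun _ => abs_nonneg _)
    hU (continuous_kconv hk hkc (locallyIntegrable_of_memLp hU)).aestronglyMeasurable
    (norm_kconv_le k U)

lemma norm_kconv_le_of_bound {k : R3 → ℝ} (hk : Continuous k) (hkc : HasCompactSupport k)
    {U : R3 → E} {M : ℝ} (hM : ∀ x, ‖U x‖ ≤ M) (x : R3) :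
    ‖kconv k U x‖ ≤ (∫ z, |k z|) * M := by
  have hi : Integrable fun y => |k (x - y)| :=
    ((integrable_of_compactSupport hk hkc).comp_sub_left x).abs
  refine (norm_integral_le_of_norm_le (hi.mul_const M) (Eventually.of_forall fun y => ?_)).trans
    (le_of_eq ?_)
  · rw [norm_smul, Real.norm_eq_abs]; gcongr; exact hM y
  · rw [integral_mul_const, integral_sub_left_eq_self (fun z => |k z|) volume x]

/-- The adjoint of a convolution operator. -/
lemma integral_inner_kconv {k : R3 → ℝ} (hk : Continuous k) (hkc : HasCompactSupport k)
    {U W : R3 → E} (hU : LocallyIntegrable U volume) (hW : Continuous W)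
    (hWc : HasCompactSupport W) [CompleteSpace E] :
    ∫ x, (inner ℝ (W x) (kconv k U x) : ℝ) =
      ∫ y, (inner ℝ (∫ x, k (x - y) • W x) (U y) : ℝ) := by
  obtain ⟨C, hC⟩ := hk.bounded_above_of_compact_support hkc
  have hC0 : 0 ≤ C := (norm_nonneg _).trans (hC 0)
  -- `U` is only locally integrable. The double integrand vanishes unless y lies in the compact set
  -- supp W - supp k, so cutting `U` off to it gives the integrable majorant required by Fubini.
  set K : Set R3 := (fun p : R3 × R3 => p.1 - p.2) '' (tsupport W ×ˢ tsupport k) with hK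
  have hKc : IsCompact K := (hWc.prod hkc).image (by fun_prop)
  have hUK : IntegrableOn U K := hU.integrableOn_isCompact hKc
  have hWi : Integrable W := integrable_of_compactSupport hW hWc
  have hdom : Integrable (fun p : R3 × R3 => C * (‖W p.1‖ * ‖K.indicator U p.2‖))
      (volume.prod volume) :=
    (hWi.norm.mul_prod (hUK.integrable_indicator hKc.measurableSet).norm).const_mul C
  have hint : Integrable (fun p : R3 × R3 => (inner ℝ (W p.1) (k (p.1 - p.2) • U p.2) : ℝ))
      (volume.prod volume) := by
    refine hdom.mono' ?_ (Eventually.of_forall fun p => ?_)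
    · refine AEStronglyMeasurable.inner (𝕜 := ℝ) ?_ ?_
      · exact (hW.comp continuous_fst).aestronglyMeasurable
      · exact (hk.comp (continuous_fst.sub continuous_snd)).aestronglyMeasurable.smul
          hU.aestronglyMeasurable.comp_snd
    · by_cases h : W p.1 = 0 ∨ k (p.1 - p.2) = 0
      · have : (inner ℝ (W p.1) (k (p.1 - p.2) • U p.2) : ℝ) = 0 := by
          rcases h with h | h <;> simp [h]
        rw [this, norm_zero]; positivity
      · push Not at h
        have hp : p.2 ∈ K := ⟨(p.1, p.1 - p.2), ⟨subset_tsupport _ h.1, subset_tsupport _ h.2⟩,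
          by simp⟩
        rw [indicator_of_mem hp]
        calc ‖(inner ℝ (W p.1) (k (p.1 - p.2) • U p.2) : ℝ)‖
            ≤ ‖W p.1‖ * ‖k (p.1 - p.2) • U p.2‖ := norm_inner_le_norm _ _
          _ ≤ ‖W p.1‖ * (C * ‖U p.2‖) := by
              rw [norm_smul]; gcongr; exact hC _
          _ = C * (‖W p.1‖ * ‖U p.2‖) := by ring
  calc ∫ x, (inner ℝ (W x) (kconv k U x) : ℝ)
      = ∫ x, ∫ y, (inner ℝ (W x) (k (x - y) • U y) : ℝ) := by
        refine integral_congr_ae (Eventually.of_forall fun x => ?_)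
        exact (integral_inner (integrable_kconv hk hkc hU x) (W x)).symm
    _ = ∫ y, ∫ x, (inner ℝ (W x) (k (x - y) • U y) : ℝ) := integral_integral_swap hint
    _ = _ := by
        refine integral_congr_ae (Eventually.of_forall fun y => ?_)
        have hi : Integrable fun x => k (x - y) • W x :=
          integrable_of_compactSupport (by fun_prop) (hWc.smul_left)
        have h2 := integral_inner (𝕜 := ℝ) hi (U y)
        simp only
        rw [real_inner_comm, ← h2]
        refine integral_congr_ae (Eventually.of_forall fun x => ?_)
        simp only [inner_smul_right, real_inner_comm (U y)]

end ConvolutionInequalities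

/-! ### Interior and exterior cutoff functions. -/

section Cutoffs

/-- A smooth bump function equal to one on the unit ball. -/
def unitBump : ContDiffBump (0 : R3) := ⟨1, 2, one_pos, one_lt_two⟩

/-- A smooth compactly supported cutoff equal to one on the ball of radius `R`. -/
def cutoff (R : ℝ) (x : R3) : ℝ := unitBump (R⁻¹ • x)

lemma contDiff_cutoff (R : ℝ) {n : ℕ∞} : ContDiff ℝ n (cutoff R) :=
  (unitBump.contDiff (n := n)).comp (contDiff_const_smul R⁻¹)

lemma cutoff_nonneg (R : ℝ) (x : R3) : 0 ≤ cutoff R x := unitBump.nonneg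

lemma cutoff_le_one (R : ℝ) (x : R3) : cutoff R x ≤ 1 := unitBump.le_one

lemma cutoff_eq_one {R : ℝ} (hR : 0 < R) {x : R3} (hx : ‖x‖ ≤ R) : cutoff R x = 1 := by
  refine unitBump.one_of_mem_closedBall ?_
  rw [mem_closedBall_zero_iff, norm_smul, norm_inv, Real.norm_of_nonneg hR.le]
  show R⁻¹ * ‖x‖ ≤ 1
  rw [inv_mul_le_iff₀ hR]; simpa using hx

lemma cutoff_eq_zero {R : ℝ} (hR : 0 < R) {x : R3} (hx : 2 * R ≤ ‖x‖) : cutoff R x = 0 := by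
  refine unitBump.zero_of_le_dist ?_
  rw [dist_zero_right, norm_smul, norm_inv, Real.norm_of_nonneg hR.le]
  show 2 ≤ R⁻¹ * ‖x‖
  rw [le_inv_mul_iff₀ hR]; linarith

lemma hasCompactSupport_cutoff {R : ℝ} (hR : 0 < R) : HasCompactSupport (cutoff R) := by
  refine HasCompactSupport.intro (isCompact_closedBall (0 : R3) (2 * R)) fun x hx => ?_
  refine cutoff_eq_zero hR ?_
  rw [mem_closedBall_zero_iff] at hx
  linarith

lemma tendsto_cutoff (x : R3) : Tendsto (fun n : ℕ => cutoff (n + 1) x) atTop (𝓝 1) := by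
  refine tendsto_const_nhds.congr' ?_
  filter_upwards [eventually_ge_atTop ⌈‖x‖⌉₊] with n hn
  refine (cutoff_eq_one (by positivity) ?_).symm
  have : ‖x‖ ≤ n := (Nat.le_ceil _).trans (by exact_mod_cast hn)
  linarith

variable {E : Type*} [NormedAddCommGroup E] [InnerProductSpace ℝ E]

lemma pd_comp_smul (f : R3 → E) (c : ℝ) (j : Fin 3) (x : R3) :
    pd j (fun y => f (c • y)) x = c • pd j f (c • x) := by
  have : fderiv ℝ (fun y => f (c • y)) x = c • fderiv ℝ f (c • x) := by
    simpa using fderiv_comp_smul (𝕜 := ℝ) (f := f) (x := x) c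
  simp [pd, this]

/-- Scaling gives 1/R for the gradient and 1/R² for the Laplacian. For R ≥ 1 the second is weakened
to 1/R: both bounds only have to vanish as R → ∞. -/
lemma exists_cutoff_bound : ∃ C : ℝ, 0 ≤ C ∧ ∀ R : ℝ, 1 ≤ R → ∀ x : R3,
    ‖fderiv ℝ (cutoff R) x‖ ≤ C / R ∧ |lap (cutoff R) x| ≤ C / R := by
  have hc : HasCompactSupport (unitBump : R3 → ℝ) := unitBump.hasCompactSupport
  have hs : ContDiff ℝ 2 (unitBump : R3 → ℝ) := unitBump.contDiff (n := 2)
  obtain ⟨C₁, h₁⟩ := (hs.continuous_fderiv (by norm_num)).bounded_above_of_compact_support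
    (hc.fderiv ℝ)
  obtain ⟨C₂, h₂⟩ := (continuous_lap hs).bounded_above_of_compact_support (hasCompactSupport_lap hc)
  refine ⟨max C₁ C₂, le_max_of_le_left ((norm_nonneg _).trans (h₁ 0)), fun R hR x => ⟨?_, ?_⟩⟩
  · have : fderiv ℝ (cutoff R) x = R⁻¹ • fderiv ℝ (unitBump : R3 → ℝ) (R⁻¹ • x) :=
      fderiv_comp_smul (𝕜 := ℝ) (f := (unitBump : R3 → ℝ)) (x := x) R⁻¹
    rw [this, norm_smul, norm_inv, Real.norm_of_nonneg (by linarith), inv_mul_eq_div]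
    gcongr
    exact (h₁ _).trans (le_max_left _ _)
  · have e : lap (cutoff R) x = R⁻¹ * R⁻¹ * lap (unitBump : R3 → ℝ) (R⁻¹ • x) := by
      simp only [lap, Finset.mul_sum]
      refine Finset.sum_congr rfl fun j _ => ?_
      have h3 : pd j (cutoff R) = fun y => (fun z => R⁻¹ • pd j (unitBump : R3 → ℝ) z) (R⁻¹ • y) :=
        funext fun y => pd_comp_smul (unitBump : R3 → ℝ) R⁻¹ j y
      rw [h3, pd_comp_smul (fun z => R⁻¹ • pd j (unitBump : R3 → ℝ) z), pd_smul (differentiableAt_const _)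
        ((contDiff_pd_one hs j).differentiable (by norm_num) _), pd_const]
      simp [mul_assoc]
    have hR' : R⁻¹ ≤ 1 := inv_le_one_of_one_le₀ hR
    have hR0 : 0 ≤ R⁻¹ := by positivity
    rw [e, abs_mul, abs_of_nonneg (by positivity)]
    calc R⁻¹ * R⁻¹ * |lap (unitBump : R3 → ℝ) (R⁻¹ • x)| ≤ 1 * R⁻¹ * max C₁ C₂ := by
          gcongr
          exact (h₂ _).trans (le_max_right _ _)
      _ = _ := by rw [one_mul, inv_mul_eq_div]

/-- Smooth cutoffs vanishing in a ball and equal to one outside a larger ball. -/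
lemma exists_exterior_cutoff : ∃ C : ℝ, 0 ≤ C ∧ ∀ R₁ R₂ : ℝ, 0 < R₁ → R₁ < R₂ →
    ∃ χ : R3 → ℝ, ContDiff ℝ ∞ χ ∧ (∀ x, 0 ≤ χ x) ∧ (∀ x, χ x ≤ 1) ∧
      (∀ x, ‖x‖ ≤ R₁ → χ x = 0) ∧ (∀ x, R₂ ≤ ‖x‖ → χ x = 1) ∧
      ∀ x, ‖fderiv ℝ χ x‖ ≤ C / (R₂ - R₁) := by
  have hs : ContDiff ℝ 1 Real.smoothTransition := Real.smoothTransition.contDiff (n := 1)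
  have hd0 : ∀ s : ℝ, s ∉ Icc (0 : ℝ) 1 → deriv Real.smoothTransition s = 0 := by
    intro s hs
    rw [mem_Icc, not_and_or, not_le, not_le] at hs
    rcases hs with h | h
    · have : Real.smoothTransition =ᶠ[𝓝 s] fun _ => 0 := by
        filter_upwards [Iio_mem_nhds h] with r hr
        exact Real.smoothTransition.zero_of_nonpos hr.le
      rw [this.deriv_eq]; simp
    · have : Real.smoothTransition =ᶠ[𝓝 s] fun _ => 1 := by
        filter_upwards [Ioi_mem_nhds h] with r hr
        exact Real.smoothTransition.one_of_one_le hr.le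
      rw [this.deriv_eq]; simp
  obtain ⟨C, hC⟩ := (hs.continuous_deriv (by norm_num)).bounded_above_of_compact_support
    (HasCompactSupport.intro isCompact_Icc hd0)
  have hC0 : 0 ≤ C := (norm_nonneg _).trans (hC 0)
  refine ⟨2 * C, by positivity, fun R₁ R₂ h1 h12 => ?_⟩
  have hD : 0 < R₂ ^ 2 - R₁ ^ 2 := by nlinarith
  -- Squared norms keep the profile smooth at the origin. For |x| ≤ R₂ the gradient 2|x| / (R₂² -
  -- R₁²) is at most 2 / (R₂ - R₁), because R₂ ≤ R₁ + R₂; beyond R₂ the transition function is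
  -- constant.
  set q : R3 → ℝ := fun x => (‖x‖ ^ 2 - R₁ ^ 2) / (R₂ ^ 2 - R₁ ^ 2) with hq
  have hqs : ContDiff ℝ ∞ q := ((contDiff_norm_sq ℝ).sub contDiff_const).div_const _
  refine ⟨fun x => Real.smoothTransition (q x),
    (Real.smoothTransition.contDiff (n := ⊤)).comp hqs,
    fun x => Real.smoothTransition.nonneg _, fun x => Real.smoothTransition.le_one _,
    fun x hx => ?_, fun x hx => ?_, fun x => ?_⟩
  · refine Real.smoothTransition.zero_of_nonpos (div_nonpos_of_nonpos_of_nonneg ?_ hD.le)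
    nlinarith [norm_nonneg x]
  · refine Real.smoothTransition.one_of_one_le ((one_le_div hD).2 ?_)
    nlinarith [norm_nonneg x]
  · have hqd : HasFDerivAt q ((R₂ ^ 2 - R₁ ^ 2)⁻¹ • (2 • innerSL ℝ x)) x := by
      have := ((hasStrictFDerivAt_norm_sq x).hasFDerivAt.sub_const (R₁ ^ 2)).const_smul
        (R₂ ^ 2 - R₁ ^ 2)⁻¹
      refine this.congr_of_eventuallyEq (Eventually.of_forall fun y => ?_)
      simp [hq, div_eq_inv_mul]
    have hcomp := ((hs.differentiable (by norm_num) (q x)).hasDerivAt.comp_hasFDerivAt x hqd).fderiv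
    have hf : fderiv ℝ (fun x => Real.smoothTransition (q x)) x = _ := hcomp
    by_cases hx : R₂ < ‖x‖
    · have : deriv Real.smoothTransition (q x) = 0 := by
        refine hd0 _ fun h => ?_
        have := (div_le_one hD).1 h.2
        nlinarith [norm_nonneg x]
      rw [hf, this]; simp; exact div_nonneg (by positivity) (by linarith)
    · rw [hf, norm_smul, norm_smul, norm_inv, Real.norm_of_nonneg hD.le]
      have hn : ‖(2 • innerSL ℝ x : R3 →L[ℝ] ℝ)‖ ≤ 2 * R₂ := by
        refine (norm_nsmul_le).trans ?_
        rw [innerSL_apply_norm]; push_cast; linarith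
      calc ‖deriv Real.smoothTransition (q x)‖ * ((R₂ ^ 2 - R₁ ^ 2)⁻¹ * ‖(2 • innerSL ℝ x : R3 →L[ℝ] ℝ)‖)
          ≤ C * ((R₂ ^ 2 - R₁ ^ 2)⁻¹ * (2 * R₂)) := by
            gcongr
            exact hC _
        _ ≤ C * (2 / (R₂ - R₁)) := by
            gcongr
            rw [inv_mul_eq_div, div_le_div_iff₀ hD (by linarith)]
            nlinarith
        _ = _ := by ring

end Cutoffs

section Smoothness

variable {E : Type*} [NormedAddCommGroup E] [NormedSpace ℝ E]

lemma contDiff_two {f : R3 → E} (h : ContDiff ℝ ∞ f) : ContDiff ℝ 2 f :=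
  contDiff_infty.1 h 2

lemma contDiff_one {f : R3 → E} (h : ContDiff ℝ ∞ f) : ContDiff ℝ 1 f :=
  contDiff_infty.1 h 1

end Smoothness

/-! ### Square integrable harmonic functions and the density of Laplacians in L². -/

section Harmonic

variable {E : Type*} [NormedAddCommGroup E] [InnerProductSpace ℝ E]

/-- The Caccioppoli inequality for harmonic functions. -/
lemma caccioppoli {v : R3 → E} (hv : ContDiff ℝ 2 v) (hL : MemLp v 2 volume)
    (h : ∀ x, lap v x = 0) {η : R3 → ℝ} (hη : ContDiff ℝ 1 η) (hc : HasCompactSupport η) {L : ℝ}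
    (hb : ∀ x, ‖fderiv ℝ η x‖ ≤ L) :
    ∫ x, ∑ j, η x ^ 2 * ‖pd j v x‖ ^ 2 ≤ 12 * L ^ 2 * ∫ x, ‖v x‖ ^ 2 := by
  have hv1 : ContDiff ℝ 1 v := hv.of_le (by norm_num)
  -- The divergence of this field integrates to zero. Harmonicity removes its second-order term and
  -- leaves η² |∇v|² plus a cross term.
  have hG : ∀ j, ContDiff ℝ 1 fun x => η x ^ 2 * (inner ℝ (v x) (pd j v x) : ℝ) := fun j =>
    (hη.pow 2).mul (hv1.inner ℝ (contDiff_pd_one hv j))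
  have hη2c : HasCompactSupport fun x => η x ^ 2 := hc.comp_left (g := fun t : ℝ => t ^ 2) (by simp)
  have hGc : ∀ j, HasCompactSupport fun x => η x ^ 2 * (inner ℝ (v x) (pd j v x) : ℝ) := fun j =>
    hη2c.mul_right
  have h0 := integral_sum_pd_eq_zero hG hGc
  have hpd : ∀ j x, pd j (fun x => η x ^ 2 * (inner ℝ (v x) (pd j v x) : ℝ)) x
      = η x ^ 2 * (inner ℝ (v x) (pd j (pd j v) x) + ‖pd j v x‖ ^ 2)
        + 2 * η x * pd j η x * inner ℝ (v x) (pd j v x) := by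
    intro j x
    have hd := hη.differentiable (by norm_num) x
    rw [pd_mul (c := fun x => η x ^ 2) (hd.pow 2) ((hv1.inner ℝ (contDiff_pd_one hv j)).differentiable (by norm_num) x),
      pd_inner (hv1.differentiable (by norm_num) x)
        ((contDiff_pd_one hv j).differentiable (by norm_num) x), real_inner_self_eq_norm_sq]
    have : pd j (fun y => η y ^ 2) x = 2 * η x * pd j η x := by
      have := pd_mul hd hd j
      simp only [← pow_two] at this
      rw [this]; ring
    rw [this]
  have hsum : ∀ x, ∑ j, pd j (fun x => η x ^ 2 * (inner ℝ (v x) (pd j v x) : ℝ)) x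
      = ∑ j, (η x ^ 2 * ‖pd j v x‖ ^ 2 + 2 * η x * pd j η x * inner ℝ (v x) (pd j v x)) := by
    intro x
    have hl : ∑ j, (inner ℝ (v x) (pd j (pd j v) x) : ℝ) = 0 := by
      rw [← inner_sum]
      have := h x
      rw [lap] at this
      rw [this, inner_zero_right]
    simp only [hpd, mul_add, Finset.sum_add_distrib, ← Finset.mul_sum, hl]
    ring
  have hle : ∀ x, (1 / 2) * (∑ j, η x ^ 2 * ‖pd j v x‖ ^ 2) - 6 * L ^ 2 * ‖v x‖ ^ 2
      ≤ ∑ j, pd j (fun x => η x ^ 2 * (inner ℝ (v x) (pd j v x) : ℝ)) x := by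
    intro x
    rw [hsum]
    -- Young's inequality: 2 |η| L |v| |∂ⱼv| ≤ ½ η² |∂ⱼv|² + 2 L² |v|². Three directions and
    -- absorption of the half give the constant 12.
    have hj : ∀ j : Fin 3, (1 / 2) * (η x ^ 2 * ‖pd j v x‖ ^ 2) - 2 * L ^ 2 * ‖v x‖ ^ 2
        ≤ η x ^ 2 * ‖pd j v x‖ ^ 2 + 2 * η x * pd j η x * inner ℝ (v x) (pd j v x) := by
      intro j
      have h1 : |pd j η x| ≤ L := (norm_pd_le j η x).trans (hb x)
      have hL0 : 0 ≤ L := (abs_nonneg _).trans h1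
      have h2 : |(inner ℝ (v x) (pd j v x) : ℝ)| ≤ ‖v x‖ * ‖pd j v x‖ := abs_real_inner_le_norm _ _
      have h3 : |2 * η x * pd j η x * inner ℝ (v x) (pd j v x)|
          ≤ 2 * |η x| * L * (‖v x‖ * ‖pd j v x‖) := by
        rw [abs_mul, abs_mul, abs_mul, abs_two]
        gcongr
      have h4 := neg_le_of_abs_le h3
      have h5 := sq_nonneg (|η x| * ‖pd j v x‖ - 2 * L * ‖v x‖)
      have h6 : (|η x| * ‖pd j v x‖) ^ 2 = η x ^ 2 * ‖pd j v x‖ ^ 2 := by rw [mul_pow, sq_abs]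
      nlinarith
    calc _ = ∑ j : Fin 3, ((1 / 2) * (η x ^ 2 * ‖pd j v x‖ ^ 2) - 2 * L ^ 2 * ‖v x‖ ^ 2) := by
          simp only [Fin.sum_univ_three]; ring
      _ ≤ _ := Finset.sum_le_sum fun j _ => hj j
  have hi1 : Integrable fun x => ∑ j, η x ^ 2 * ‖pd j v x‖ ^ 2 :=
    integrable_of_compactSupport
      (continuous_finsetSum _ fun j _ => (hη.continuous.pow 2).mul
        ((continuous_pd hv1 j).norm.pow 2))
      (hasCompactSupport_finset_sum _ fun j _ => hη2c.mul_right)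
  have hi2 := integrable_norm_sq hL
  have hi3 : Integrable fun x =>
      ∑ j, pd j (fun x => η x ^ 2 * (inner ℝ (v x) (pd j v x) : ℝ)) x :=
    integrable_of_compactSupport
      (continuous_finsetSum _ fun j _ => continuous_pd (hG j) j)
      (hasCompactSupport_finset_sum _ fun j _ => hasCompactSupport_pd (hGc j) j)
  have hm := integral_mono ((hi1.const_mul (1 / 2)).sub (hi2.const_mul (6 * L ^ 2))) hi3 hle
  simp only [Pi.sub_apply] at hm
  rw [h0, integral_sub (hi1.const_mul _) (hi2.const_mul _), integral_const_mul,
    integral_const_mul] at hm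
  linarith

/-- A square integrable harmonic function vanishes. -/
lemma eq_zero_of_lap_eq_zero {v : R3 → E} (hv : ContDiff ℝ 2 v) (hL : MemLp v 2 volume)
    (h : ∀ x, lap v x = 0) (x : R3) : v x = 0 := by
  obtain ⟨C, hC0, hC⟩ := exists_cutoff_bound
  have hv1 : ContDiff ℝ 1 v := hv.of_le (by norm_num)
  have hpd : ∀ j y, pd j v y = 0 := by
    intro i y
    by_contra hne
    set R₀ : ℝ := ‖y‖ + 1 with hR₀
    have hR₀1 : 1 ≤ R₀ := by simp [hR₀]
    have hcont : ∀ R : ℝ, Continuous fun x => cutoff R x ^ 2 * ‖pd i v x‖ ^ 2 := fun R =>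
      ((contDiff_cutoff R (n := 0)).continuous.pow 2).mul ((continuous_pd hv1 i).norm.pow 2)
    have hsupp : ∀ R : ℝ, 0 < R → HasCompactSupport fun x => cutoff R x ^ 2 * ‖pd i v x‖ ^ 2 :=
      fun R hR => ((hasCompactSupport_cutoff hR).comp_left (g := fun t : ℝ => t ^ 2)
        (by simp)).mul_right
    have hpos : 0 < ∫ x, cutoff R₀ x ^ 2 * ‖pd i v x‖ ^ 2 := by
      refine (hcont R₀).integral_pos_of_hasCompactSupport_nonneg_nonzero
        (hsupp R₀ (by linarith)) (fun x => by positivity) (x := y) ?_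
      rw [cutoff_eq_one (by linarith) (by linarith)]
      simpa using hne
    -- The cutoff at R₀ is supported in the ball of radius 2 R₀, where the cutoff at R equals one.
    -- The Caccioppoli bound with slope C / R then applies to a fixed positive quantity and tends to
    -- zero.
    have hle : ∀ R : ℝ, 2 * R₀ ≤ R →
        ∫ x, cutoff R₀ x ^ 2 * ‖pd i v x‖ ^ 2 ≤ 12 * (C / R) ^ 2 * ∫ x, ‖v x‖ ^ 2 := by
      intro R hR
      have hR1 : 1 ≤ R := by linarith
      refine le_trans ?_ (caccioppoli hv hL h (contDiff_cutoff R (n := 1))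
        (hasCompactSupport_cutoff (by linarith)) fun x => (hC R hR1 x).1)
      refine integral_mono (integrable_of_compactSupport (hcont R₀) (hsupp R₀ (by linarith)))
        (integrable_of_compactSupport (continuous_finsetSum _ fun j _ =>
          ((contDiff_cutoff R (n := 0)).continuous.pow 2).mul ((continuous_pd hv1 j).norm.pow 2))
          (hasCompactSupport_finset_sum _ fun j _ => ((hasCompactSupport_cutoff
            (by linarith)).comp_left (g := fun t : ℝ => t ^ 2) (by simp)).mul_right)) fun x => ?_
      refine le_trans ?_ (Finset.single_le_sum
        (f := fun j => cutoff R x ^ 2 * ‖pd j v x‖ ^ 2) (fun j _ => by positivity)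
        (Finset.mem_univ i))
      dsimp only
      gcongr
      · exact cutoff_nonneg _ _
      · by_cases hx : ‖x‖ ≤ R
        · rw [cutoff_eq_one (by linarith) hx]; exact cutoff_le_one _ _
        · rw [cutoff_eq_zero (by linarith) (by linarith)]; exact cutoff_nonneg _ _
    have hlim : Tendsto (fun R : ℝ => 12 * (C / R) ^ 2 * ∫ x, ‖v x‖ ^ 2) atTop
        (𝓝 (12 * 0 ^ 2 * ∫ x, ‖v x‖ ^ 2)) :=
      (((tendsto_const_nhds.div_atTop tendsto_id).pow 2).const_mul 12).mul_const _
    have := ge_of_tendsto hlim ((eventually_ge_atTop (2 * R₀)).mono hle)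
    simp at this
    linarith
  have hconst : ∀ y, v y = v x := fun y =>
    is_const_of_fderiv_eq_zero (𝕜 := ℝ) (hv1.differentiable (by norm_num)) (fun z => by
      ext w
      rw [fderiv_apply_eq_sum_pd]
      simp [hpd]) y x
  have hvc : v = fun _ => v x := funext hconst
  rw [hvc] at hL
  -- The gradient vanishes, so `v` is constant; a nonzero constant is not square integrable on a
  -- space of infinite measure.
  rcases (memLp_const_iff (by norm_num) (by norm_num)).1 hL with h0 | h0
  · exact h0
  · simp at h0

lemma pd_comp_sub_left {f : R3 → E} (hf : Differentiable ℝ f) (x y : R3) (j : Fin 3) :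
    pd j (fun y => f (x - y)) y = - pd j f (x - y) := by
  have h1 := (hf (x - y)).hasFDerivAt.comp y ((hasFDerivAt_const x y).sub (hasFDerivAt_id y))
  have h2 : fderiv ℝ (fun y => f (x - y)) y = _ := h1.fderiv
  simp [pd, h2]

lemma lap_comp_sub_left {f : R3 → E} (hf : ContDiff ℝ 2 f) (x y : R3) :
    lap (fun y => f (x - y)) y = lap f (x - y) := by
  simp only [lap]
  refine Finset.sum_congr rfl fun j _ => ?_
  have h1 : pd j (fun y => f (x - y)) = fun y => (fun z => - pd j f z) (x - y) :=
    funext fun y => pd_comp_sub_left (hf.differentiable (by norm_num)) x y j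
  have h2 : pd j (fun z => - pd j f z) (x - y) = - pd j (pd j f) (x - y) := by
    show fderiv ℝ (fun z => - pd j f z) (x - y) (stdVec j) = _
    rw [fderiv_fun_neg]; rfl
  rw [h1, pd_comp_sub_left ((contDiff_pd_one hf j).neg.differentiable (by norm_num)), h2, neg_neg]

lemma lap_kconv {k : R3 → ℝ} (hk : ContDiff ℝ 2 k) (hkc : HasCompactSupport k)
    {U : R3 → E} (hU : LocallyIntegrable U volume) :
    lap (kconv k U) = kconv (lap k) U := by
  ext x
  simp only [lap]
  have : ∀ j, pd j (pd j (kconv k U)) x = kconv (pd j (pd j k)) U x := fun j => by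
    rw [pd_kconv (hk.of_le (by norm_num)) hkc hU,
      pd_kconv (contDiff_pd_one hk j) (hasCompactSupport_pd hkc j) hU]
  simp only [this, kconv]
  rw [← integral_finsetSum]
  · simp only [lap, Finset.sum_smul]
  exact fun j _ => integrable_kconv (continuous_pd (contDiff_pd_one hk j) j)
    (hasCompactSupport_pd (hasCompactSupport_pd hkc j) j) hU x

lemma lap_add {f g : R3 → E} (hf : ContDiff ℝ 2 f) (hg : ContDiff ℝ 2 g) (x : R3) :
    lap (fun y => f y + g y) x = lap f x + lap g x := by
  simp only [lap, ← Finset.sum_add_distrib]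
  refine Finset.sum_congr rfl fun j _ => ?_
  have : pd j (fun y => f y + g y) = fun y => pd j f y + pd j g y := funext fun y =>
    pd_add (hf.differentiable (by norm_num) y) (hg.differentiable (by norm_num) y) j
  rw [this, pd_add ((contDiff_pd_one hf j).differentiable (by norm_num) x)
    ((contDiff_pd_one hg j).differentiable (by norm_num) x)]

lemma pd_const_smul (c : ℝ) {f : R3 → E} (hf : Differentiable ℝ f) (j : Fin 3) (x : R3) :
    pd j (fun y => c • f y) x = c • pd j f x := by
  rw [pd_smul (differentiableAt_const c) (hf x), pd_const, zero_smul, add_zero]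

lemma lap_const_smul (c : ℝ) {f : R3 → E} (hf : ContDiff ℝ 2 f) (x : R3) :
    lap (fun y => c • f y) x = c • lap f x := by
  simp only [lap, Finset.smul_sum]
  refine Finset.sum_congr rfl fun j _ => ?_
  have : pd j (fun y => c • f y) = fun y => c • pd j f y := funext fun y =>
    pd_const_smul c (hf.differentiable (by norm_num)) j y
  rw [this, pd_const_smul c ((contDiff_pd_one hf j).differentiable (by norm_num))]

lemma lap_smul_const {φ : R3 → ℝ} (hφ : ContDiff ℝ 2 φ) (e : E) (x : R3) :
    lap (fun y => φ y • e) x = lap φ x • e := by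
  simp only [lap, Finset.sum_smul]
  refine Finset.sum_congr rfl fun j _ => ?_
  have h : ∀ {g : R3 → ℝ}, Differentiable ℝ g → ∀ y, pd j (fun z => g z • e) y = pd j g y • e := by
    intro g hg y
    rw [pd_smul (hg y) (differentiableAt_const e), pd_const, smul_zero, zero_add]
  rw [show pd j (fun y => φ y • e) = fun y => pd j φ y • e from
    funext fun y => h (hφ.differentiable (by norm_num)) y,
    h ((contDiff_pd_one hφ j).differentiable (by norm_num))]

/-- Laplacians of test functions, as a subspace of `L²`. -/
def lapSubmodule (E : Type*) [NormedAddCommGroup E] [InnerProductSpace ℝ E] :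
    Submodule ℝ (Lp E 2 (volume : Measure R3)) where
  carrier := {F | ∃ ψ : R3 → E, ContDiff ℝ ∞ ψ ∧ HasCompactSupport ψ ∧ F =ᵐ[volume] lap ψ}
  zero_mem' := by
    refine ⟨fun _ => 0, contDiff_const, HasCompactSupport.zero, ?_⟩
    filter_upwards [Lp.coeFn_zero E 2 (volume : Measure R3)] with x hx
    rw [hx]
    simp only [lap, Pi.zero_apply]
    refine (Finset.sum_eq_zero fun j _ => ?_).symm
    rw [show pd j (fun _ : R3 => (0 : E)) = fun _ => 0 from funext fun y => pd_const 0 j y, pd_const]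
  add_mem' := by
    rintro F G ⟨ψ, h1, h2, h3⟩ ⟨ψ', h1', h2', h3'⟩
    refine ⟨fun x => ψ x + ψ' x, h1.add h1', h2.add h2', ?_⟩
    filter_upwards [Lp.coeFn_add F G, h3, h3'] with x hx hF hG
    rw [hx, lap_add (contDiff_two h1) (contDiff_two h1'),
      Pi.add_apply, hF, hG]
  smul_mem' := by
    rintro c F ⟨ψ, h1, h2, h3⟩
    refine ⟨fun x => c • ψ x, contDiff_const.smul h1, h2.smul_left (f := fun _ => c), ?_⟩
    filter_upwards [Lp.coeFn_smul c F, h3] with x hx hF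
    rw [hx, lap_const_smul c (contDiff_two h1), Pi.smul_apply, hF]

/-- Laplacians of test functions are dense in `L²`. -/
lemma exists_lap_approx [CompleteSpace E] {f : R3 → E} (hf : MemLp f 2 volume) {δ : ℝ}
    (hδ : 0 < δ) : ∃ ψ : R3 → E, ContDiff ℝ ∞ ψ ∧ HasCompactSupport ψ ∧
      l2 (fun x => lap ψ x - f x) < δ := by
  have h2 : (2 : WithTop ℕ∞) ≤ ∞ := WithTop.coe_le_coe.2 (le_top : (2 : ℕ∞) ≤ ⊤)
  have hbot : (lapSubmodule E)ᗮ = ⊥ := by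
    rw [Submodule.eq_bot_iff]
    intro w hw
    rw [Submodule.mem_orthogonal'] at hw
    have hwL : MemLp (w : R3 → E) 2 volume := Lp.memLp w
    have hwl := locallyIntegrable_of_memLp hwL
    -- An element `w` orthogonal to all Laplacians is only weakly harmonic. Its mollifications are
    -- smooth, harmonic and in L², hence zero, and this for every `φ` forces w = 0 without an appeal
    -- to Weyl's lemma.
    have htest : ∀ φ : R3 → ℝ, ContDiff ℝ ∞ φ → HasCompactSupport φ → ∀ x, kconv φ w x = 0 := by
      intro φ hφ hφc
      refine eq_zero_of_lap_eq_zero (contDiff_kconv (n := 2) (hφ.of_le h2) hφc hwl)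
        (memLp_kconv hφ.continuous hφc hwL).1 fun x => ?_
      rw [lap_kconv (hφ.of_le h2) hφc hwl]
      refine ext_inner_right ℝ fun e => ?_
      rw [inner_zero_left, real_inner_comm, kconv, ← integral_inner (integrable_kconv
        (continuous_lap (hφ.of_le h2)) (hasCompactSupport_lap hφc) hwl x)]
      set ψ : R3 → E := fun y => φ (x - y) • e with hψ
      have hφx : ContDiff ℝ ∞ fun y => φ (x - y) := hφ.comp (contDiff_const.sub contDiff_id)
      have hψs : ContDiff ℝ ∞ ψ := hφx.smul contDiff_const
      have hψc : HasCompactSupport ψ := by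
        have : HasCompactSupport fun y => φ (x - y) := hφc.comp_homeomorph (Homeomorph.subLeft x)
        exact this.smul_right
      have hψL : MemLp (lap ψ) 2 volume := memLp_of_compactSupport
        (continuous_lap (hψs.of_le h2)) (hasCompactSupport_lap hψc)
      have h0 := hw (hψL.toLp _) ⟨ψ, hψs, hψc, hψL.coeFn_toLp⟩
      rw [L2.inner_def] at h0
      rw [← h0]
      refine integral_congr_ae ?_
      filter_upwards [hψL.coeFn_toLp] with y hy
      rw [hy, hψ, lap_smul_const (hφx.of_le h2), lap_comp_sub_left (hφ.of_le h2),
        inner_smul_right, inner_smul_right, real_inner_comm]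
    refine (Lp.eq_zero_iff_ae_eq_zero).2 ?_
    refine ae_eq_zero_of_integral_contDiff_smul_eq_zero hwl fun g hg hgc => ?_
    have h0 := htest (fun z => g (-z)) (hg.comp contDiff_neg)
      (hgc.comp_homeomorph (Homeomorph.neg R3)) 0
    simpa [kconv] using h0
  have hdense := (Submodule.topologicalClosure_eq_top_iff (K := lapSubmodule E)).2 hbot
  have hmem : hf.toLp f ∈ closure (lapSubmodule E : Set (Lp E 2 (volume : Measure R3))) := by
    rw [← Submodule.topologicalClosure_coe, hdense]; trivial
  obtain ⟨G, ⟨ψ, hψ, hψc, hG⟩, hd⟩ := Metric.mem_closure_iff.1 hmem δ hδ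
  refine ⟨ψ, hψ, hψc, ?_⟩
  rw [dist_comm, dist_eq_norm, Lp.norm_def] at hd
  refine lt_of_eq_of_lt ?_ hd
  rw [l2]
  congr 1
  refine eLpNorm_congr_ae ?_
  filter_upwards [Lp.coeFn_sub G (hf.toLp f), hG, hf.coeFn_toLp] with x h1 h2 h3
  rw [h1, Pi.sub_apply, h2, h3]

end Harmonic

/-! ### The Hessian of a test function in terms of its Laplacian. -/

section Hessian

lemma integral_mul_pd {f g : R3 → ℝ} (hf : ContDiff ℝ 1 f) (hg : ContDiff ℝ 1 g)
    (hc : HasCompactSupport f) (j : Fin 3) :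
    ∫ x, f x * pd j g x = - ∫ x, pd j f x * g x := by
  have h0 := integral_pd_eq_zero (hf.mul hg) hc.mul_right j
  have h1 : ∀ x, pd j (fun x => f x * g x) x = f x * pd j g x + pd j f x * g x := fun x =>
    pd_mul (hf.differentiable (by norm_num) x) (hg.differentiable (by norm_num) x) j
  have i1 : Integrable fun x => f x * pd j g x := integrable_of_compactSupport
    (hf.continuous.mul (continuous_pd hg j)) hc.mul_right
  have i2 : Integrable fun x => pd j f x * g x := integrable_of_compactSupport
    ((continuous_pd hf j).mul hg.continuous) (hasCompactSupport_pd hc j).mul_right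
  rw [funext h1, integral_add i1 i2] at h0
  linarith

/-- The `L²` norm of the Hessian of a test function is that of its Laplacian. -/
lemma sum_integral_hessian_sq {ψ : R3 → ℝ} (hψ : ContDiff ℝ ∞ ψ) (hc : HasCompactSupport ψ) :
    ∑ j, ∑ i, ∫ x, pd j (pd i ψ) x ^ 2 = ∫ x, lap ψ x ^ 2 := by
  -- Two integrations by parts, in directions j and i, with the partial derivatives commuted in
  -- between.
  have hij : ∀ i j, ∫ x, pd j (pd i ψ) x ^ 2 = ∫ x, pd j (pd j ψ) x * pd i (pd i ψ) x := by
    intro i j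
    have hi := contDiff_pd_top hψ i
    have hji := contDiff_pd_top hi j
    have hcomm : pd j (pd i ψ) = pd i (pd j ψ) := funext fun x => pd_comm (contDiff_two hψ) j i x
    have hcomm2 : pd j (pd i (pd j ψ)) = pd i (pd j (pd j ψ)) :=
      funext fun x => pd_comm (contDiff_two (contDiff_pd_top hψ j)) j i x
    have h1 := integral_mul_pd (contDiff_one hi) (contDiff_one hji) (hasCompactSupport_pd hc i) j
    have h2 := integral_mul_pd (contDiff_one hi)
      (contDiff_one (contDiff_pd_top (contDiff_pd_top hψ j) j)) (hasCompactSupport_pd hc i) i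
    rw [hcomm, hcomm2, h2, ← hcomm] at h1
    simp only [pow_two, mul_comm (pd j (pd j ψ) _)]
    exact (neg_inj.1 h1).symm
  simp only [hij]
  simp only [lap, pow_two, Finset.sum_mul_sum]
  rw [integral_finsetSum]
  · refine Finset.sum_congr rfl fun j _ => ?_
    rw [integral_finsetSum]
    exact fun i _ => integrable_of_compactSupport
      ((contDiff_pd_top (contDiff_pd_top hψ j) j).continuous.mul
        (contDiff_pd_top (contDiff_pd_top hψ i) i).continuous)
      (hasCompactSupport_pd (hasCompactSupport_pd hc j) j).mul_right
  · exact fun j _ => integrable_of_compactSupport (continuous_finsetSum _ fun i _ =>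
      (contDiff_pd_top (contDiff_pd_top hψ j) j).continuous.mul
        (contDiff_pd_top (contDiff_pd_top hψ i) i).continuous)
      (hasCompactSupport_finset_sum _ fun i _ =>
        (hasCompactSupport_pd (hasCompactSupport_pd hc j) j).mul_right)

lemma contDiff_gradient {n m : WithTop ℕ∞} {ψ : R3 → ℝ} (hψ : ContDiff ℝ n ψ) (h : m + 1 ≤ n) :
    ContDiff ℝ m (fun x => gradient ψ x) := by
  rw [contDiff_euclidean]
  intro i
  simp only [gradient_apply_eq_pd]
  exact contDiff_pd hψ h i

lemma hasCompactSupport_gradient {ψ : R3 → ℝ} (hψ : HasCompactSupport ψ) :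
    HasCompactSupport (fun x => gradient ψ x) :=
  (hψ.fderiv ℝ).comp_left (g := (InnerProductSpace.toDual ℝ R3).symm) (map_zero _)

lemma pd_gradient_apply {ψ : R3 → ℝ} (hψ : ContDiff ℝ 2 ψ) (i j : Fin 3) (x : R3) :
    pd j (fun x => gradient ψ x) x i = pd j (pd i ψ) x := by
  rw [← pd_apply ((contDiff_gradient (m := 1) hψ (by norm_num)).differentiable (by norm_num) x)]
  simp only [gradient_apply_eq_pd]

/-- The left side is the norm of one column of the Hessian. In the pressure estimate this plays the
part of the L² boundedness of Riesz transforms. -/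
lemma l2_pd_gradient_le {ψ : R3 → ℝ} (hψ : ContDiff ℝ ∞ ψ) (hc : HasCompactSupport ψ)
    (j : Fin 3) : l2 (pd j (fun x => gradient ψ x)) ≤ l2 (lap ψ) := by
  have h2 : ContDiff ℝ 2 ψ := contDiff_two hψ
  have hg : ContDiff ℝ ∞ (fun x => gradient ψ x) := contDiff_gradient hψ (by simp)
  have hL : MemLp (pd j (fun x => gradient ψ x)) 2 volume := memLp_of_compactSupport
    (contDiff_pd_top hg j).continuous (hasCompactSupport_pd (hasCompactSupport_gradient hc) j)
  have hLl : MemLp (lap ψ) 2 volume := memLp_of_compactSupport (continuous_lap h2)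
    (hasCompactSupport_lap hc)
  refine l2_le_of_sq_le hL (l2_nonneg _) ?_
  rw [l2_sq hLl]
  simp only [EuclideanSpace.norm_sq_eq, pd_gradient_apply h2, Real.norm_eq_abs, sq_abs]
  rw [integral_finsetSum, ← sum_integral_hessian_sq hψ hc]
  · exact Finset.single_le_sum (f := fun j => ∑ i, ∫ x, pd j (pd i ψ) x ^ 2)
      (fun j _ => Finset.sum_nonneg fun i _ => integral_nonneg fun x => sq_nonneg _)
      (Finset.mem_univ j)
  · exact fun i _ => integrable_of_compactSupport
      ((contDiff_pd_top (contDiff_pd_top hψ i) j).continuous.pow 2)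
      ((hasCompactSupport_pd (hasCompactSupport_pd hc i) j).comp_left (g := fun t : ℝ => t ^ 2)
        (by simp))

end Hessian

/-- The `j`-th coordinate. -/
def coordL (j : Fin 3) : R3 →L[ℝ] ℝ := EuclideanSpace.proj j

@[simp] lemma coordL_apply (j : Fin 3) (x : R3) : coordL j x = x j := rfl

/-! ### Mollifiers and their rescalings. -/

section Kernel

lemma isMollifier_scaledKernel {ρ : R3 → ℝ} (hρ : IsMollifier ρ) {ε : ℝ} (hε : 0 < ε) :
    IsMollifier (scaledKernel ρ ε) where
  smooth := contDiff_const.mul (hρ.smooth.comp (contDiff_const_smul ε⁻¹))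
  compactSupport := by
    have : HasCompactSupport fun x : R3 => ρ (ε⁻¹ • x) :=
      hρ.compactSupport.comp_homeomorph (Homeomorph.smulOfNeZero ε⁻¹ (by positivity))
    exact this.mul_left
  nonneg x := mul_nonneg (by positivity) (hρ.nonneg _)
  integral_eq_one := by
    simp only [scaledKernel]
    rw [integral_const_mul, Measure.integral_comp_inv_smul_of_nonneg volume ρ hε.le,
      hρ.integral_eq_one]
    simp
    field_simp
  even x := by simp [scaledKernel, hρ.even]

namespace IsMollifier

variable {k : R3 → ℝ} (hk : IsMollifier k)
include hk

lemma continuous : Continuous k := hk.smooth.continuous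

lemma contDiff_one : ContDiff ℝ 1 k := _root_.contDiff_one hk.smooth

lemma integral_abs : ∫ x, |k x| = 1 := by
  simp only [abs_of_nonneg (hk.nonneg _), hk.integral_eq_one]

lemma continuous_pd (j : Fin 3) : Continuous (pd j k) := _root_.continuous_pd hk.contDiff_one j

lemma compactSupport_pd (j : Fin 3) : HasCompactSupport (pd j k) :=
  hasCompactSupport_pd hk.compactSupport j

/-- This oddness supplies the sign that makes the eddy stress dissipative in
`IsSlice.integral_stress_le`. -/
lemma pd_neg (j : Fin 3) (x : R3) : pd j k (-x) = - pd j k x := by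
  have h := pd_comp_sub_left (f := k) (hk.contDiff_one.differentiable (by norm_num)) 0 x j
  simp only [zero_sub, hk.even] at h
  rw [← neg_inj, neg_neg, ← h]

end IsMollifier

end Kernel

/-! ### The momentum equation at a fixed time, and its integrations by parts. -/

section Slice

/-- The `j`-th column of the regularized eddy stress `k ⋆ (a ∇(k ⋆ v))`. -/
def eddyStress (k a : R3 → ℝ) (v : R3 → R3) (j : Fin 3) : R3 → R3 :=
  kconv k (fun y => a y • pd j (kconv k v) y)

/-- The `j`-th column of the total flux `v ⊗ (k ⋆ v) - k ⋆ (a ∇(k ⋆ v))`. -/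
def flux (k a : R3 → ℝ) (v : R3 → R3) (j : Fin 3) (x : R3) : R3 :=
  kconv k v x j • v x - eddyStress k a v j x

/-- A velocity `v` with time derivative `dv` and pressure `q` satisfying the equations at a fixed
time, with eddy viscosity `a ≤ MA` and kernel `k`. -/
structure IsSlice (ν MA : ℝ) (a k : R3 → ℝ) (v dv : R3 → R3) (q : R3 → ℝ) : Prop where
  kernel : IsMollifier k
  a_meas : AEStronglyMeasurable a volume
  a_nonneg : ∀ᵐ x ∂(volume : Measure R3), 0 ≤ a x
  a_le : ∀ᵐ x ∂(volume : Measure R3), a x ≤ MA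
  MA_nonneg : 0 ≤ MA
  v_smooth : ContDiff ℝ 2 v
  q_smooth : ContDiff ℝ 1 q
  v_memLp : MemLp v 2 volume
  div_free : ∀ x, ∑ j, pd j v x j = 0
  momentum : ∀ x, dv x = ν • lap v x - fderiv ℝ v x (kconv k v x)
    + ∑ j, pd j (eddyStress k a v j) x - gradient q x

namespace IsSlice

variable {ν MA : ℝ} {a k : R3 → ℝ} {v dv : R3 → R3} {q : R3 → ℝ} (S : IsSlice ν MA a k v dv q)
include S

lemma v_one : ContDiff ℝ 1 v := S.v_smooth.of_le (by norm_num)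

lemma v_diff : Differentiable ℝ v := S.v_one.differentiable (by norm_num)

lemma v_loc : LocallyIntegrable v volume := S.v_one.continuous.locallyIntegrable

lemma w_smooth : ContDiff ℝ ∞ (kconv k v) :=
  contDiff_kconv (n := ⊤) S.kernel.smooth S.kernel.compactSupport S.v_loc

lemma w_diff : Differentiable ℝ (kconv k v) := (contDiff_one S.w_smooth).differentiable (by norm_num)

lemma pd_w (j : Fin 3) : pd j (kconv k v) = kconv (pd j k) v :=
  pd_kconv S.kernel.contDiff_one S.kernel.compactSupport S.v_loc j

lemma pd_w' (j : Fin 3) : pd j (kconv k v) = kconv k (pd j v) := by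
  rw [S.pd_w]
  ext1 x
  exact (kconv_pd_right S.kernel.contDiff_one S.kernel.compactSupport S.v_one j x).symm

lemma w_memLp : MemLp (kconv k v) 2 volume :=
  (memLp_kconv S.kernel.continuous S.kernel.compactSupport S.v_memLp).1

lemma l2_w_le : l2 (kconv k v) ≤ l2 v := by
  have := (memLp_kconv S.kernel.continuous S.kernel.compactSupport S.v_memLp).2
  rwa [S.kernel.integral_abs, one_mul] at this

lemma norm_w_le {M : ℝ} (hM : ∀ x, ‖v x‖ ≤ M) (x : R3) : ‖kconv k v x‖ ≤ M := by
  have := norm_kconv_le_of_bound S.kernel.continuous S.kernel.compactSupport hM x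
  rwa [S.kernel.integral_abs, one_mul] at this

lemma pd_w_memLp (j : Fin 3) : MemLp (pd j (kconv k v)) 2 volume := by
  rw [S.pd_w]
  exact (memLp_kconv (S.kernel.continuous_pd j) (S.kernel.compactSupport_pd j) S.v_memLp).1

lemma l2_pd_w_le (j : Fin 3) : l2 (pd j (kconv k v)) ≤ (∫ z, |pd j k z|) * l2 v := by
  rw [S.pd_w]
  exact (memLp_kconv (S.kernel.continuous_pd j) (S.kernel.compactSupport_pd j) S.v_memLp).2

/-- Here the derivative falls on `v`, so the constant is one for every kernel. In `l2_pd_w_le` it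
falls on the kernel: no information on the gradient of `v` is needed, but the constant depends on
the scale. -/
lemma l2_pd_w_le' (j : Fin 3) (h : MemLp (pd j v) 2 volume) :
    l2 (pd j (kconv k v)) ≤ l2 (pd j v) := by
  rw [S.pd_w']
  have := (memLp_kconv S.kernel.continuous S.kernel.compactSupport h).2
  rwa [S.kernel.integral_abs, one_mul] at this

lemma div_w (x : R3) : ∑ j, pd j (kconv k v) x j = 0 := by
  have h : ∀ j, pd j (kconv k v) x j = ∫ y, k (x - y) * pd j v y j := by
    intro j
    have hi := integrable_kconv S.kernel.continuous S.kernel.compactSupport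
      (continuous_pd S.v_one j).locallyIntegrable x
    have := (coordL j).integral_comp_comm hi
    rw [S.pd_w']
    simpa [kconv] using this.symm
  simp only [h]
  rw [← integral_finsetSum]
  · simp only [← Finset.mul_sum, S.div_free]; simp
  · intro j _
    have hcont : Continuous fun y => pd j v y j :=
      (coordL j).continuous.comp
        (continuous_pd S.v_one j)
    exact integrable_kconv S.kernel.continuous S.kernel.compactSupport
      hcont.locallyIntegrable x

lemma norm_a_smul_le (f : R3 → R3) :
    ∀ᵐ x ∂(volume : Measure R3), ‖a x • f x‖ ≤ MA * ‖f x‖ := by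
  filter_upwards [S.a_nonneg, S.a_le] with x h0 h1
  rw [norm_smul, Real.norm_of_nonneg h0]
  gcongr

lemma a_smul_memLp {f : R3 → R3} (hf : MemLp f 2 volume) :
    MemLp (fun x => a x • f x) 2 volume ∧ l2 (fun x => a x • f x) ≤ MA * l2 f :=
  ⟨hf.of_le_mul (S.a_meas.smul hf.1) (S.norm_a_smul_le f),
    l2_le_of_norm_le S.MA_nonneg hf (S.norm_a_smul_le f)⟩

lemma stress_smooth (j : Fin 3) : ContDiff ℝ ∞ (eddyStress k a v j) :=
  contDiff_kconv (n := ⊤) S.kernel.smooth S.kernel.compactSupport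
    (locallyIntegrable_of_memLp (S.a_smul_memLp (S.pd_w_memLp j)).1)

lemma stress_memLp (j : Fin 3) : MemLp (eddyStress k a v j) 2 volume :=
  (memLp_kconv S.kernel.continuous S.kernel.compactSupport (S.a_smul_memLp (S.pd_w_memLp j)).1).1

lemma l2_stress_le (j : Fin 3) : l2 (eddyStress k a v j) ≤ MA * l2 (pd j (kconv k v)) := by
  have := (memLp_kconv S.kernel.continuous S.kernel.compactSupport
    (S.a_smul_memLp (S.pd_w_memLp j)).1).2
  rw [S.kernel.integral_abs, one_mul] at this
  exact this.trans (S.a_smul_memLp (S.pd_w_memLp j)).2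

lemma coord_w_smooth (j : Fin 3) : ContDiff ℝ 1 fun x => kconv k v x j :=
  (contDiff_euclidean.1 (contDiff_one S.w_smooth)) j

/-- Integration by parts in the transport term. -/
lemma integral_transport {Φ : R3 → R3} (hΦ : ContDiff ℝ 1 Φ) (hc : HasCompactSupport Φ) :
    ∫ x, (inner ℝ (Φ x) (fderiv ℝ v x (kconv k v x)) : ℝ) =
      - ∫ x, ∑ j, kconv k v x j * inner ℝ (pd j Φ x) (v x) := by
  have hG : ∀ j, ContDiff ℝ 1 fun x => kconv k v x j * (inner ℝ (Φ x) (v x) : ℝ) := fun j =>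
    (S.coord_w_smooth j).mul (hΦ.inner ℝ S.v_one)
  have hΦv : HasCompactSupport fun x => (inner ℝ (Φ x) (v x) : ℝ) :=
    hc.mono fun x hx h => hx (by simp [h])
  have h0 := integral_sum_pd_eq_zero hG fun j => hΦv.mul_left
  -- The derivatives of the transporting field add up to its divergence, which vanishes because
  -- mollification preserves `div_free`.
  have hpt : ∀ x, ∑ j, pd j (fun x => kconv k v x j * (inner ℝ (Φ x) (v x) : ℝ)) x
      = inner ℝ (Φ x) (fderiv ℝ v x (kconv k v x))
        + ∑ j, kconv k v x j * inner ℝ (pd j Φ x) (v x) := by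
    intro x
    have hj : ∀ j, pd j (fun x => kconv k v x j * (inner ℝ (Φ x) (v x) : ℝ)) x
        = inner ℝ (Φ x) (kconv k v x j • pd j v x) + kconv k v x j * inner ℝ (pd j Φ x) (v x)
          + pd j (kconv k v) x j * inner ℝ (Φ x) (v x) := by
      intro j
      rw [pd_mul ((S.coord_w_smooth j).differentiable (by norm_num) x)
        ((hΦ.inner ℝ S.v_one).differentiable (by norm_num) x),
        pd_inner (hΦ.differentiable (by norm_num) x) (S.v_diff x), pd_apply (S.w_diff x),
        inner_smul_right]
      ring
    simp only [hj, Finset.sum_add_distrib, ← Finset.sum_mul, S.div_w, ← inner_sum,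
      fderiv_apply_eq_sum_pd]
    ring
  have hcf : Continuous fun x => fderiv ℝ v x (kconv k v x) :=
    (S.v_one.continuous_fderiv (by norm_num)).clm_apply S.w_smooth.continuous
  rw [funext hpt, integral_add] at h0
  · linarith
  · exact integrable_of_compactSupport (hΦ.continuous.inner hcf)
      (hc.mono fun x hx h => hx (by simp [h]))
  · exact integrable_of_compactSupport (continuous_finsetSum _ fun j _ =>
      (S.coord_w_smooth j).continuous.mul ((continuous_pd hΦ j).inner S.v_one.continuous))
      (hasCompactSupport_finset_sum _ fun j _ => HasCompactSupport.mul_left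
        ((hasCompactSupport_pd hc j).mono fun x hx h => hx (by simp [h])))

end IsSlice

lemma hasCompactSupport_inner_left {E : Type*} [NormedAddCommGroup E] [InnerProductSpace ℝ E]
    {f g : R3 → E} (hf : HasCompactSupport f) :
    HasCompactSupport fun x => (inner ℝ (f x) (g x) : ℝ) :=
  hf.mono fun x hx h => hx (by simp [h])

lemma integrable_inner_left {E : Type*} [NormedAddCommGroup E] [InnerProductSpace ℝ E]
    {f g : R3 → E} (hf : Continuous f) (hc : HasCompactSupport f) (hg : Continuous g) :
    Integrable fun x => (inner ℝ (f x) (g x) : ℝ) :=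
  integrable_of_compactSupport (hf.inner hg) (hasCompactSupport_inner_left hc)

/-- Green's second identity. -/
lemma integral_inner_lap {E : Type*} [NormedAddCommGroup E] [InnerProductSpace ℝ E]
    {Φ v : R3 → E} (hΦ : ContDiff ℝ 2 Φ) (hv : ContDiff ℝ 2 v) (hc : HasCompactSupport Φ) :
    ∫ x, (inner ℝ (Φ x) (lap v x) : ℝ) = ∫ x, (inner ℝ (lap Φ x) (v x) : ℝ) := by
  have hΦ1 : ContDiff ℝ 1 Φ := hΦ.of_le (by norm_num)
  have hv1 : ContDiff ℝ 1 v := hv.of_le (by norm_num)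
  have hG : ∀ j, ContDiff ℝ 1 fun x =>
      (inner ℝ (Φ x) (pd j v x) : ℝ) - inner ℝ (pd j Φ x) (v x) := fun j =>
    (hΦ1.inner ℝ (contDiff_pd_one hv j)).sub ((contDiff_pd_one hΦ j).inner ℝ hv1)
  have h0 := integral_sum_pd_eq_zero hG fun j => (hasCompactSupport_inner_left hc).sub
    (hasCompactSupport_inner_left (hasCompactSupport_pd hc j))
  have hpt : ∀ x, ∑ j, pd j (fun x => (inner ℝ (Φ x) (pd j v x) : ℝ) - inner ℝ (pd j Φ x) (v x)) x
      = inner ℝ (Φ x) (lap v x) - inner ℝ (lap Φ x) (v x) := by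
    intro x
    simp only [lap, inner_sum, sum_inner, ← Finset.sum_sub_distrib]
    refine Finset.sum_congr rfl fun j _ => ?_
    have d1 := hΦ1.differentiable (by norm_num) x
    have d2 := hv1.differentiable (by norm_num) x
    have d3 := (contDiff_pd_one hv j).differentiable (by norm_num) x
    have d4 := (contDiff_pd_one hΦ j).differentiable (by norm_num) x
    rw [pd_sub (d1.inner ℝ d3) (d4.inner ℝ d2), pd_inner d1 d3, pd_inner d4 d2]
    ring
  rw [funext hpt, integral_sub (integrable_inner_left hΦ.continuous hc (continuous_lap hv))
    (integrable_inner_left (continuous_lap hΦ) (hasCompactSupport_lap hc) hv.continuous)] at h0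
  linarith

lemma integral_inner_sum_pd {E : Type*} [NormedAddCommGroup E] [InnerProductSpace ℝ E]
    {Φ : R3 → E} {V : Fin 3 → R3 → E} (hΦ : ContDiff ℝ 1 Φ) (hV : ∀ j, ContDiff ℝ 1 (V j))
    (hc : HasCompactSupport Φ) :
    ∫ x, (inner ℝ (Φ x) (∑ j, pd j (V j) x) : ℝ) =
      - ∫ x, ∑ j, (inner ℝ (pd j Φ x) (V j x) : ℝ) := by
  have h0 := integral_sum_pd_eq_zero (fun j => hΦ.inner ℝ (hV j))
    fun j => hasCompactSupport_inner_left hc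
  have hpt : ∀ x, ∑ j, pd j (fun x => (inner ℝ (Φ x) (V j x) : ℝ)) x
      = inner ℝ (Φ x) (∑ j, pd j (V j) x) + ∑ j, (inner ℝ (pd j Φ x) (V j x) : ℝ) := by
    intro x
    rw [inner_sum, ← Finset.sum_add_distrib]
    exact Finset.sum_congr rfl fun j _ => pd_inner (hΦ.differentiable (by norm_num) x)
      ((hV j).differentiable (by norm_num) x) j
  rw [funext hpt, integral_add (integrable_inner_left hΦ.continuous hc
    (continuous_finsetSum _ fun j _ => continuous_pd (hV j) j))
    (integrable_finsetSum _ fun j _ => integrable_inner_left (continuous_pd hΦ j)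
      (hasCompactSupport_pd hc j) (hV j).continuous)] at h0
  linarith

lemma continuous_vecDiv {Φ : R3 → R3} (hΦ : ContDiff ℝ 1 Φ) : Continuous (vecDiv Φ) :=
  continuous_finsetSum _ fun j _ =>
    (coordL j).continuous.comp (continuous_pd hΦ j)

lemma hasCompactSupport_vecDiv {Φ : R3 → R3} (hc : HasCompactSupport Φ) :
    HasCompactSupport (vecDiv Φ) :=
  hasCompactSupport_finset_sum _ fun j _ => (hasCompactSupport_pd hc j).comp_left
    (g := fun w : R3 => w j) rfl

lemma integral_inner_gradient {Φ : R3 → R3} {q : R3 → ℝ} (hΦ : ContDiff ℝ 1 Φ)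
    (hq : ContDiff ℝ 1 q) (hc : HasCompactSupport Φ) :
    ∫ x, (inner ℝ (Φ x) (gradient q x) : ℝ) = - ∫ x, q x * vecDiv Φ x := by
  have hΦj : ∀ j, ContDiff ℝ 1 fun x => Φ x j := fun j => (contDiff_euclidean.1 hΦ) j
  have h0 := integral_sum_pd_eq_zero (fun j => hq.mul (hΦj j)) fun j =>
    (hc.comp_left (g := fun w : R3 => w j) rfl).mul_left
  have hpt : ∀ x, ∑ j, pd j (fun x => q x * Φ x j) x
      = inner ℝ (Φ x) (gradient q x) + q x * vecDiv Φ x := by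
    intro x
    rw [vecDiv_eq_sum_pd, Finset.mul_sum, PiLp.inner_apply, ← Finset.sum_add_distrib]
    refine Finset.sum_congr rfl fun j _ => ?_
    rw [pd_mul (hq.differentiable (by norm_num) x) ((hΦj j).differentiable (by norm_num) x),
      pd_apply (hΦ.differentiable (by norm_num) x), gradient_apply_eq_pd]
    simp; ring
  have hg : Continuous fun x => gradient q x :=
    (contDiff_gradient (m := 0) hq (by norm_num)).continuous
  have hi : Integrable fun x => q x * vecDiv Φ x := integrable_of_compactSupport
    (hq.continuous.mul (continuous_vecDiv hΦ)) (hasCompactSupport_vecDiv hc).mul_left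
  rw [funext hpt, integral_add (integrable_inner_left hΦ.continuous hc hg) hi] at h0
  linarith

end Slice

/-! ### Kernel moments, the commutator and the local energy inequality. -/

lemma abs_sub_le_of_fderiv_le {ζ : R3 → ℝ} (hζ : ContDiff ℝ 1 ζ) {L : ℝ}
    (hb : ∀ x, ‖fderiv ℝ ζ x‖ ≤ L) (x y : R3) : |ζ x - ζ y| ≤ L * ‖x - y‖ :=
  convex_univ.norm_image_sub_le_of_norm_fderiv_le (𝕜 := ℝ)
    (fun z _ => hζ.differentiable (by norm_num) z) (fun z _ => hb z) (mem_univ y) (mem_univ x)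

/-- The first moment of the `j`-th partial derivative of a kernel. -/
def gradMoment (k : R3 → ℝ) (j : Fin 3) : ℝ := ∫ z, |pd j k z| * ‖z‖

lemma gradMoment_nonneg (k : R3 → ℝ) (j : Fin 3) : 0 ≤ gradMoment k j :=
  integral_nonneg fun z => by positivity

/-- The derivative of the rescaled kernel has size ε⁻⁴, the weight |z| has size ε and the volume ε³,
so the powers cancel. This keeps the eddy viscosity term uniform in ε. -/
lemma gradMoment_scaledKernel {ρ : R3 → ℝ} (hρ : IsMollifier ρ) {ε : ℝ} (hε : 0 < ε) (j : Fin 3) :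
    gradMoment (scaledKernel ρ ε) j = gradMoment ρ j := by
  have h : ∀ z, |pd j (scaledKernel ρ ε) z| * ‖z‖
      = (ε ^ 3)⁻¹ * (|pd j ρ (ε⁻¹ • z)| * ‖ε⁻¹ • z‖) := by
    intro z
    have hd : Differentiable ℝ fun x : R3 => ρ (ε⁻¹ • x) :=
      (hρ.contDiff_one.comp (contDiff_const_smul ε⁻¹)).differentiable (by norm_num)
    have h1 : pd j (scaledKernel ρ ε) z = (ε ^ 3)⁻¹ * (ε⁻¹ * pd j ρ (ε⁻¹ • z)) := by
      have := pd_const_smul (ε ^ 3)⁻¹ hd j z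
      rw [pd_comp_smul] at this
      exact this
    rw [h1, norm_smul, norm_inv, Real.norm_of_nonneg hε.le, abs_mul, abs_mul,
      abs_of_pos (inv_pos.2 hε), abs_of_pos (inv_pos.2 (pow_pos hε 3))]
    ring
  simp only [gradMoment, h]
  rw [integral_const_mul, Measure.integral_comp_inv_smul_of_nonneg volume
    (fun z : R3 => |pd j ρ z| * ‖z‖) hε.le]
  simp
  field_simp

namespace IsSlice

variable {ν MA : ℝ} {a k : R3 → ℝ} {v dv : R3 → R3} {q : R3 → ℝ} (S : IsSlice ν MA a k v dv q)
include S

lemma continuous_transport : Continuous fun x => fderiv ℝ v x (kconv k v x) :=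
  (S.v_one.continuous_fderiv (by norm_num)).clm_apply S.w_smooth.continuous

lemma continuous_stress_div : Continuous fun x => ∑ j, pd j (eddyStress k a v j) x :=
  continuous_finsetSum _ fun j _ => continuous_pd (contDiff_one (S.stress_smooth j)) j

lemma continuous_gradient_q : Continuous fun x => gradient q x :=
  (contDiff_gradient (m := 0) S.q_smooth (by norm_num)).continuous

/-- Testing the momentum equation. -/
lemma integral_inner_dv {Φ : R3 → R3} (hΦ : Continuous Φ) (hc : HasCompactSupport Φ) :
    ∫ x, (inner ℝ (Φ x) (dv x) : ℝ) = ν * (∫ x, (inner ℝ (Φ x) (lap v x) : ℝ))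
      - (∫ x, (inner ℝ (Φ x) (fderiv ℝ v x (kconv k v x)) : ℝ))
      + (∫ x, (inner ℝ (Φ x) (∑ j, pd j (eddyStress k a v j) x) : ℝ))
      - ∫ x, (inner ℝ (Φ x) (gradient q x) : ℝ) := by
  have h : ∀ x, (inner ℝ (Φ x) (dv x) : ℝ) = ν * (inner ℝ (Φ x) (lap v x) : ℝ)
      - inner ℝ (Φ x) (fderiv ℝ v x (kconv k v x))
      + inner ℝ (Φ x) (∑ j, pd j (eddyStress k a v j) x) - inner ℝ (Φ x) (gradient q x) := by
    intro x
    rw [S.momentum, inner_sub_right, inner_add_right, inner_sub_right, inner_smul_right]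
  have i1 := (integrable_inner_left hΦ hc (continuous_lap S.v_smooth)).const_mul ν
  have i2 := integrable_inner_left hΦ hc S.continuous_transport
  have i3 := integrable_inner_left hΦ hc S.continuous_stress_div
  have i4 := integrable_inner_left hΦ hc S.continuous_gradient_q
  have e1 := integral_sub ((i1.sub i2).add i3) i4
  have e2 := integral_add (i1.sub i2) i3
  have e3 := integral_sub i1 i2
  simp only [Pi.sub_apply, Pi.add_apply] at e1 e2 e3
  rw [funext h, e1, e2, e3, integral_const_mul]

/-- The weak form of the momentum equation. -/
lemma weak_momentum {Φ : R3 → R3} (hΦ : ContDiff ℝ 2 Φ) (hc : HasCompactSupport Φ) :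
    ∫ x, (inner ℝ (Φ x) (dv x) : ℝ) = ν * (∫ x, (inner ℝ (lap Φ x) (v x) : ℝ))
      + (∫ x, ∑ j, (inner ℝ (pd j Φ x) (flux k a v j x) : ℝ)) + ∫ x, q x * vecDiv Φ x := by
  have hΦ1 : ContDiff ℝ 1 Φ := hΦ.of_le (by norm_num)
  rw [S.integral_inner_dv hΦ.continuous hc, integral_inner_lap hΦ S.v_smooth hc,
    S.integral_transport hΦ1 hc,
    integral_inner_sum_pd hΦ1 (fun j => contDiff_one (S.stress_smooth j)) hc,
    integral_inner_gradient hΦ1 S.q_smooth hc]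
  have hf : ∀ x, ∑ j, (inner ℝ (pd j Φ x) (flux k a v j x) : ℝ)
      = ∑ j, kconv k v x j * inner ℝ (pd j Φ x) (v x)
        - ∑ j, (inner ℝ (pd j Φ x) (eddyStress k a v j x) : ℝ) := by
    intro x
    rw [← Finset.sum_sub_distrib]
    refine Finset.sum_congr rfl fun j _ => ?_
    rw [flux, inner_sub_right, inner_smul_right]
  rw [funext hf, integral_sub]
  · ring
  · exact integrable_of_compactSupport (continuous_finsetSum _ fun j _ =>
      (S.coord_w_smooth j).continuous.mul ((continuous_pd hΦ1 j).inner S.v_one.continuous))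
      (hasCompactSupport_finset_sum _ fun j _ => HasCompactSupport.mul_left
        (hasCompactSupport_inner_left (hasCompactSupport_pd hc j)))
  · exact integrable_finsetSum _ fun j _ => integrable_inner_left (continuous_pd hΦ1 j)
      (hasCompactSupport_pd hc j) (S.stress_smooth j).continuous

omit S in
lemma vecDiv_gradient {ψ : R3 → ℝ} (hψ : ContDiff ℝ 2 ψ) (x : R3) :
    vecDiv (fun x => gradient ψ x) x = lap ψ x := by
  rw [vecDiv_eq_sum_pd]
  exact Finset.sum_congr rfl fun j _ => pd_gradient_apply hψ j j x

lemma integral_inner_gradient_v {ψ : R3 → ℝ} (hψ : ContDiff ℝ 1 ψ) (hc : HasCompactSupport ψ) :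
    ∫ x, (inner ℝ (gradient ψ x) (v x) : ℝ) = 0 := by
  have hvj : ∀ j, ContDiff ℝ 1 fun x => v x j := fun j => (contDiff_euclidean.1 S.v_one) j
  have h0 := integral_sum_pd_eq_zero (fun j => hψ.mul (hvj j)) fun j => hc.mul_right
  have hpt : ∀ x, ∑ j, pd j (fun x => ψ x * v x j) x = inner ℝ (gradient ψ x) (v x) := by
    intro x
    have : ∀ j, pd j (fun x => ψ x * v x j) x = ψ x * pd j v x j + pd j ψ x * v x j := by
      intro j
      rw [pd_mul (hψ.differentiable (by norm_num) x) ((hvj j).differentiable (by norm_num) x),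
        pd_apply (S.v_diff x)]
    simp only [this, Finset.sum_add_distrib, ← Finset.mul_sum, S.div_free, PiLp.inner_apply,
      gradient_apply_eq_pd]
    simp [mul_comm]
  rwa [funext hpt] at h0

omit S in
lemma lap_gradient {ψ : R3 → ℝ} (hψ : ContDiff ℝ ∞ ψ) (x : R3) :
    lap (fun x => gradient ψ x) x = gradient (lap ψ) x := by
  have hg : ContDiff ℝ ∞ (fun x => gradient ψ x) := contDiff_gradient hψ (by simp)
  ext i
  rw [gradient_apply_eq_pd, lap]
  have h1 : pd i (lap ψ) x = ∑ j, pd i (pd j (pd j ψ)) x :=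
    pd_sum (fun j _ => (contDiff_one (contDiff_pd_top (contDiff_pd_top hψ j) j)).differentiable
      (by norm_num) x) i
  rw [h1]
  simp only [WithLp.ofLp_sum, Finset.sum_apply]
  refine Finset.sum_congr rfl fun j _ => ?_
  rw [← pd_apply ((contDiff_one (contDiff_pd_top hg j)).differentiable (by norm_num) x)]
  have h2 : (fun y => pd j (fun x => gradient ψ x) y i) = pd i (pd j ψ) := by
    ext y
    rw [pd_gradient_apply (contDiff_two hψ), pd_comm (contDiff_two hψ)]
  rw [h2, pd_comm (contDiff_two (contDiff_pd_top hψ j))]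

/-- The weak pressure equation, provided that `dv` is divergence free. -/
lemma abs_integral_mul_lap_le {ψ : R3 → ℝ} (hψ : ContDiff ℝ ∞ ψ) (hc : HasCompactSupport ψ)
    (hdv : ∫ x, (inner ℝ (gradient ψ x) (dv x) : ℝ) = 0)
    (hF : ∀ j, MemLp (flux k a v j) 2 volume) :
    |∫ x, q x * lap ψ x| ≤ (∑ j, l2 (flux k a v j)) * l2 (lap ψ) := by
  have hg : ContDiff ℝ ∞ (fun x => gradient ψ x) := contDiff_gradient hψ (by simp)
  have hgc := hasCompactSupport_gradient hc
  -- For the test field ∇ψ the viscous term pairs ∇Δψ with a divergence free field and vanishes; the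
  -- time derivative drops out by `hdv`. Only flux and pressure remain.
  have hw := S.weak_momentum (contDiff_two hg) hgc
  simp only [lap_gradient hψ, vecDiv_gradient (contDiff_two hψ)] at hw
  rw [hdv, S.integral_inner_gradient_v (contDiff_one (contDiff_lap_top hψ))
    (hasCompactSupport_lap hc), mul_zero, zero_add] at hw
  have hL : ∀ j, MemLp (pd j (fun x => gradient ψ x)) 2 volume := fun j =>
    memLp_of_compactSupport (contDiff_pd_top hg j).continuous (hasCompactSupport_pd hgc j)
  rw [integral_finsetSum _ fun j _ => integrable_inner (hL j) (hF j)] at hw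
  have hq : ∫ x, q x * lap ψ x =
      - ∑ j, ∫ x, (inner ℝ (pd j (fun x => gradient ψ x) x) (flux k a v j x) : ℝ) := by
    linarith
  rw [hq, abs_neg, Finset.sum_mul]
  refine (Finset.abs_sum_le_sum_abs _ _).trans (Finset.sum_le_sum fun j _ => ?_)
  refine (abs_integral_inner_le (hL j) (hF j)).trans ?_
  rw [mul_comm]
  gcongr
  · exact l2_nonneg _
  · exact l2_pd_gradient_le hψ hc j

/-- The commutator of a differentiated mollification with the multiplication by a Lipschitz
function. -/
lemma commutator_bound {ζ : R3 → ℝ} (hζ : ContDiff ℝ 1 ζ) {L : ℝ}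
    (hb : ∀ x, ‖fderiv ℝ ζ x‖ ≤ L) (j : Fin 3) :
    MemLp (fun y => kconv (pd j k) (fun x => ζ x • v x) y - ζ y • pd j (kconv k v) y) 2 volume ∧
    l2 (fun y => kconv (pd j k) (fun x => ζ x • v x) y - ζ y • pd j (kconv k v) y)
      ≤ L * gradMoment k j * l2 v := by
  have hL0 : 0 ≤ L := (norm_nonneg _).trans (hb 0)
  have hkc := S.kernel.continuous_pd j
  have hkcs := S.kernel.compactSupport_pd j
  have hζv : Continuous fun x => ζ x • v x := hζ.continuous.smul S.v_one.continuous
  have hcont : Continuous fun y =>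
      kconv (pd j k) (fun x => ζ x • v x) y - ζ y • pd j (kconv k v) y :=
    (continuous_kconv hkc hkcs hζv.locallyIntegrable).sub
      (hζ.continuous.smul (contDiff_pd_top S.w_smooth j).continuous)
  have key := memLp_of_le_kconv (k := fun z => L * (|pd j k z| * ‖z‖)) (by fun_prop)
    (HasCompactSupport.mul_left (HasCompactSupport.mul_right
      (hkcs.comp_left (g := fun t : ℝ => |t|) abs_zero))) (fun z => by positivity) S.v_memLp
    hcont.aestronglyMeasurable (fun y => ?_)
  · rwa [integral_const_mul] at key
  · rw [S.pd_w]
    simp only [kconv]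
    have i1 := integrable_kconv hkc hkcs hζv.locallyIntegrable y
    have i2 : Integrable fun x => ζ y • pd j k (y - x) • v x :=
      (integrable_kconv hkc hkcs S.v_loc y).smul (ζ y)
    rw [← integral_smul, ← integral_sub i1 i2]
    have hcs : HasCompactSupport fun z => L * (|pd j k z| * ‖z‖) :=
      HasCompactSupport.mul_left (HasCompactSupport.mul_right
        (hkcs.comp_left (g := fun t : ℝ => |t|) abs_zero))
    refine norm_integral_le_of_norm_le (integrable_kconv (by fun_prop) hcs
      (locallyIntegrable_of_memLp S.v_memLp.norm) y) (Eventually.of_forall fun x => ?_)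
    -- The integrand is ∂ⱼk(y - x) (ζ(x) - ζ(y)) v(x). The Lipschitz bound on `ζ` trades the
    -- difference for L |y - x|, and the commutator is dominated by convolution with L |∂ⱼk| |z|.
    rw [smul_comm (ζ y), ← smul_sub, ← sub_smul, norm_smul, norm_smul, smul_eq_mul,
      Real.norm_eq_abs, Real.norm_eq_abs]
    have := abs_sub_le_of_fderiv_le hζ hb x y
    rw [norm_sub_rev] at this
    calc |pd j k (y - x)| * (|ζ x - ζ y| * ‖v x‖)
        ≤ |pd j k (y - x)| * ((L * ‖y - x‖) * ‖v x‖) := by gcongr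
      _ = _ := by ring

/-- The eddy viscosity is dissipative up to a commutator. -/
lemma integral_stress_le {ζ : R3 → ℝ} (hζ : ContDiff ℝ 1 ζ) (hc : HasCompactSupport ζ)
    (h0 : ∀ x, 0 ≤ ζ x) {L : ℝ} (hb : ∀ x, ‖fderiv ℝ ζ x‖ ≤ L) :
    ∫ x, (inner ℝ (ζ x • v x) (∑ j, pd j (eddyStress k a v j) x) : ℝ)
      ≤ MA * L * l2 v * ∑ j, gradMoment k j * l2 (pd j (kconv k v)) := by
  have hζv : Continuous fun x => ζ x • v x := hζ.continuous.smul S.v_one.continuous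
  have hζvc : HasCompactSupport fun x => ζ x • v x := hc.smul_right
  simp only [inner_sum]
  rw [integral_finsetSum _ fun j _ => integrable_inner_left hζv hζvc
    (continuous_pd (contDiff_one (S.stress_smooth j)) j), Finset.mul_sum]
  refine Finset.sum_le_sum fun j _ => ?_
  have hkc := S.kernel.continuous_pd j
  have hkcs := S.kernel.compactSupport_pd j
  have haw := S.a_smul_memLp (S.pd_w_memLp j)
  rw [eddyStress, pd_kconv S.kernel.contDiff_one S.kernel.compactSupport
    (locallyIntegrable_of_memLp haw.1), integral_inner_kconv hkc hkcs
    (locallyIntegrable_of_memLp haw.1) hζv hζvc]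
  -- The adjoint of convolution by an odd kernel is its negative.
  have hrefl : ∀ y, ∫ x, pd j k (x - y) • (ζ x • v x) = - kconv (pd j k) (fun x => ζ x • v x) y := by
    intro y
    rw [kconv, ← integral_neg]
    refine integral_congr_ae (Eventually.of_forall fun x => ?_)
    simp only
    rw [← neg_smul, ← S.kernel.pd_neg, neg_sub]
  simp only [hrefl]
  obtain ⟨hcm, hcl⟩ := S.commutator_bound hζ hb j
  set G := fun y => kconv (pd j k) (fun x => ζ x • v x) y - ζ y • pd j (kconv k v) y with hG
  have hi := integrable_inner hcm haw.1
  have hcs := abs_integral_inner_le hcm haw.1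
  have hcont := continuous_kconv hkc hkcs hζv.locallyIntegrable
  have hsuppc : HasCompactSupport (kconv (pd j k) (fun x => ζ x • v x)) :=
    hasCompactSupport_kconv hkcs hζvc
  -- Split the differentiated mollification of ζv into ζ ∂ⱼ(k ⋆ v) plus the commutator `G`. The
  -- first part contributes -ζ a |∂ⱼ(k ⋆ v)|² ≤ 0 and is discarded.
  have hle : ∀ᵐ y ∂(volume : Measure R3),
      (inner ℝ (- kconv (pd j k) (fun x => ζ x • v x) y) (a y • pd j (kconv k v) y) : ℝ)
        ≤ - inner ℝ (G y) (a y • pd j (kconv k v) y) := by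
    filter_upwards [S.a_nonneg] with y hy
    have : kconv (pd j k) (fun x => ζ x • v x) y = G y + ζ y • pd j (kconv k v) y := by
      simp [hG]
    rw [this, inner_neg_left, inner_add_left, inner_smul_left, inner_smul_right,
      inner_smul_right, real_inner_self_eq_norm_sq]
    have : 0 ≤ ζ y * (a y * ‖pd j (kconv k v) y‖ ^ 2) :=
      mul_nonneg (h0 y) (mul_nonneg hy (sq_nonneg _))
    simp
    linarith
  have hm := integral_mono_ae (integrable_inner (memLp_of_compactSupport hcont.neg hsuppc.neg) haw.1)
    hi.neg hle
  refine hm.trans ?_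
  have hL0 : 0 ≤ L := (norm_nonneg _).trans (hb 0)
  have hneg : ∫ y, (-fun x => (inner ℝ (G x) (a x • pd j (kconv k v) x) : ℝ)) y
      = - ∫ y, (inner ℝ (G y) (a y • pd j (kconv k v) y) : ℝ) := integral_neg _
  rw [hneg]
  refine (neg_le_abs _).trans (hcs.trans ?_)
  calc l2 G * l2 (fun y => a y • pd j (kconv k v) y)
      ≤ (L * gradMoment k j * l2 v) * (MA * l2 (pd j (kconv k v))) := by
        gcongr
        · exact l2_nonneg _
        · exact mul_nonneg (mul_nonneg hL0 (gradMoment_nonneg k j)) (l2_nonneg v)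
        · exact haw.2
    _ = _ := by ring

lemma integral_transport_energy {ζ : R3 → ℝ} (hζ : ContDiff ℝ 1 ζ) (hc : HasCompactSupport ζ) :
    ∫ x, (inner ℝ (ζ x • v x) (fderiv ℝ v x (kconv k v x)) : ℝ)
      = - (1 / 2) * ∫ x, fderiv ℝ ζ x (kconv k v x) * ‖v x‖ ^ 2 := by
  have h := S.integral_transport (hζ.smul S.v_one) hc.smul_right
  have hpt : ∀ x, ∑ j, kconv k v x j * (inner ℝ (pd j (fun x => ζ x • v x) x) (v x) : ℝ)
      = (inner ℝ (ζ x • v x) (fderiv ℝ v x (kconv k v x)) : ℝ)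
        + fderiv ℝ ζ x (kconv k v x) * ‖v x‖ ^ 2 := by
    intro x
    rw [fderiv_apply_eq_sum_pd v, fderiv_apply_eq_sum_pd ζ, inner_sum, Finset.sum_mul,
      ← Finset.sum_add_distrib]
    refine Finset.sum_congr rfl fun j _ => ?_
    rw [pd_smul (hζ.differentiable (by norm_num) x) (S.v_diff x), inner_add_left,
      inner_smul_left, inner_smul_left, inner_smul_left, inner_smul_right,
      real_inner_self_eq_norm_sq, real_inner_comm]
    simp; ring
  have hcf : Continuous fun x => fderiv ℝ ζ x (kconv k v x) :=
    (hζ.continuous_fderiv (by norm_num)).clm_apply S.w_smooth.continuous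
  have hcc : HasCompactSupport fun x => fderiv ℝ ζ x (kconv k v x) :=
    (hc.fderiv ℝ).mono fun x hx h => hx (by simp [h])
  have i1 : Integrable fun x => (inner ℝ (ζ x • v x) (fderiv ℝ v x (kconv k v x)) : ℝ) :=
    integrable_inner_left (hζ.continuous.smul S.v_one.continuous) hc.smul_right
      S.continuous_transport
  have i2 : Integrable fun x => fderiv ℝ ζ x (kconv k v x) * ‖v x‖ ^ 2 :=
    integrable_of_compactSupport (hcf.mul (S.v_one.continuous.norm.pow 2)) hcc.mul_right
  rw [show (ζ • v) = fun x => ζ x • v x from rfl, funext hpt, integral_add i1 i2] at h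
  linarith

lemma integral_lap_energy {ζ : R3 → ℝ} (hζ : ContDiff ℝ 1 ζ) (hc : HasCompactSupport ζ) :
    ∫ x, (inner ℝ (ζ x • v x) (lap v x) : ℝ)
      = - (∫ x, ζ x * ∑ j, ‖pd j v x‖ ^ 2) - ∫ x, ∑ j, pd j ζ x * inner ℝ (v x) (pd j v x) := by
  have hV : ∀ j, ContDiff ℝ 1 (pd j v) := fun j => contDiff_pd_one S.v_smooth j
  have h := integral_inner_sum_pd (hζ.smul S.v_one) hV hc.smul_right
  have hpt : ∀ x, ∑ j, (inner ℝ (pd j (fun x => ζ x • v x) x) (pd j v x) : ℝ)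
      = ζ x * ∑ j, ‖pd j v x‖ ^ 2 + ∑ j, pd j ζ x * inner ℝ (v x) (pd j v x) := by
    intro x
    rw [Finset.mul_sum, ← Finset.sum_add_distrib]
    refine Finset.sum_congr rfl fun j _ => ?_
    rw [pd_smul (hζ.differentiable (by norm_num) x) (S.v_diff x), inner_add_left,
      inner_smul_left, inner_smul_left, real_inner_self_eq_norm_sq]
    simp
  have i1 : Integrable fun x => ζ x * ∑ j, ‖pd j v x‖ ^ 2 :=
    integrable_of_compactSupport (hζ.continuous.mul (continuous_finsetSum _ fun j _ =>
      (hV j).continuous.norm.pow 2)) hc.mul_right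
  have i2 : Integrable fun x => ∑ j, pd j ζ x * (inner ℝ (v x) (pd j v x) : ℝ) :=
    integrable_finsetSum _ fun j _ => integrable_of_compactSupport
      ((continuous_pd hζ j).mul (S.v_one.continuous.inner (hV j).continuous))
      (hasCompactSupport_pd hc j).mul_right
  rw [show (ζ • v) = fun x => ζ x • v x from rfl, funext hpt, integral_add i1 i2] at h
  simp only [lap]
  refine Eq.trans h ?_
  ring

/-- Since v · ∂ⱼv = ½ ∂ⱼ|v|², a second integration by parts removes the gradient of `v`. This serves
the global energy estimate, made before that gradient is known to be in L². -/
lemma integral_grad_energy {ζ : R3 → ℝ} (hζ : ContDiff ℝ 2 ζ) (hc : HasCompactSupport ζ) :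
    ∫ x, ∑ j, pd j ζ x * inner ℝ (v x) (pd j v x)
      = - (1 / 2) * ∫ x, lap ζ x * ‖v x‖ ^ 2 := by
  have hn : ContDiff ℝ 1 fun x => ‖v x‖ ^ 2 := S.v_one.norm_sq ℝ
  have h0 := integral_sum_pd_eq_zero (fun j => (contDiff_pd_one hζ j).mul hn)
    fun j => (hasCompactSupport_pd hc j).mul_right
  have hpt : ∀ x, ∑ j, pd j (fun x => pd j ζ x * ‖v x‖ ^ 2) x
      = 2 * ∑ j, pd j ζ x * inner ℝ (v x) (pd j v x) + lap ζ x * ‖v x‖ ^ 2 := by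
    intro x
    rw [lap, Finset.sum_mul, Finset.mul_sum, ← Finset.sum_add_distrib]
    refine Finset.sum_congr rfl fun j _ => ?_
    have : pd j (fun x => ‖v x‖ ^ 2) x = 2 * inner ℝ (v x) (pd j v x) := by
      have := pd_inner (S.v_diff x) (S.v_diff x) j
      simp only [real_inner_self_eq_norm_sq] at this
      rw [this, real_inner_comm]; ring
    rw [pd_mul ((contDiff_pd_one hζ j).differentiable (by norm_num) x)
      (hn.differentiable (by norm_num) x), this]
    ring
  have i1 : Integrable fun x => ∑ j, pd j ζ x * (inner ℝ (v x) (pd j v x) : ℝ) :=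
    integrable_finsetSum _ fun j _ => integrable_of_compactSupport
      ((contDiff_pd_one hζ j).continuous.mul (S.v_one.continuous.inner (continuous_pd S.v_one j)))
      (hasCompactSupport_pd hc j).mul_right
  have i2 : Integrable fun x => lap ζ x * ‖v x‖ ^ 2 :=
    integrable_of_compactSupport ((continuous_lap hζ).mul hn.continuous)
      (hasCompactSupport_lap hc).mul_right
  rw [funext hpt, integral_add (i1.const_mul 2) i2, integral_const_mul] at h0
  linarith

lemma vecDiv_smul_v {ζ : R3 → ℝ} (hζ : ContDiff ℝ 1 ζ) (x : R3) :
    vecDiv (fun x => ζ x • v x) x = fderiv ℝ ζ x (v x) := by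
  rw [vecDiv_eq_sum_pd, fderiv_apply_eq_sum_pd]
  have : ∀ j, pd j (fun x => ζ x • v x) x j = ζ x * pd j v x j + v x j • pd j ζ x := by
    intro j
    rw [pd_smul (hζ.differentiable (by norm_num) x) (S.v_diff x)]
    simp [mul_comm]
  simp only [this, Finset.sum_add_distrib, ← Finset.mul_sum, S.div_free]
  simp

/-- The local energy inequality at a fixed time. -/
lemma local_energy {ζ : R3 → ℝ} (hζ : ContDiff ℝ 1 ζ) (hc : HasCompactSupport ζ)
    (h0 : ∀ x, 0 ≤ ζ x) {L : ℝ} (hb : ∀ x, ‖fderiv ℝ ζ x‖ ≤ L) :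
    ∫ x, (inner ℝ (ζ x • v x) (dv x) : ℝ) ≤
      - ν * (∫ x, ζ x * ∑ j, ‖pd j v x‖ ^ 2)
      - ν * (∫ x, ∑ j, pd j ζ x * inner ℝ (v x) (pd j v x))
      + 1 / 2 * (∫ x, fderiv ℝ ζ x (kconv k v x) * ‖v x‖ ^ 2)
      + (∫ x, q x * fderiv ℝ ζ x (v x))
      + MA * L * l2 v * ∑ j, gradMoment k j * l2 (pd j (kconv k v)) := by
  rw [S.integral_inner_dv (Φ := fun x => ζ x • v x) (hζ.continuous.smul S.v_one.continuous) hc.smul_right,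
    S.integral_lap_energy hζ hc, S.integral_transport_energy hζ hc,
    integral_inner_gradient (Φ := fun x => ζ x • v x) (hζ.smul S.v_one) S.q_smooth hc.smul_right]
  have := S.integral_stress_le hζ hc h0 hb
  simp only [S.vecDiv_smul_v hζ]
  linarith

end IsSlice

/-! ### Regular solutions as evolutions on bounded time intervals. -/

lemma tensorDiv_kconv {k a : R3 → ℝ} {w : R3 → R3} (hk : IsMollifier k)
    (ha : LocallyIntegrable a volume) (hw : ContDiff ℝ 1 w) (x : R3) :
    tensorDiv (kconv k (fun y => a y • fderiv ℝ w y)) x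
      = ∑ j, pd j (kconv k (fun y => a y • pd j w y)) x := by
  have hG : LocallyIntegrable (fun y => a y • fderiv ℝ w y) volume := by
    rw [← locallyIntegrableOn_univ] at ha ⊢
    exact ha.smul_continuousOn isOpen_univ.isLocallyClosed
      (hw.continuous_fderiv (by norm_num)).continuousOn
  have hV : ContDiff ℝ 1 (kconv k (fun y => a y • fderiv ℝ w y)) :=
    contDiff_kconv (n := 1) hk.contDiff_one hk.compactSupport hG
  rw [tensorDiv]
  refine Finset.sum_congr rfl fun j _ => ?_
  have h1 : kconv k (fun y => a y • pd j w y)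
      = fun x => kconv k (fun y => a y • fderiv ℝ w y) x (stdVec j) := by
    ext1 x
    rw [kconv, kconv, ContinuousLinearMap.integral_apply
      (integrable_kconv hk.continuous hk.compactSupport hG x)]
    rfl
  have := ((hV.differentiable (by norm_num) x).hasFDerivAt.clm_apply
    (hasFDerivAt_const (stdVec j) x)).fderiv
  rw [h1, pd, this]
  simp

/-- A solution of the regularized equations on a bounded time interval, with the bounds on the
coefficients and on the velocity. -/
structure IsEvolution (ν MA τ M : ℝ) (A : ℝ → R3 → ℝ) (k : R3 → ℝ) (u : ℝ → R3 → R3)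
    (p : ℝ → R3 → ℝ) : Prop where
  slice : ∀ t ∈ Ioo 0 τ, IsSlice ν MA (A t) k (u t) (fun x => deriv (fun s => u s x) t) (p t)
  diff_time : ∀ t ∈ Ioo 0 τ, ∀ x, DifferentiableAt ℝ (fun s => u s x) t
  cont_u : ContinuousOn (fun z : ℝ × R3 => u z.1 z.2) (Ioo 0 τ ×ˢ univ)
  cont_dt : ContinuousOn (fun z : ℝ × R3 => deriv (fun s => u s z.2) z.1) (Ioo 0 τ ×ˢ univ)
  cont_grad : ContinuousOn (fun z : ℝ × R3 => fderiv ℝ (u z.1) z.2) (Ioo 0 τ ×ˢ univ)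
  l2_le : ∀ t ∈ Ioo 0 τ, l2 (u t) ≤ M
  norm_le : ∀ t ∈ Ioo 0 τ, ∀ x, ‖u t x‖ ≤ M

lemma IsEddyViscosity.exists_bound {A : ℝ → R3 → ℝ} (hA : IsEddyViscosity A) :
    ∃ MA : ℝ, 0 ≤ MA ∧ ∀ t, 0 ≤ t → ∀ᵐ x ∂(volume : Measure R3), A t x ≤ MA := by
  obtain ⟨M, hM⟩ := hA.bounded
  refine ⟨max M 0, le_max_right _ _, fun t ht => ?_⟩
  have h := hM t ht
  rw [eLpNorm_exponent_top] at h
  filter_upwards [ae_le_eLpNormEssSup (f := A t) (μ := (volume : Measure R3))] with x hx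
  have h1 := hx.trans h
  rw [← ofReal_norm, ENNReal.ofReal_le_ofReal_iff'] at h1
  rcases h1 with h1 | h1
  · exact (le_abs_self _).trans (h1.trans (le_max_left _ _))
  · exact (le_abs_self _).trans (h1.trans (le_max_right _ _))

/-- Stopping at τ strictly before T makes the L² and L^∞ bounds uniform in time. The resulting `M`
depends on the solution; it serves qualitative arguments only. -/
lemma IsRegularSolution.isEvolution {ν : ℝ} {A : ℝ → R3 → ℝ} {ρ : R3 → ℝ} {ε : ℝ} {u₀ : R3 → R3}
    {T : EReal} {u : ℝ → R3 → R3} {p : ℝ → R3 → ℝ} (h : IsRegularSolution ν A ρ ε u₀ T u p)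
    (hρ : IsMollifier ρ) (hε : 0 < ε) (hA : IsEddyViscosity A) {MA : ℝ} (hMA : 0 ≤ MA)
    (hAM : ∀ t, 0 ≤ t → ∀ᵐ x ∂(volume : Measure R3), A t x ≤ MA) {τ : ℝ} (hτ0 : 0 ≤ τ)
    (hτ : (τ : EReal) < T) : ∃ M : ℝ, 0 ≤ M ∧ IsEvolution ν MA τ M A (scaledKernel ρ ε) u p := by
  obtain ⟨M₁, h₁⟩ := h.bound_L2 τ hτ0 hτ
  obtain ⟨M₂, h₂⟩ := h.bound_Linfty τ hτ0 hτ
  have hk := isMollifier_scaledKernel hρ hε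
  have hT : ∀ t ∈ Ioo 0 τ, (t : EReal) < T := fun t ht =>
    lt_trans (EReal.coe_lt_coe_iff.2 ht.2) hτ
  have hsub : Ioo 0 τ ×ˢ (univ : Set R3) ⊆ slab T := fun z hz => ⟨hz.1.1, hT _ hz.1⟩
  have hI : ∀ t ∈ Ioo 0 τ, t ∈ Icc 0 τ := fun t ht => Ioo_subset_Icc_self ht
  refine ⟨max (max M₁ 0) M₂, le_max_of_le_left (le_max_right _ _), ?_, ?_, h.cont_u.mono hsub,
    h.cont_dt.mono hsub, h.cont_grad.mono hsub, ?_, ?_⟩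
  · intro t ht
    have hv := h.diff_space t ht.1 (hT t ht)
    have hvL : MemLp (u t) 2 volume := ⟨hv.continuous.aestronglyMeasurable,
      (h₁ t (hI t ht)).trans_lt ENNReal.ofReal_lt_top⟩
    have hw : ContDiff ℝ 1 (kconv (scaledKernel ρ ε) (u t)) :=
      contDiff_kconv (n := 1) hk.contDiff_one hk.compactSupport hv.continuous.locallyIntegrable
    refine ⟨hk, (hA.memLp t ht.1.le).1, hA.nonneg t ht.1.le, hAM t ht.1.le, hMA, hv,
      h.diff_pressure t ht.1 (hT t ht), hvL, h.divFree t ht.1 (hT t ht), fun x => ?_⟩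
    have hm := h.momentum t ht.1 (hT t ht) x
    rw [laplacian_eq_lap hv, mollify_eq_kconv ρ ε (u t), mollify_eq_kconv,
      tensorDiv_kconv hk ((hA.memLp t ht.1.le).locallyIntegrable le_top) hw] at hm
    rw [← sub_eq_zero, ← hm]
    simp only [eddyStress]
    abel
  · exact fun t ht x => h.diff_time (t, x) ⟨ht.1, hT t ht⟩
  · exact fun t ht => (l2_le_of_eLpNorm_le (h₁ t (hI t ht))).trans (le_max_left _ _)
  · exact fun t ht x => (h₂ t (hI t ht) x).trans (le_max_right _ _)

/-- Differentiation of an integral whose integrand has uniformly compact support. -/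
lemma hasDerivAt_integral_of_compactSupport {F F' : ℝ → R3 → ℝ} {s : Set ℝ} (hs : IsOpen s)
    {K : Set R3} (hK : IsCompact K) (hF : ∀ t ∈ s, Continuous (F t))
    (hF' : ContinuousOn (fun z : ℝ × R3 => F' z.1 z.2) (s ×ˢ univ))
    (hd : ∀ t ∈ s, ∀ x, HasDerivAt (fun r => F r x) (F' t x) t)
    (h0 : ∀ t ∈ s, ∀ x, x ∉ K → F t x = 0) (h0' : ∀ t ∈ s, ∀ x, x ∉ K → F' t x = 0)
    {t : ℝ} (ht : t ∈ s) : HasDerivAt (fun r => ∫ x, F r x) (∫ x, F' t x) t := by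
  obtain ⟨r, hr, hrs⟩ := Metric.isOpen_iff.1 hs t ht
  have hball : Metric.closedBall t (r / 2) ⊆ s :=
    (Metric.closedBall_subset_ball (by linarith)).trans hrs
  have hcpt : IsCompact (Metric.closedBall t (r / 2) ×ˢ K) :=
    (isCompact_closedBall t (r / 2)).prod hK
  obtain ⟨C, hC⟩ := hcpt.exists_bound_of_continuousOn
    (hF'.mono (prod_mono hball (subset_univ K)))
  have hcont' : Continuous (F' t) := by
    rw [← continuousOn_univ]
    exact hF'.comp (f := fun x => (t, x)) (by fun_prop) fun x _ => ⟨ht, mem_univ x⟩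
  refine (hasDerivAt_integral_of_dominated_loc_of_deriv_le (F := F) (F' := F')
    (bound := K.indicator fun _ => C) (s := Metric.closedBall t (r / 2)) (Metric.closedBall_mem_nhds t (by positivity)) ?_ ?_
    hcont'.aestronglyMeasurable ?_ ?_ ?_).2
  · filter_upwards [hs.mem_nhds ht] with q hq using (hF q hq).aestronglyMeasurable
  · exact integrable_of_compactSupport (hF t ht) (HasCompactSupport.intro hK (h0 t ht))
  · refine Eventually.of_forall fun x q hq => ?_
    by_cases hx : x ∈ K
    · rw [indicator_of_mem hx]; exact hC (q, x) ⟨hq, hx⟩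
    · rw [indicator_of_notMem hx, h0' q (hball hq) x hx, norm_zero]
  · exact (integrable_indicator_iff hK.measurableSet).2 (integrableOn_const hK.measure_ne_top)
  · exact Eventually.of_forall fun x q hq => hd q (hball hq) x

/-! ### Time derivatives of pairings and of local energies. -/

namespace IsEvolution

variable {ν MA τ M : ℝ} {A : ℝ → R3 → ℝ} {k : R3 → ℝ} {u : ℝ → R3 → R3} {p : ℝ → R3 → ℝ}
  (H : IsEvolution ν MA τ M A k u p)
include H

lemma hasDerivAt_u {t : ℝ} (ht : t ∈ Ioo 0 τ) (x : R3) :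
    HasDerivAt (fun s => u s x) (deriv (fun s => u s x) t) t := (H.diff_time t ht x).hasDerivAt

lemma hasDerivAt_pairing {Φ : R3 → R3} (hΦ : Continuous Φ) (hc : HasCompactSupport Φ) {t : ℝ}
    (ht : t ∈ Ioo 0 τ) : HasDerivAt (fun s => ∫ x, (inner ℝ (Φ x) (u s x) : ℝ))
      (∫ x, (inner ℝ (Φ x) (deriv (fun s => u s x) t) : ℝ)) t := by
  refine hasDerivAt_integral_of_compactSupport (F := fun s x => (inner ℝ (Φ x) (u s x) : ℝ))
    (F' := fun t x => (inner ℝ (Φ x) (deriv (fun s => u s x) t) : ℝ)) isOpen_Ioo hc ?_ ?_ ?_ ?_ ?_ ht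
  · exact fun t ht => hΦ.inner (H.slice t ht).v_one.continuous
  · exact (hΦ.comp continuous_snd).continuousOn.inner H.cont_dt
  · intro t ht x
    simpa using (hasDerivAt_const t (Φ x)).inner ℝ (H.hasDerivAt_u ht x)
  · intro t ht x hx; simp [image_eq_zero_of_notMem_tsupport hx]
  · intro t ht x hx; simp [image_eq_zero_of_notMem_tsupport hx]

lemma continuousOn_energy_rate {ζ : R3 → ℝ} (hζ : Continuous ζ) :
    ContinuousOn (fun z : ℝ × R3 => (inner ℝ (ζ z.2 • u z.1 z.2) (deriv (fun s => u s z.2) z.1) : ℝ))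
      (Ioo 0 τ ×ˢ univ) :=
  ((hζ.comp continuous_snd).continuousOn.smul H.cont_u).inner H.cont_dt

lemma hasDerivAt_energy {ζ : R3 → ℝ} (hζ : Continuous ζ) (hc : HasCompactSupport ζ) {t : ℝ}
    (ht : t ∈ Ioo 0 τ) : HasDerivAt (fun s => ∫ x, 1 / 2 * (ζ x * ‖u s x‖ ^ 2))
      (∫ x, (inner ℝ (ζ x • u t x) (deriv (fun s => u s x) t) : ℝ)) t := by
  refine hasDerivAt_integral_of_compactSupport (F := fun s x => 1 / 2 * (ζ x * ‖u s x‖ ^ 2))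
    (F' := fun t x => (inner ℝ (ζ x • u t x) (deriv (fun s => u s x) t) : ℝ)) isOpen_Ioo hc
    ?_ (H.continuousOn_energy_rate hζ) ?_ ?_ ?_ ht
  · exact fun t ht => continuous_const.mul (hζ.mul ((H.slice t ht).v_one.continuous.norm.pow 2))
  · intro t ht x
    have := ((H.hasDerivAt_u ht x).norm_sq.const_mul (ζ x)).const_mul (1 / 2)
    have e : 1 / 2 * (ζ x * (2 * (inner ℝ (u t x) (deriv (fun s => u s x) t) : ℝ)))
        = inner ℝ (ζ x • u t x) (deriv (fun s => u s x) t) := by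
      rw [inner_smul_left]; simp; ring
    rwa [e] at this
  · intro t ht x hx; simp [image_eq_zero_of_notMem_tsupport hx]
  · intro t ht x hx; simp [image_eq_zero_of_notMem_tsupport hx]

lemma continuousOn_integral_energy_rate {ζ : R3 → ℝ} (hζ : Continuous ζ)
    (hc : HasCompactSupport ζ) : ContinuousOn
      (fun t => ∫ x, (inner ℝ (ζ x • u t x) (deriv (fun s => u s x) t) : ℝ)) (Ioo 0 τ) := by
  refine continuousOn_integral_of_compact_support hc (H.continuousOn_energy_rate hζ) ?_
  intro t x ht hx
  simp [image_eq_zero_of_notMem_tsupport hx]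

/-- The pairing of ∇ψ with u(s) vanishes for all s, hence so does its derivative. Mixed derivatives
of u in time and space, which are not assumed to exist, are avoided. -/
lemma integral_gradient_dt {ψ : R3 → ℝ} (hψ : ContDiff ℝ 1 ψ) (hc : HasCompactSupport ψ) {t : ℝ}
    (ht : t ∈ Ioo 0 τ) :
    ∫ x, (inner ℝ (gradient ψ x) (deriv (fun s => u s x) t) : ℝ) = 0 := by
  have h1 := H.hasDerivAt_pairing (contDiff_gradient (m := 0) hψ (by norm_num)).continuous
    (hasCompactSupport_gradient hc) ht
  have h2 : (fun s => ∫ x, (inner ℝ (gradient ψ x) (u s x) : ℝ)) =ᶠ[𝓝 t] fun _ => 0 := by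
    filter_upwards [isOpen_Ioo.mem_nhds ht] with s hs
    exact (H.slice s hs).integral_inner_gradient_v hψ hc
  exact h1.unique ((hasDerivAt_const t (0 : ℝ)).congr_of_eventuallyEq h2)

lemma M_nonneg {t : ℝ} (ht : t ∈ Ioo 0 τ) : 0 ≤ M := (l2_nonneg _).trans (H.l2_le t ht)

lemma flux_memLp {t : ℝ} (ht : t ∈ Ioo 0 τ) (j : Fin 3) :
    MemLp (flux k (A t) (u t) j) 2 volume ∧
      l2 (flux k (A t) (u t) j) ≤ M * M + MA * ((∫ z, |pd j k z|) * M) := by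
  have S := H.slice t ht
  have hM := H.M_nonneg ht
  have hb : ∀ x, ‖kconv k (u t) x j • u t x‖ ≤ M * ‖u t x‖ := by
    intro x
    rw [norm_smul]
    gcongr
    exact (PiLp.norm_apply_le _ j).trans (S.norm_w_le (H.norm_le t ht) x)
  have h1 : MemLp (fun x => kconv k (u t) x j • u t x) 2 volume :=
    S.v_memLp.of_le_mul ((S.coord_w_smooth j).continuous.smul
      S.v_one.continuous).aestronglyMeasurable (Eventually.of_forall hb)
  refine ⟨h1.sub (S.stress_memLp j), (l2_sub_le h1 (S.stress_memLp j)).trans (add_le_add ?_ ?_)⟩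
  · refine (l2_le_of_norm_le hM S.v_memLp (Eventually.of_forall hb)).trans ?_
    gcongr
    exact H.l2_le t ht
  · refine (S.l2_stress_le j).trans (mul_le_mul_of_nonneg_left ?_ S.MA_nonneg)
    exact (S.l2_pd_w_le j).trans (mul_le_mul_of_nonneg_left (H.l2_le t ht)
      (integral_nonneg fun z => abs_nonneg _))

end IsEvolution

/-! ### Laplacians and divergences of smooth fields. -/

section SmoothConvolution

variable {E : Type*} [NormedAddCommGroup E] [InnerProductSpace ℝ E]

lemma lap_kconv_right [CompleteSpace E] {k : R3 → ℝ} (hk : ContDiff ℝ 2 k)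
    (hkc : HasCompactSupport k) {U : R3 → E} (hU : ContDiff ℝ 2 U) :
    lap (kconv k U) = kconv k (lap U) := by
  have hk1 : ContDiff ℝ 1 k := hk.of_le (by norm_num)
  have hU1 : ContDiff ℝ 1 U := hU.of_le (by norm_num)
  have h1 : ∀ {W : R3 → E}, ContDiff ℝ 1 W → ∀ j, pd j (kconv k W) = kconv k (pd j W) :=
    fun hW j => by
      rw [pd_kconv hk1 hkc hW.continuous.locallyIntegrable]
      ext1 x
      exact (kconv_pd_right hk1 hkc hW j x).symm
  ext1 x
  simp only [lap, h1 hU1, h1 (contDiff_pd_one hU _), kconv, Finset.smul_sum]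
  rw [integral_finsetSum]
  exact fun j _ => integrable_kconv hk.continuous hkc
    (continuous_pd (contDiff_pd_one hU j) j).locallyIntegrable x

lemma abs_vecDiv_le (Φ : R3 → R3) (x : R3) : |vecDiv Φ x| ≤ ∑ j, ‖pd j Φ x‖ := by
  rw [vecDiv_eq_sum_pd]
  exact (Finset.abs_sum_le_sum_abs _ _).trans
    (Finset.sum_le_sum fun j _ => by simpa using PiLp.norm_apply_le (pd j Φ x) j)

lemma vecDiv_sub {Φ Ψ : R3 → R3} {x : R3} (hΦ : DifferentiableAt ℝ Φ x)
    (hΨ : DifferentiableAt ℝ Ψ x) :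
    vecDiv (fun y => Φ y - Ψ y) x = vecDiv Φ x - vecDiv Ψ x := by
  simp only [vecDiv_eq_sum_pd, pd_sub hΦ hΨ, ← Finset.sum_sub_distrib]
  rfl

lemma contDiff_vecDiv {Ψ : R3 → R3} (h : ContDiff ℝ ∞ Ψ) : ContDiff ℝ ∞ (vecDiv Ψ) :=
  ContDiff.sum fun j _ => (coordL j).contDiff.comp (contDiff_pd_top h j)

lemma vecDiv_lap {Ψ : R3 → R3} (h : ContDiff ℝ ∞ Ψ) (x : R3) :
    vecDiv (lap Ψ) x = lap (vecDiv Ψ) x := by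
  have hd : ∀ {f : R3 → R3}, ContDiff ℝ ∞ f → Differentiable ℝ f := fun h =>
    (contDiff_one h).differentiable (by norm_num)
  have hdc : ∀ {f : R3 → R3} (i : Fin 3), ContDiff ℝ ∞ f → Differentiable ℝ fun y => coordL i (f y) :=
    fun i h => (coordL i).differentiable.comp (hd h)
  have hr : ∀ j, pd j (vecDiv Ψ) = fun y => ∑ i, coordL i (pd j (pd i Ψ) y) := by
    intro j
    ext y
    have : vecDiv Ψ = fun y => ∑ i, coordL i (pd i Ψ y) := rfl
    rw [this, pd_sum fun i _ => hdc i (contDiff_pd_top h i) y]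
    exact Finset.sum_congr rfl fun i _ => pd_clm_comp (coordL i) (hd (contDiff_pd_top h i) y) j
  have hl : ∀ i, pd i (lap Ψ) x = ∑ j, pd i (pd j (pd j Ψ)) x := fun i =>
    pd_sum (fun j _ => hd (contDiff_pd_top (contDiff_pd_top h j) j) x) i
  rw [vecDiv_eq_sum_pd]
  simp only [lap, hr]
  rw [Finset.sum_congr rfl fun j _ => pd_sum
    (fun i _ => hdc i (contDiff_pd_top (contDiff_pd_top h i) j) x) j, Finset.sum_comm]
  refine Finset.sum_congr rfl fun i _ => ?_
  rw [hl i, WithLp.ofLp_sum, Finset.sum_apply]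
  refine Finset.sum_congr rfl fun j _ => ?_
  rw [pd_clm_comp (coordL i) (hd (contDiff_pd_top (contDiff_pd_top h i) j) x), coordL_apply,
    pd_comm (contDiff_two (contDiff_pd_top h j)),
    show pd i (pd j Ψ) = pd j (pd i Ψ) from funext fun y => pd_comm (contDiff_two h) i j y]

lemma l2_vecDiv_le {Φ : R3 → R3} (h : ∀ j, MemLp (pd j Φ) 2 volume) :
    l2 (vecDiv Φ) ≤ ∑ j, l2 (pd j Φ) := by
  have hs : MemLp (fun x => ∑ j, ‖pd j Φ x‖) 2 volume :=
    memLp_finsetSum _ fun j _ => (h j).norm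
  refine (l2_mono hs (Eventually.of_forall fun x => ?_)).trans
    ((l2_sum_le Finset.univ fun j _ => (h j).norm).trans (le_of_eq ?_))
  · rw [Real.norm_eq_abs, Real.norm_eq_abs]
    exact (abs_vecDiv_le Φ x).trans (le_abs_self _)
  · exact Finset.sum_congr rfl fun j _ => l2_norm _

end SmoothConvolution

/-- The sum of the `L²` norms of the columns of the flux. -/
def fluxNorm (k a : R3 → ℝ) (v : R3 → R3) : ℝ := ∑ j, l2 (flux k a v j)

lemma fluxNorm_nonneg (k a : R3 → ℝ) (v : R3 → R3) : 0 ≤ fluxNorm k a v :=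
  Finset.sum_nonneg fun _ _ => l2_nonneg _

/-! ### The pressure estimate by duality. -/

namespace IsEvolution

variable {ν MA τ M : ℝ} {A : ℝ → R3 → ℝ} {k : R3 → ℝ} {u : ℝ → R3 → R3} {p : ℝ → R3 → ℝ}
  (H : IsEvolution ν MA τ M A k u p)
include H

/-- A bound for the pressure tested against Laplacians. -/
lemma abs_integral_pressure_lap_le {ψ : R3 → ℝ} (hψ : ContDiff ℝ ∞ ψ) (hc : HasCompactSupport ψ)
    {t : ℝ} (ht : t ∈ Ioo 0 τ) :
    |∫ x, p t x * lap ψ x| ≤ fluxNorm k (A t) (u t) * l2 (lap ψ) :=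
  (H.slice t ht).abs_integral_mul_lap_le hψ hc
    (H.integral_gradient_dt (contDiff_one hψ) hc ht) fun j => (H.flux_memLp ht j).1

/-- The bound depends on `M` and on the kernel. It gives uniformity in time for limits and never
enters the final constant. -/
lemma exists_fluxNorm_le : ∃ B : ℝ, 0 ≤ B ∧ ∀ t ∈ Ioo 0 τ, fluxNorm k (A t) (u t) ≤ B := by
  refine ⟨max 0 (∑ j, (M * M + MA * ((∫ z, |pd j k z|) * M))), le_max_left _ _,
    fun t ht => le_max_of_le_right (Finset.sum_le_sum fun j _ => (H.flux_memLp ht j).2)⟩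

/-- The terms of the weak momentum equation other than the pressure are controlled by the `H²` norm
of the test function, uniformly in time. -/
lemma abs_pairing_dt_sub_pressure_le {φ : R3 → ℝ} (hφ : ContDiff ℝ ∞ φ)
    (hφc : HasCompactSupport φ) : ∃ C : ℝ, 0 ≤ C ∧ ∀ r : R3 → R3, Continuous r →
      HasCompactSupport r → ∀ t ∈ Ioo 0 τ,
      |∫ x, (inner ℝ (kconv φ r x) (u t x) : ℝ)| ≤ C * l2 r ∧
      |(∫ x, (inner ℝ (kconv φ r x) (deriv (fun s => u s x) t) : ℝ))
        - ∫ x, p t x * vecDiv (kconv φ r) x| ≤ C * l2 r := by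
  obtain ⟨B, hB0, hB⟩ := H.exists_fluxNorm_le
  rcases (Ioo 0 τ).eq_empty_or_nonempty with he | ⟨t₀, ht₀⟩
  · exact ⟨0, le_rfl, fun r _ _ t ht => by rw [he] at ht; exact absurd ht (notMem_empty t)⟩
  have hM0 := H.M_nonneg ht₀
  set c₀ := ∫ z, |φ z|
  set c₁ := ∑ j, ∫ z, |pd j φ z|
  set c₂ := ∫ z, |lap φ z|
  have hc₀ : 0 ≤ c₀ := integral_nonneg fun z => abs_nonneg _
  have hcj : ∀ j, 0 ≤ ∫ z, |pd j φ z| := fun j => integral_nonneg fun z => abs_nonneg _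
  have hc₁ : 0 ≤ c₁ := Finset.sum_nonneg fun j _ => hcj j
  have hc₂ : 0 ≤ c₂ := integral_nonneg fun z => abs_nonneg _
  refine ⟨c₀ * M + (|ν| * (c₂ * M) + c₁ * B), by positivity, fun r hr hrc t ht => ?_⟩
  have S := H.slice t ht
  have hrL := memLp_of_compactSupport hr hrc
  have hrl := locallyIntegrable_of_memLp hrL
  have hl0 := l2_nonneg r
  have huM := H.l2_le t ht
  obtain ⟨m0, e0⟩ := memLp_kconv hφ.continuous hφc hrL
  have hΦ : ContDiff ℝ ∞ (kconv φ r) := contDiff_kconv (n := ⊤) hφ hφc hrl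
  have hΦc : HasCompactSupport (kconv φ r) := hasCompactSupport_kconv hφc hrc
  refine ⟨?_, ?_⟩
  · calc _ ≤ l2 (kconv φ r) * l2 (u t) := abs_integral_inner_le m0 S.v_memLp
      _ ≤ (c₀ * l2 r) * M := by gcongr; exact l2_nonneg _
      _ = (c₀ * M) * l2 r := by ring
      _ ≤ _ := by gcongr; exact le_add_of_nonneg_right (by positivity)
  · rw [S.weak_momentum (contDiff_two hΦ) hΦc, add_sub_cancel_right]
    -- All derivatives are put on `φ`, so that the test field is controlled by the L² norm of `r`
    -- alone.
    have hl : lap (kconv φ r) = kconv (lap φ) r := lap_kconv (contDiff_two hφ) hφc hrl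
    obtain ⟨m2, e2⟩ := memLp_kconv (continuous_lap (contDiff_two hφ))
      (hasCompactSupport_lap hφc) hrL
    have hp : ∀ j, pd j (kconv φ r) = kconv (pd j φ) r := pd_kconv (contDiff_one hφ) hφc hrl
    have m1 := fun j => (memLp_kconv (contDiff_pd_top hφ j).continuous
      (hasCompactSupport_pd hφc j) hrL)
    have b2 : |ν * ∫ x, (inner ℝ (lap (kconv φ r) x) (u t x) : ℝ)| ≤ |ν| * ((c₂ * l2 r) * M) := by
      rw [abs_mul, hl]
      gcongr
      refine (abs_integral_inner_le m2 S.v_memLp).trans ?_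
      gcongr
      exact l2_nonneg _
    have b1 : |∫ x, ∑ j, (inner ℝ (pd j (kconv φ r) x) (flux k (A t) (u t) j x) : ℝ)|
        ≤ (c₁ * l2 r) * B := by
      simp only [hp]
      rw [integral_finsetSum _ fun j _ => integrable_inner (m1 j).1 (H.flux_memLp ht j).1]
      refine (Finset.abs_sum_le_sum_abs _ _).trans ?_
      rw [Finset.sum_mul, Finset.sum_mul]
      refine Finset.sum_le_sum fun j _ => ?_
      refine (abs_integral_inner_le (m1 j).1 (H.flux_memLp ht j).1).trans ?_
      refine mul_le_mul (m1 j).2 ?_ (l2_nonneg _) (mul_nonneg (hcj j) hl0)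
      exact (Finset.single_le_sum (f := fun j => l2 (flux k (A t) (u t) j))
        (fun j _ => l2_nonneg _) (Finset.mem_univ j)).trans (hB t ht)
    refine ((abs_add_le _ _).trans (add_le_add b2 b1)).trans ?_
    have : 0 ≤ c₀ * M * l2 r := by positivity
    linarith

/-- A bound for the pressure tested against the divergence of a mollified field. -/
lemma abs_integral_pressure_vecDiv_kconv_le {φ : R3 → ℝ} (hφ : ContDiff ℝ ∞ φ)
    (hφc : HasCompactSupport φ) {f : R3 → R3} (hf : Continuous f) (hfc : HasCompactSupport f)
    {t : ℝ} (ht : t ∈ Ioo 0 τ) :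
    |∫ x, p t x * vecDiv (kconv φ f) x| ≤
      fluxNorm k (A t) (u t) * l2 (vecDiv (kconv φ f)) := by
  obtain ⟨C, hC0, hC⟩ := H.abs_pairing_dt_sub_pressure_le hφ hφc
  obtain ⟨B, hB0, hB⟩ := H.exists_fluxNorm_le
  have hfL := memLp_of_compactSupport hf hfc
  -- Smallness of the remainder lap ψₙ - f in L² becomes smallness of every derivative after
  -- convolution with `φ`, which is why the field is mollified.
  choose ψ hψ hψc hψl using fun n : ℕ => exists_lap_approx hfL
    (δ := 1 / ((n : ℝ) + 1)) Nat.one_div_pos_of_nat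
  set r : ℕ → R3 → R3 := fun n x => lap (ψ n) x - f x with hr
  have hlap : ∀ n, Continuous (lap (ψ n)) := fun n => continuous_lap (contDiff_two (hψ n))
  have hlapc : ∀ n, HasCompactSupport (lap (ψ n)) := fun n => hasCompactSupport_lap (hψc n)
  have hrc : ∀ n, Continuous (r n) := fun n => (hlap n).sub hf
  have hrs : ∀ n, HasCompactSupport (r n) := fun n => (hlapc n).sub hfc
  have hrL : ∀ n, MemLp (r n) 2 volume := fun n => memLp_of_compactSupport (hrc n) (hrs n)
  set Ψ : ℕ → R3 → R3 := fun n => kconv φ (ψ n) with hΨ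
  have hΨs : ∀ n, ContDiff ℝ ∞ (Ψ n) := fun n =>
    contDiff_kconv (n := ⊤) hφ hφc (hψ n).continuous.locallyIntegrable
  have hΨc : ∀ n, HasCompactSupport (Ψ n) := fun n => hasCompactSupport_kconv hφc (hψc n)
  have hΦs : ContDiff ℝ ∞ (kconv φ f) := contDiff_kconv (n := ⊤) hφ hφc hf.locallyIntegrable
  have hΦc : HasCompactSupport (kconv φ f) := hasCompactSupport_kconv hφc hfc
  have hd : ∀ {g : R3 → R3}, ContDiff ℝ ∞ g → Differentiable ℝ g := fun h =>
    (contDiff_one h).differentiable (by norm_num)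
  have hkr : ∀ n, kconv φ (r n) = fun x => lap (Ψ n) x - kconv φ f x := by
    intro n
    ext1 x
    rw [hΨ, lap_kconv_right (contDiff_two hφ) hφc (contDiff_two (hψ n))]
    exact kconv_sub hφ.continuous hφc (hlap n).locallyIntegrable hf.locallyIntegrable x
  set g : ℕ → R3 → ℝ := fun n => vecDiv (Ψ n) with hg
  have hgs : ∀ n, ContDiff ℝ ∞ (g n) := fun n => contDiff_vecDiv (hΨs n)
  have hgneg : ∀ n, ContDiff ℝ ∞ fun y => (-1 : ℝ) • g n y := fun n => (hgs n).const_smul (-1 : ℝ)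
  have hgc : ∀ n, HasCompactSupport (g n) := fun n => hasCompactSupport_vecDiv (hΨc n)
  have hdiv : ∀ n x, vecDiv (kconv φ (r n)) x = lap (g n) x - vecDiv (kconv φ f) x := by
    intro n x
    rw [hkr, vecDiv_sub (hd (contDiff_lap_top (hΨs n)) x) (hd hΦs x), vecDiv_lap (hΨs n)]
  set c₁ := ∑ j, ∫ z, |pd j φ z|
  have hc₁ : 0 ≤ c₁ := Finset.sum_nonneg fun j _ => integral_nonneg fun z => abs_nonneg _
  have hδ : ∀ n, l2 (fun x => lap (g n) x - vecDiv (kconv φ f) x) ≤ c₁ * (1 / ((n : ℝ) + 1)) := by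
    intro n
    rw [← funext (hdiv n)]
    have hp : ∀ j, pd j (kconv φ (r n)) = kconv (pd j φ) (r n) :=
      pd_kconv (contDiff_one hφ) hφc (locallyIntegrable_of_memLp (hrL n))
    have m1 := fun j => memLp_kconv (contDiff_pd_top hφ j).continuous
      (hasCompactSupport_pd hφc j) (hrL n)
    refine (l2_vecDiv_le fun j => by rw [hp]; exact (m1 j).1).trans ?_
    rw [Finset.sum_mul]
    refine Finset.sum_le_sum fun j _ => ?_
    rw [hp]
    refine (m1 j).2.trans (mul_le_mul_of_nonneg_left (hψl n).le ?_)
    exact integral_nonneg fun z => abs_nonneg _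
  have hgl : ∀ n, MemLp (lap (g n)) 2 volume := fun n =>
    memLp_of_compactSupport (continuous_lap (contDiff_two (hgs n))) (hasCompactSupport_lap (hgc n))
  have hDc : Continuous (vecDiv (kconv φ f)) := continuous_vecDiv (contDiff_one hΦs)
  have hDs : HasCompactSupport (vecDiv (kconv φ f)) := hasCompactSupport_vecDiv hΦc
  have hDl : MemLp (vecDiv (kconv φ f)) 2 volume := memLp_of_compactSupport hDc hDs
  have hpi : ∀ s ∈ Ioo 0 τ, ∀ {h : R3 → ℝ}, Continuous h → HasCompactSupport h →
      Integrable fun x => p s x * h x := fun s hs h hh hhc =>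
    integrable_of_compactSupport ((H.slice s hs).q_smooth.continuous.mul hh) hhc.mul_left
  have hgi : ∀ s ∈ Ioo 0 τ, ∀ n, Integrable fun x => p s x * lap (g n) x := fun s hs n =>
    hpi s hs (continuous_lap (contDiff_two (hgs n))) (hasCompactSupport_lap (hgc n))
  set a : ℕ → ℝ → ℝ := fun n s => ∫ x, p s x * lap (g n) x with ha
  set π : ℝ → ℝ := fun s => ∫ x, p s x * vecDiv (kconv φ f) x with hπ
  -- Here the exact factor `fluxNorm` is kept, since this estimate passes to the limit. The Cauchy
  -- estimate that follows uses the crude uniform bound `B`.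
  have hab : ∀ s ∈ Ioo 0 τ, ∀ n,
      |a n s| ≤ fluxNorm k (A s) (u s) * (l2 (vecDiv (kconv φ f)) + c₁ * (1 / ((n : ℝ) + 1))) := by
    intro s hs n
    refine (H.abs_integral_pressure_lap_le (hgs n) (hgc n) hs).trans
      (mul_le_mul_of_nonneg_left ?_ (fluxNorm_nonneg _ _ _))
    have := (le_abs_self _).trans (abs_l2_sub_l2_le (hgl n) hDl)
    linarith [hδ n]
  have haa : ∀ s ∈ Ioo 0 τ, ∀ n m,
      |a n s - a m s| ≤ B * (c₁ * (1 / ((n : ℝ) + 1)) + c₁ * (1 / ((m : ℝ) + 1))) := by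
    intro s hs n m
    have e : ∀ x, lap (fun y => g n y + (-1 : ℝ) • g m y) x = lap (g n) x - lap (g m) x := by
      intro x
      rw [lap_add (g := fun y => (-1 : ℝ) • g m y) (contDiff_two (hgs n))
        (contDiff_two (hgneg m)),
        lap_const_smul _ (contDiff_two (hgs m))]
      simp [sub_eq_add_neg]
    have h1 := H.abs_integral_pressure_lap_le (ψ := fun y => g n y + (-1 : ℝ) • g m y)
      ((hgs n).add (hgneg m))
      ((hgc n).add ((hgc m).smul_left (f := fun _ => (-1 : ℝ)))) hs
    have h3 : a n s - a m s = ∫ x, p s x * (lap (g n) x - lap (g m) x) := by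
      rw [ha]
      simp only [mul_sub]
      rw [integral_sub (hgi s hs n) (hgi s hs m)]
    have h4 : l2 (fun x => lap (g n) x - lap (g m) x)
        ≤ c₁ * (1 / ((n : ℝ) + 1)) + c₁ * (1 / ((m : ℝ) + 1)) := by
      have h5 := l2_sub_le ((hgl n).sub hDl) ((hgl m).sub hDl)
      have h6 : (fun x => (lap (g n) - vecDiv (kconv φ f)) x - (lap (g m) - vecDiv (kconv φ f)) x)
          = fun x => lap (g n) x - lap (g m) x := by ext x; simp
      rw [h6] at h5
      exact h5.trans (add_le_add (hδ n) (hδ m))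
    rw [h3]
    rw [show lap (fun y => g n y + (-1 : ℝ) • g m y) = _ from funext e] at h1
    exact h1.trans (mul_le_mul (hB s hs) h4 (l2_nonneg _) hB0)
  have hlim0 : Tendsto (fun n : ℕ => 1 / ((n : ℝ) + 1)) atTop (𝓝 0) :=
    tendsto_one_div_add_atTop_nhds_zero_nat
  have hanti : ∀ {n m : ℕ}, n ≤ m → 1 / ((m : ℝ) + 1) ≤ 1 / ((n : ℝ) + 1) := fun h =>
    Nat.one_div_le_one_div h
  have hex : ∀ s, ∃ l, s ∈ Ioo 0 τ → Tendsto (fun n => a n s) atTop (𝓝 l) := by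
    intro s
    by_cases hs : s ∈ Ioo 0 τ
    · have : CauchySeq fun n => a n s := by
        refine cauchySeq_of_le_tendsto_0 (fun N : ℕ => B * (c₁ * (1 / ((N : ℝ) + 1))
          + c₁ * (1 / ((N : ℝ) + 1)))) (fun n m N hn hm => ?_) ?_
        · rw [Real.dist_eq]
          refine (haa s hs n m).trans ?_
          gcongr
        · simpa using ((hlim0.const_mul c₁).add (hlim0.const_mul c₁)).const_mul B
      obtain ⟨l, hl⟩ := cauchySeq_tendsto_of_complete this
      exact ⟨l, fun _ => hl⟩
    · exact ⟨0, fun h => absurd h hs⟩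
  choose α hα using hex
  -- The rate is uniform in time, as needed to differentiate a limit below.
  have hαn : ∀ s ∈ Ioo 0 τ, ∀ n, |a n s - α s| ≤ B * (c₁ + c₁) * (1 / ((n : ℝ) + 1)) := by
    intro s hs n
    refine le_of_tendsto ((tendsto_const_nhds.sub (hα s hs)).abs) ?_
    filter_upwards [eventually_ge_atTop n] with m hm
    refine (haa s hs n m).trans ?_
    calc _ ≤ B * (c₁ * (1 / ((n : ℝ) + 1)) + c₁ * (1 / ((n : ℝ) + 1))) := by
          gcongr
      _ = _ := by ring
  -- The pairings of u with φ ⋆ rₙ tend to zero, and by the momentum equation their time derivatives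
  -- tend uniformly to α - π. The defect between the limit of the Laplacian pairings and the true
  -- pressure pairing is thus the derivative of zero.
  have hder : ∀ s ∈ Ioo 0 τ, HasDerivAt (fun _ : ℝ => (0 : ℝ)) (α s - π s) s := by
    intro s hs
    refine hasDerivAt_of_tendstoUniformlyOn (l := atTop) (s := Ioo 0 τ) isOpen_Ioo
      (f := fun n s => ∫ x, (inner ℝ (kconv φ (r n) x) (u s x) : ℝ))
      (f' := fun n s => ∫ x, (inner ℝ (kconv φ (r n) x) (deriv (fun q => u q x) s) : ℝ))
      (g' := fun s => α s - π s) ?_ (Eventually.of_forall fun n q hq => ?_) (fun q hq => ?_) hs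
    · rw [Metric.tendstoUniformlyOn_iff]
      intro e he
      have hl : Tendsto (fun n : ℕ => (C + B * (c₁ + c₁)) * (1 / ((n : ℝ) + 1))) atTop (𝓝 0) := by
        simpa using hlim0.const_mul (C + B * (c₁ + c₁))
      filter_upwards [hl.eventually (gt_mem_nhds he)] with n hn q hq
      refine lt_of_le_of_lt ?_ hn
      have h1 := (hC (r n) (hrc n) (hrs n) q hq).2
      have h2 : ∫ x, p q x * vecDiv (kconv φ (r n)) x = a n q - π q := by
        simp only [hdiv, mul_sub]
        exact integral_sub (hgi q hq n) (hpi q hq hDc hDs)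
      rw [h2] at h1
      have h3 := h1.trans (mul_le_mul_of_nonneg_left (hψl n).le hC0)
      have h4 := hαn q hq n
      rw [Real.dist_eq, add_mul]
      refine le_trans ?_ (add_le_add h3 h4)
      rw [abs_sub_comm]
      refine le_trans (le_of_eq ?_) (abs_add_le _ _)
      congr 1; ring
    · exact H.hasDerivAt_pairing (continuous_kconv hφ.continuous hφc
        (locallyIntegrable_of_memLp (hrL n))) (hasCompactSupport_kconv hφc (hrs n)) hq
    · refine squeeze_zero_norm (a := fun n : ℕ => C * (1 / ((n : ℝ) + 1))) (fun n => ?_) ?_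
      · exact ((hC (r n) (hrc n) (hrs n) q hq).1).trans
          (mul_le_mul_of_nonneg_left (hψl n).le hC0)
      · simpa using hlim0.const_mul C
  have hαπ : α t = π t := by
    have := (hder t ht).unique (hasDerivAt_const t (0 : ℝ))
    linarith
  have hlimit : Tendsto (fun n => |a n t|) atTop (𝓝 |π t|) := by
    rw [← hαπ]; exact (hα t ht).abs
  have hlimit2 : Tendsto (fun n : ℕ => fluxNorm k (A t) (u t) *
      (l2 (vecDiv (kconv φ f)) + c₁ * (1 / ((n : ℝ) + 1)))) atTop
      (𝓝 (fluxNorm k (A t) (u t) * (l2 (vecDiv (kconv φ f)) + c₁ * 0))) :=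
    (tendsto_const_nhds.add (hlim0.const_mul c₁)).const_mul _
  have := le_of_tendsto_of_tendsto' hlimit hlimit2 (hab t ht)
  simpa using this

end IsEvolution

/-! ### Removing the mollification from the pressure estimate. -/

section Approximation

lemma kconv_scaledKernel (ρ : R3 → ℝ) {δ : ℝ} (hδ : 0 < δ) (g : R3 → ℝ) (x : R3) :
    kconv (scaledKernel ρ δ) g x = ∫ z, ρ z * g (x - δ • z) := by
  rw [kconv_eq_swap]
  have h : ∀ z, scaledKernel ρ δ z • g (x - z)
      = (δ ^ 3)⁻¹ * (fun w => ρ w * g (x - δ • w)) (δ⁻¹ • z) := by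
    intro z
    simp only [scaledKernel, smul_eq_mul, smul_inv_smul₀ hδ.ne']
    ring
  simp only [h]
  rw [integral_const_mul, Measure.integral_comp_inv_smul_of_nonneg volume
    (fun w => ρ w * g (x - δ • w)) hδ.le]
  simp
  field_simp

lemma integral_mul_kconv {k q g : R3 → ℝ} (hk : IsMollifier k) (hq : Continuous q)
    (hg : Continuous g) (hgc : HasCompactSupport g) :
    ∫ x, q x * kconv k g x = ∫ x, g x * kconv k q x := by
  have h := integral_inner_kconv hk.continuous hk.compactSupport hq.locallyIntegrable hg hgc
  have h1 : ∀ y, ∫ x, k (x - y) • g x = kconv k g y := by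
    intro y
    refine integral_congr_ae (Eventually.of_forall fun x => ?_)
    simp only
    rw [← hk.even, neg_sub]
  simp only [h1] at h
  simpa [mul_comm] using h.symm

/-- No growth bound on `q` is needed: by evenness the mollifier is moved onto `q`, the integral runs
over the support of `g`, and it depends continuously on the scale down to zero. -/
lemma tendsto_integral_mul_kconv {ρ q g : R3 → ℝ} (hρ : IsMollifier ρ) (hq : Continuous q)
    (hg : Continuous g) (hgc : HasCompactSupport g) :
    Tendsto (fun n : ℕ => ∫ x, q x * kconv (scaledKernel ρ (1 / ((n : ℝ) + 1))) g x) atTop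
      (𝓝 (∫ x, q x * g x)) := by
  have h1 : Continuous fun y : ℝ × R3 => ∫ z, ρ z * q (y.2 - y.1 • z) := by
    rw [← continuousOn_univ]
    refine continuousOn_integral_of_compact_support
      (f := fun (y : ℝ × R3) z => ρ z * q (y.2 - y.1 • z)) hρ.compactSupport ?_ ?_
    · have := hρ.continuous
      exact Continuous.continuousOn (by simp only [Function.uncurry_def]; fun_prop)
    · intro y z _ hz; simp [image_eq_zero_of_notMem_tsupport hz]
  have h2 : Continuous fun δ : ℝ => ∫ x, g x * ∫ z, ρ z * q (x - δ • z) := by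
    rw [← continuousOn_univ]
    refine continuousOn_integral_of_compact_support
      (f := fun (δ : ℝ) x => g x * ∫ z, ρ z * q (x - δ • z)) hgc ?_ ?_
    · exact Continuous.continuousOn ((hg.comp continuous_snd).mul h1)
    · intro δ x _ hx; simp [image_eq_zero_of_notMem_tsupport hx]
  have h3 := (h2.tendsto 0).comp tendsto_one_div_add_atTop_nhds_zero_nat
  have h4 : ∫ x, g x * ∫ z, ρ z * q (x - (0 : ℝ) • z) = ∫ x, q x * g x := by
    simp only [zero_smul, sub_zero, integral_mul_const, hρ.integral_eq_one, one_mul]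
    simp only [mul_comm]
  rw [h4] at h3
  refine h3.congr fun n => ?_
  have hδ : 0 < 1 / ((n : ℝ) + 1) := Nat.one_div_pos_of_nat
  rw [integral_mul_kconv (isMollifier_scaledKernel hρ hδ) hq hg hgc]
  simp only [kconv_scaledKernel ρ hδ]
  rfl

lemma vecDiv_kconv {k : R3 → ℝ} (hk : IsMollifier k) {f : R3 → R3} (hf : ContDiff ℝ 1 f) :
    vecDiv (kconv k f) = kconv k (vecDiv f) := by
  ext x
  have h : ∀ j, pd j (kconv k f) x j = ∫ y, k (x - y) * pd j f y j := by
    intro j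
    have hi := integrable_kconv hk.continuous hk.compactSupport
      (continuous_pd hf j).locallyIntegrable x
    have := (coordL j).integral_comp_comm hi
    rw [pd_kconv hk.contDiff_one hk.compactSupport hf.continuous.locallyIntegrable,
      ← kconv_pd_right hk.contDiff_one hk.compactSupport hf]
    simpa [kconv] using this.symm
  rw [vecDiv_eq_sum_pd]
  simp only [h]
  rw [← integral_finsetSum]
  · simp only [← Finset.mul_sum]; rfl
  · intro j _
    exact integrable_kconv hk.continuous hk.compactSupport
      ((coordL j).continuous.comp (continuous_pd hf j)).locallyIntegrable x

/-- By incompressibility ∇ζ · u = div (ζu). Apply the mollified estimate to ζu, with `k` shrunk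
further as mollifier, and pass to the limit. -/
lemma IsEvolution.abs_integral_pressure_le {ν MA τ M : ℝ} {A : ℝ → R3 → ℝ} {k : R3 → ℝ}
    {u : ℝ → R3 → R3} {p : ℝ → R3 → ℝ} (H : IsEvolution ν MA τ M A k u p) {ζ : R3 → ℝ}
    (hζ : ContDiff ℝ 1 ζ) (hc : HasCompactSupport ζ) {L : ℝ} (hb : ∀ x, ‖fderiv ℝ ζ x‖ ≤ L) {t : ℝ}
    (ht : t ∈ Ioo 0 τ) :
    |∫ x, p t x * fderiv ℝ ζ x (u t x)| ≤ fluxNorm k (A t) (u t) * (L * l2 (u t)) := by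
  have S := H.slice t ht
  have hL : 0 ≤ L := (norm_nonneg _).trans (hb 0)
  have hf : ContDiff ℝ 1 fun x => ζ x • u t x := hζ.smul S.v_one
  have hfc : HasCompactSupport fun x => ζ x • u t x := hc.smul_right
  have hdiv : vecDiv (fun x => ζ x • u t x) = fun x => fderiv ℝ ζ x (u t x) :=
    funext (S.vecDiv_smul_v hζ)
  have hgc := continuous_vecDiv hf
  have hgs := hasCompactSupport_vecDiv hfc
  have hgl : l2 (vecDiv fun x => ζ x • u t x) ≤ L * l2 (u t) := by
    rw [hdiv]
    refine l2_le_of_norm_le hL S.v_memLp (Eventually.of_forall fun x => ?_)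
    exact ((fderiv ℝ ζ x).le_opNorm _).trans (by gcongr; exact hb x)
  have hlim := tendsto_integral_mul_kconv S.kernel S.q_smooth.continuous hgc hgs
  simp only [← S.vecDiv_smul_v hζ]
  refine le_of_tendsto hlim.abs (Eventually.of_forall fun n => ?_)
  have hk := isMollifier_scaledKernel S.kernel (ε := 1 / ((n : ℝ) + 1)) Nat.one_div_pos_of_nat
  rw [← vecDiv_kconv hk hf]
  refine (H.abs_integral_pressure_vecDiv_kconv_le hk.smooth hk.compactSupport hf.continuous hfc
    ht).trans (mul_le_mul_of_nonneg_left ?_ (fluxNorm_nonneg _ _ _))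
  rw [vecDiv_kconv hk hf]
  have := (memLp_kconv hk.continuous hk.compactSupport (memLp_of_compactSupport hgc hgs)).2
  rw [hk.integral_abs, one_mul] at this
  exact this.trans hgl

end Approximation

/-! ### A Sobolev inequality in L⁴. -/

section Sobolev

lemma norm_fderiv_le_sum (f : R3 → R3) (x : R3) : ‖fderiv ℝ f x‖ ≤ ∑ j, ‖pd j f x‖ := by
  refine ContinuousLinearMap.opNorm_le_bound _ (Finset.sum_nonneg fun j _ => norm_nonneg _)
    fun v => ?_
  rw [fderiv_apply_eq_sum_pd, Finset.sum_mul]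
  refine (norm_sum_le _ _).trans (Finset.sum_le_sum fun j _ => ?_)
  rw [norm_smul, mul_comm]
  gcongr
  exact PiLp.norm_apply_le v j

lemma memLp_norm_sq {v : R3 → R3} (hv : MemLp v 2 volume) {M : ℝ} (hM : ∀ x, ‖v x‖ ≤ M) :
    MemLp (fun x => ‖v x‖ ^ 2) 2 volume := by
  refine hv.of_le_mul (c := M) (hv.1.norm.pow 2) (Eventually.of_forall fun x => ?_)
  rw [norm_pow, norm_norm, pow_two]
  gcongr
  exact hM x

/-- The Sobolev inequality for compactly supported fields, in the form of a bound in `L⁴`. -/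
lemma exists_l4_le_of_compactSupport : ∃ K : ℝ, 0 ≤ K ∧ ∀ f : R3 → R3, ContDiff ℝ 1 f →
    HasCompactSupport f → ∫ x, ‖f x‖ ^ 4 ≤ l2 f * (K * ∑ j, l2 (pd j f)) ^ 3 := by
  set C := SNormLESNormFDerivOfEqConst R3 (volume : Measure R3) 2
  refine ⟨C, C.2, fun f hf hc => ?_⟩
  have hgns := eLpNorm_le_eLpNorm_fderiv_of_eq (volume : Measure R3) hf hc (p := 2) (p' := 6)
    (by norm_num) (by simp) (by simp; norm_num)
  have hfL := memLp_of_compactSupport hf.continuous hc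
  have hpL : ∀ j, MemLp (pd j f) 2 volume := fun j =>
    memLp_of_compactSupport (continuous_pd hf j) (hasCompactSupport_pd hc j)
  have hsL : MemLp (fun x => ∑ j, ‖pd j f x‖) 2 volume := memLp_finsetSum _ fun j _ => (hpL j).norm
  have h3c : Continuous fun x => ‖f x‖ ^ 3 := hf.continuous.norm.pow 3
  have h3L : MemLp (fun x => ‖f x‖ ^ 3) 2 volume := memLp_of_compactSupport h3c
    (hc.norm.comp_left (g := fun t : ℝ => t ^ 3) (by simp))
  have e6 : l2 (fun x => ‖f x‖ ^ 3) = (eLpNorm f 6 volume).toReal ^ 3 := by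
    have := eLpNorm_norm_rpow (μ := (volume : Measure R3)) (p := 2) f (q := 3) (by norm_num)
    rw [l2]
    have e : (fun x => ‖f x‖ ^ 3) = fun x => ‖f x‖ ^ (3 : ℝ) := by
      ext x; norm_cast
    have e2 : (2 : ENNReal) * ENNReal.ofReal 3 = 6 := by norm_num
    rw [e, this, e2, ← ENNReal.toReal_rpow]
    norm_cast
  have hd : (eLpNorm (fderiv ℝ f) 2 volume).toReal ≤ ∑ j, l2 (pd j f) := by
    refine (ENNReal.toReal_mono hsL.2.ne (eLpNorm_mono_ae_real (Eventually.of_forall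
      (norm_fderiv_le_sum f)))).trans ((l2_sum_le Finset.univ fun j _ => (hpL j).norm).trans
      (le_of_eq ?_))
    exact Finset.sum_congr rfl fun j _ => l2_norm _
  have hfd : eLpNorm (fderiv ℝ f) 2 volume ≠ ⊤ :=
    ((eLpNorm_mono_ae_real (Eventually.of_forall (norm_fderiv_le_sum f))).trans_lt hsL.2).ne
  have h6 : (eLpNorm f 6 volume).toReal ≤ C * ∑ j, l2 (pd j f) := by
    have h := ENNReal.toReal_mono (ENNReal.mul_ne_top ENNReal.coe_ne_top hfd) hgns
    rw [ENNReal.toReal_mul, ENNReal.coe_toReal] at h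
    exact h.trans (mul_le_mul_of_nonneg_left hd C.2)
  -- Interpolation: the integral of |f|⁴ = |f| · |f|³ is at most ‖f‖₂ ‖f‖₆³, and the exponent 6 is
  -- the Sobolev conjugate of 2 in dimension three.
  have hcs := integral_norm_mul_norm_le hfL h3L
  have e4 : ∀ x, ‖f x‖ * ‖‖f x‖ ^ 3‖ = ‖f x‖ ^ 4 := by
    intro x; rw [norm_pow, norm_norm]; ring
  simp only [e4, e6] at hcs
  refine hcs.trans ?_
  gcongr
  exact l2_nonneg _

lemma l2_pd_cutoff_smul_le {C : ℝ} (hC : 0 ≤ C)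
    (hcut : ∀ R : ℝ, 1 ≤ R → ∀ x : R3, ‖fderiv ℝ (cutoff R) x‖ ≤ C / R) {R : ℝ} (hR : 1 ≤ R)
    {v : R3 → R3} (hv : ContDiff ℝ 1 v) (hvL : MemLp v 2 volume) (j : Fin 3)
    (hpL : MemLp (pd j v) 2 volume) :
    l2 (pd j fun x => cutoff R x • v x) ≤ l2 (pd j v) + C * l2 v := by
  have hη : ContDiff ℝ 1 (cutoff R) := contDiff_cutoff _ (n := 1)
  have hCv : MemLp (fun x => C • ‖v x‖) 2 volume := hvL.norm.const_smul C
  have : l2 (pd j fun x => cutoff R x • v x) ≤ l2 (fun x => ‖pd j v x‖ + C • ‖v x‖) := by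
    refine l2_mono (hpL.norm.add hCv) (Eventually.of_forall fun x => ?_)
    rw [pd_smul (hη.differentiable (by norm_num) x) (hv.differentiable (by norm_num) x),
      Real.norm_of_nonneg (add_nonneg (norm_nonneg _) (smul_nonneg hC (norm_nonneg _)))]
    refine (norm_add_le _ _).trans (add_le_add ?_ ?_)
    · rw [norm_smul, Real.norm_of_nonneg (cutoff_nonneg _ _)]
      exact mul_le_of_le_one_left (norm_nonneg _) (cutoff_le_one _ _)
    · rw [norm_smul, smul_eq_mul]
      refine mul_le_mul_of_nonneg_right ?_ (norm_nonneg _)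
      exact (norm_pd_le j _ x).trans ((hcut _ hR x).trans (div_le_self hC hR))
  refine this.trans ((l2_add_le hpL.norm hCv).trans (le_of_eq ?_))
  rw [l2_norm, l2_const_mul, l2_norm, abs_of_nonneg hC]

lemma tendsto_integral_cutoff_pow_four {v : R3 → R3} (hv : Continuous v)
    (hvL : MemLp v 2 volume) {M : ℝ} (hM : ∀ x, ‖v x‖ ≤ M) :
    Tendsto (fun n : ℕ => ∫ x, ‖cutoff (n + 1) x • v x‖ ^ 4) atTop (𝓝 (∫ x, ‖v x‖ ^ 4)) := by
  have hint : Integrable fun x => M ^ 2 * ‖v x‖ ^ 2 := (integrable_norm_sq hvL).const_mul _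
  refine tendsto_integral_of_dominated_convergence _ (fun n => ?_) hint
    (fun n => Eventually.of_forall fun x => ?_) (Eventually.of_forall fun x => ?_)
  · exact (((contDiff_cutoff _ (n := 0)).continuous.smul hv).norm.pow 4).aestronglyMeasurable
  · rw [norm_pow, norm_norm, norm_smul, Real.norm_of_nonneg (cutoff_nonneg _ _)]
    have h1 : cutoff (n + 1) x * ‖v x‖ ≤ ‖v x‖ :=
      mul_le_of_le_one_left (norm_nonneg _) (cutoff_le_one _ _)
    have h2 := pow_le_pow_left₀ (mul_nonneg (cutoff_nonneg _ _) (norm_nonneg _)) h1 4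
    refine h2.trans ?_
    have h3 := pow_le_pow_left₀ (norm_nonneg _) (hM x) 2
    calc ‖v x‖ ^ 4 = ‖v x‖ ^ 2 * ‖v x‖ ^ 2 := by ring
      _ ≤ _ := mul_le_mul_of_nonneg_right h3 (sq_nonneg _)
  · have := (((tendsto_cutoff x).smul_const (v x)).norm.pow 4)
    rwa [one_smul] at this

/-- The Sobolev inequality in `L⁴` for bounded fields with square integrable gradient. -/
lemma exists_sobolev : ∃ K : ℝ, 0 ≤ K ∧ ∀ (v : R3 → R3) (M : ℝ), ContDiff ℝ 1 v →
    MemLp v 2 volume → (∀ j, MemLp (pd j v) 2 volume) → (∀ x, ‖v x‖ ≤ M) →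
    l2 (fun x => ‖v x‖ ^ 2) ≤ K * (l2 v + ∑ j, l2 (pd j v)) ^ 2 := by
  obtain ⟨K, hK, hS⟩ := exists_l4_le_of_compactSupport
  obtain ⟨C, hC, hcut⟩ := exists_cutoff_bound
  have hKC : 0 ≤ (K * (1 + 3 * C)) ^ 3 := by positivity
  -- Cutting off adds C ‖v‖₂ to each of the three derivatives, whence 1 + 3C; the root appears
  -- because the L⁴ estimate bounds the square of the left side. The bound `M` only justifies
  -- integrability and the limit.
  refine ⟨Real.sqrt ((K * (1 + 3 * C)) ^ 3), Real.sqrt_nonneg _, fun v M hv hvL hpL hM => ?_⟩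
  have hn : ∀ n : ℕ, ∫ x, ‖cutoff (n + 1) x • v x‖ ^ 4
      ≤ l2 v * (K * (∑ j, l2 (pd j v) + 3 * C * l2 v)) ^ 3 := by
    intro n
    have hn1 : (1 : ℝ) ≤ n + 1 := by simp
    have h0 := hS (fun x => cutoff (n + 1) x • v x) ((contDiff_cutoff _ (n := 1)).smul hv)
      (hasCompactSupport_cutoff (by positivity)).smul_right
    refine h0.trans ?_
    have h1 : l2 (fun x => cutoff (n + 1) x • v x) ≤ l2 v := by
      refine l2_mono hvL (Eventually.of_forall fun x => ?_)
      rw [norm_smul, Real.norm_of_nonneg (cutoff_nonneg _ _)]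
      exact mul_le_of_le_one_left (norm_nonneg _) (cutoff_le_one _ _)
    have h3 : ∑ j, l2 (pd j fun x => cutoff (n + 1) x • v x)
        ≤ ∑ j, l2 (pd j v) + 3 * C * l2 v := by
      refine (Finset.sum_le_sum fun j _ => l2_pd_cutoff_smul_le hC
        (fun R hR x => (hcut R hR x).1) hn1 hv hvL j (hpL j)).trans (le_of_eq ?_)
      rw [Finset.sum_add_distrib, Finset.sum_const, Finset.card_univ, Fintype.card_fin,
        nsmul_eq_mul, mul_assoc]
      norm_num
    have h4 : 0 ≤ ∑ j, l2 (pd j fun x => cutoff (n + 1) x • v x) :=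
      Finset.sum_nonneg fun j _ => l2_nonneg _
    exact mul_le_mul h1 (pow_le_pow_left₀ (mul_nonneg hK h4)
      (mul_le_mul_of_nonneg_left h3 hK) 3) (pow_nonneg (mul_nonneg hK h4) 3) (l2_nonneg _)
  have h4 := le_of_tendsto' (tendsto_integral_cutoff_pow_four hv.continuous hvL hM) hn
  refine l2_le_of_sq_le (memLp_norm_sq hvL hM)
    (mul_nonneg (Real.sqrt_nonneg _) (sq_nonneg _)) ?_
  have e : ∀ x, ‖‖v x‖ ^ 2‖ ^ 2 = ‖v x‖ ^ 4 := by
    intro x; rw [norm_pow, norm_norm]; ring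
  simp only [e]
  refine h4.trans ?_
  rw [mul_pow (Real.sqrt _), Real.sq_sqrt hKC]
  have hN0 : 0 ≤ l2 v := l2_nonneg _
  have hG0 : 0 ≤ ∑ j, l2 (pd j v) := Finset.sum_nonneg fun j _ => l2_nonneg _
  generalize l2 v = N at *
  generalize ∑ j, l2 (pd j v) = G at *
  have a1 : G + 3 * C * N ≤ (1 + 3 * C) * (N + G) := by nlinarith [mul_nonneg hC hG0]
  have a2 : 0 ≤ G + 3 * C * N := by positivity
  calc N * (K * (G + 3 * C * N)) ^ 3 ≤ (N + G) * (K * ((1 + 3 * C) * (N + G))) ^ 3 :=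
        mul_le_mul (by linarith) (pow_le_pow_left₀ (mul_nonneg hK a2)
          (mul_le_mul_of_nonneg_left a1 hK) 3) (pow_nonneg (mul_nonneg hK a2) 3) (by linarith)
    _ = _ := by ring

end Sobolev

/-! ### Bounds on the error terms that are uniform in the scale of the kernel. -/

namespace IsSlice

variable {ν MA : ℝ} {a k : R3 → ℝ} {v dv : R3 → R3} {q : R3 → ℝ} (S : IsSlice ν MA a k v dv q)
include S

/-- Jensen: |k ⋆ v|² ≤ k ⋆ |v|², and convolution with `k` does not increase the L² norm. -/
lemma l2_norm_w_sq_le {M : ℝ} (hM : ∀ x, ‖v x‖ ≤ M) :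
    MemLp (fun x => ‖kconv k v x‖ ^ 2) 2 volume ∧
      l2 (fun x => ‖kconv k v x‖ ^ 2) ≤ l2 (fun x => ‖v x‖ ^ 2) := by
  have hL := memLp_norm_sq S.v_memLp hM
  have h := memLp_of_le_kconv S.kernel.continuous S.kernel.compactSupport S.kernel.nonneg hL
    (h := fun x => ‖kconv k v x‖ ^ 2) (S.w_smooth.continuous.norm.pow 2).aestronglyMeasurable
    (fun x => ?_)
  · rwa [S.kernel.integral_eq_one, one_mul] at h
  · have h1 := norm_kconv_le k v x
    simp only [abs_of_nonneg (S.kernel.nonneg _)] at h1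
    have h2 := sq_kconv_norm_le S.kernel.continuous S.kernel.compactSupport S.kernel.nonneg
      S.v_memLp x
    rw [S.kernel.integral_eq_one, one_mul] at h2
    rw [norm_pow, norm_norm]
    refine (pow_le_pow_left₀ (norm_nonneg _) h1 2).trans (h2.trans (le_of_eq ?_))
    simp only [norm_pow, norm_norm]

/-- Unlike the bound in `IsEvolution.flux_memLp`, neither the kernel nor `M` enters the right side;
the price is square integrability of the gradient. The 3 counts the columns. -/
lemma fluxNorm_le {M : ℝ} (hM : ∀ x, ‖v x‖ ≤ M) (hp : ∀ j, MemLp (pd j v) 2 volume) :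
    fluxNorm k a v ≤ 3 * l2 (fun x => ‖v x‖ ^ 2) + MA * ∑ j, l2 (pd j v) := by
  have hM0 : 0 ≤ M := (norm_nonneg _).trans (hM 0)
  have hvL := memLp_norm_sq S.v_memLp hM
  obtain ⟨hwL, hwl⟩ := S.l2_norm_w_sq_le hM
  have hj : ∀ j, l2 (flux k a v j) ≤ l2 (fun x => ‖v x‖ ^ 2) + MA * l2 (pd j v) := by
    intro j
    have hb : ∀ x, ‖kconv k v x j • v x‖ ≤ ‖kconv k v x‖ * ‖v x‖ := by
      intro x
      rw [norm_smul]
      exact mul_le_mul_of_nonneg_right (PiLp.norm_apply_le (kconv k v x) j) (norm_nonneg (v x))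
    have h1 : MemLp (fun x => kconv k v x j • v x) 2 volume :=
      S.v_memLp.of_le_mul (c := M) ((S.coord_w_smooth j).continuous.smul
        S.v_one.continuous).aestronglyMeasurable (Eventually.of_forall fun x =>
          (hb x).trans (by gcongr; exact S.norm_w_le hM x))
    refine (l2_sub_le h1 (S.stress_memLp j)).trans (add_le_add ?_ ?_)
    · refine l2_le_of_sq_le h1 (l2_nonneg _) ?_
      calc ∫ x, ‖kconv k v x j • v x‖ ^ 2
          ≤ ∫ x, ‖‖kconv k v x‖ ^ 2‖ * ‖‖v x‖ ^ 2‖ := by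
            refine integral_mono (integrable_norm_sq h1) (integrable_norm_mul_norm hwL hvL)
              fun x => ?_
            simp only [norm_pow, norm_norm, ← mul_pow]
            exact pow_le_pow_left₀ (norm_nonneg _) (hb x) 2
        _ ≤ l2 (fun x => ‖kconv k v x‖ ^ 2) * l2 (fun x => ‖v x‖ ^ 2) :=
            integral_norm_mul_norm_le hwL hvL
        _ ≤ _ := by
            rw [pow_two (l2 fun x => ‖v x‖ ^ 2)]
            gcongr
            exact l2_nonneg _
    · exact (S.l2_stress_le j).trans (mul_le_mul_of_nonneg_left (S.l2_pd_w_le' j (hp j))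
        S.MA_nonneg)
  refine (Finset.sum_le_sum fun j _ => hj j).trans (le_of_eq ?_)
  rw [Finset.sum_add_distrib, Finset.mul_sum]
  simp

lemma abs_transport_le {ζ : R3 → ℝ} {L : ℝ}
    (hb : ∀ x, ‖fderiv ℝ ζ x‖ ≤ L) {M : ℝ} (hM : ∀ x, ‖v x‖ ≤ M) :
    |∫ x, fderiv ℝ ζ x (kconv k v x) * ‖v x‖ ^ 2| ≤ L * (l2 v * l2 (fun x => ‖v x‖ ^ 2)) := by
  have hL : 0 ≤ L := (norm_nonneg _).trans (hb 0)
  have hvL := memLp_norm_sq S.v_memLp hM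
  rw [← Real.norm_eq_abs]
  refine (norm_integral_le_of_norm_le ((integrable_norm_mul_norm S.w_memLp hvL).const_mul L)
    (Eventually.of_forall fun x => ?_)).trans ?_
  · rw [norm_mul, ← mul_assoc]
    refine mul_le_mul_of_nonneg_right ?_ (norm_nonneg _)
    exact ((fderiv ℝ ζ x).le_opNorm _).trans (mul_le_mul_of_nonneg_right (hb x) (norm_nonneg _))
  · rw [integral_const_mul]
    refine mul_le_mul_of_nonneg_left ((integral_norm_mul_norm_le S.w_memLp hvL).trans ?_) hL
    exact mul_le_mul_of_nonneg_right S.l2_w_le (l2_nonneg _)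

lemma abs_grad_energy_le {ζ : R3 → ℝ} {L : ℝ} (hb : ∀ x, ‖fderiv ℝ ζ x‖ ≤ L)
    (hp : ∀ j, MemLp (pd j v) 2 volume) :
    |∫ x, ∑ j, pd j ζ x * inner ℝ (v x) (pd j v x)| ≤ L * (l2 v * ∑ j, l2 (pd j v)) := by
  have hL : 0 ≤ L := (norm_nonneg _).trans (hb 0)
  have hi : Integrable fun x => ∑ j, ‖v x‖ * ‖pd j v x‖ :=
    integrable_finsetSum _ fun j _ => integrable_norm_mul_norm S.v_memLp (hp j)
  rw [← Real.norm_eq_abs]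
  refine (norm_integral_le_of_norm_le (hi.const_mul L) (Eventually.of_forall fun x => ?_)).trans ?_
  · rw [Finset.mul_sum]
    refine (norm_sum_le _ _).trans (Finset.sum_le_sum fun j _ => ?_)
    rw [norm_mul]
    exact mul_le_mul ((norm_pd_le j ζ x).trans (hb x)) (norm_inner_le_norm _ _) (norm_nonneg _) hL
  · rw [integral_const_mul, integral_finsetSum _ fun j _ =>
      integrable_norm_mul_norm S.v_memLp (hp j)]
    refine mul_le_mul_of_nonneg_left ?_ hL
    rw [Finset.mul_sum]
    exact Finset.sum_le_sum fun j _ => integral_norm_mul_norm_le S.v_memLp (hp j)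

end IsSlice

/-! ### Truncated and full dissipation. -/

/-- The truncated dissipation of a field. -/
def dissip (R : ℝ) (v : R3 → R3) : ℝ := ∫ x, cutoff R x * ∑ j, ‖pd j v x‖ ^ 2

/-- The square of the `L²` norm of the gradient of a field. -/
def gradEnergy (v : R3 → R3) : ENNReal := ∫⁻ x, ENNReal.ofReal (∑ j, ‖pd j v x‖ ^ 2)

lemma sum_sq_pd_nonneg (v : R3 → R3) (x : R3) : 0 ≤ ∑ j, ‖pd j v x‖ ^ 2 :=
  Finset.sum_nonneg fun _ _ => sq_nonneg _

lemma continuous_sum_sq_pd {v : R3 → R3} (hv : ContDiff ℝ 1 v) :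
    Continuous fun x => ∑ j, ‖pd j v x‖ ^ 2 :=
  continuous_finsetSum _ fun j _ => (continuous_pd hv j).norm.pow 2

lemma memLp_pd_of_gradEnergy_ne_top {v : R3 → R3} (hv : ContDiff ℝ 1 v) (h : gradEnergy v ≠ ⊤) :
    (∀ j, MemLp (pd j v) 2 volume) ∧ ∑ j, l2 (pd j v) ^ 2 = (gradEnergy v).toReal := by
  have hi : Integrable fun x => ∑ j, ‖pd j v x‖ ^ 2 :=
    (lintegral_ofReal_ne_top_iff_integrable (continuous_sum_sq_pd hv).aestronglyMeasurable
      (Eventually.of_forall (sum_sq_pd_nonneg v))).1 h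
  have hj : ∀ j, MemLp (pd j v) 2 volume := by
    intro j
    rw [memLp_two_iff_integrable_sq_norm (continuous_pd hv j).aestronglyMeasurable]
    refine hi.mono' ((continuous_pd hv j).norm.pow 2).aestronglyMeasurable
      (Eventually.of_forall fun x => ?_)
    rw [norm_pow, norm_norm]
    exact Finset.single_le_sum (f := fun j => ‖pd j v x‖ ^ 2) (fun i _ => sq_nonneg _)
      (Finset.mem_univ j)
  refine ⟨hj, ?_⟩
  rw [gradEnergy, ← integral_eq_lintegral_of_nonneg_ae (Eventually.of_forall (sum_sq_pd_nonneg v))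
    (continuous_sum_sq_pd hv).aestronglyMeasurable,
    integral_finsetSum _ fun j _ => integrable_norm_sq (hj j)]
  exact Finset.sum_congr rfl fun j _ => l2_sq (hj j)

/-- Fatou's lemma in space, valid also when the dissipation is infinite. -/
lemma gradEnergy_le_liminf {v : R3 → R3} (hv : ContDiff ℝ 1 v) :
    gradEnergy v ≤ liminf (fun n : ℕ => ENNReal.ofReal (dissip (n + 1) v)) atTop := by
  have hc : ∀ n : ℕ, Continuous fun x => cutoff (n + 1) x * ∑ j, ‖pd j v x‖ ^ 2 := fun n =>
    (contDiff_cutoff _ (n := 0)).continuous.mul (continuous_sum_sq_pd hv)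
  have h1 : ∀ n : ℕ, ENNReal.ofReal (dissip (n + 1) v)
      = ∫⁻ x, ENNReal.ofReal (cutoff (n + 1) x * ∑ j, ‖pd j v x‖ ^ 2) := by
    intro n
    refine ofReal_integral_eq_lintegral_ofReal (integrable_of_compactSupport (hc n)
      (hasCompactSupport_cutoff (by positivity)).mul_right) (Eventually.of_forall fun x => ?_)
    exact mul_nonneg (cutoff_nonneg _ _) (sum_sq_pd_nonneg v x)
  simp only [h1]
  refine le_trans (le_of_eq ?_) (lintegral_liminf_le fun n => (hc n).measurable.ennreal_ofReal)
  refine lintegral_congr fun x => ?_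
  have := (ENNReal.continuous_ofReal.tendsto _).comp
    ((tendsto_cutoff x).mul_const (∑ j, ‖pd j v x‖ ^ 2))
  rw [one_mul] at this
  exact this.liminf_eq.symm

lemma tendsto_integral_cutoff_mul {g : R3 → ℝ} (hg : Integrable g) :
    Tendsto (fun n : ℕ => ∫ x, cutoff (n + 1) x * g x) atTop (𝓝 (∫ x, g x)) := by
  refine tendsto_integral_of_dominated_convergence (fun x => ‖g x‖) (fun n => ?_) hg.norm
    (fun n => Eventually.of_forall fun x => ?_) (Eventually.of_forall fun x => ?_)
  · exact (contDiff_cutoff _ (n := 0)).continuous.aestronglyMeasurable.mul hg.1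
  · rw [norm_mul, Real.norm_of_nonneg (cutoff_nonneg _ _)]
    exact mul_le_of_le_one_left (norm_nonneg _) (cutoff_le_one _ _)
  · simpa using (tendsto_cutoff x).mul_const (g x)

/-! ### The global energy inequality. -/

namespace IsEvolution

variable {ν MA τ M : ℝ} {A : ℝ → R3 → ℝ} {k : R3 → ℝ} {u : ℝ → R3 → R3} {p : ℝ → R3 → ℝ}
  (H : IsEvolution ν MA τ M A k u p)
include H

/-- Every error term carries a derivative of the cutoff. `B` may depend on the solution and on the
kernel, since only the decay in R is used. -/
lemma exists_energy_rate_le (hν : 0 ≤ ν) : ∃ B : ℝ, 0 ≤ B ∧ ∀ R : ℝ, 1 ≤ R → ∀ t ∈ Ioo 0 τ,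
    (∫ x, (inner ℝ (cutoff R x • u t x) (deriv (fun s => u s x) t) : ℝ)) + ν * dissip R (u t)
      ≤ B / R := by
  rcases (Ioo 0 τ).eq_empty_or_nonempty with he | ⟨t₀, ht₀⟩
  · exact ⟨0, le_rfl, fun R _ t ht => by rw [he] at ht; exact absurd ht (notMem_empty t)⟩
  have hM0 := H.M_nonneg ht₀
  have hMA0 := (H.slice t₀ ht₀).MA_nonneg
  obtain ⟨C, hC, hcut⟩ := exists_cutoff_bound
  obtain ⟨B, hB0, hB⟩ := H.exists_fluxNorm_le
  set g := ∑ j, gradMoment k j * ∫ z, |pd j k z| with hg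
  have hg0 : 0 ≤ g := Finset.sum_nonneg fun j _ => mul_nonneg (gradMoment_nonneg k j)
    (integral_nonneg fun z => abs_nonneg _)
  refine ⟨ν * (1 / 2 * (C * M ^ 2)) + 1 / 2 * (C * (M * (M * M))) + B * (C * M)
    + MA * C * M * (g * M), by positivity, fun R hR t ht => ?_⟩
  have S := H.slice t ht
  have hR0 : 0 < R := by linarith
  have hL : 0 ≤ C / R := by positivity
  have huM := H.l2_le t ht
  have hu0 := l2_nonneg (u t)
  have hs : HasCompactSupport (cutoff R) := hasCompactSupport_cutoff hR0
  have h := S.local_energy (contDiff_cutoff R (n := 1)) hs (cutoff_nonneg R)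
    fun x => (hcut R hR x).1
  -- The viscous error is rewritten with the Laplacian of the cutoff, so that only the L² norm of u
  -- is needed.
  rw [S.integral_grad_energy (contDiff_cutoff R (n := 2)) hs] at h
  have b1 : |∫ x, lap (cutoff R) x * ‖u t x‖ ^ 2| ≤ C / R * M ^ 2 := by
    rw [← Real.norm_eq_abs]
    refine (norm_integral_le_of_norm_le ((integrable_norm_sq S.v_memLp).const_mul (C / R))
      (Eventually.of_forall fun x => ?_)).trans ?_
    · rw [norm_mul, norm_pow, norm_norm]
      exact mul_le_mul_of_nonneg_right (hcut R hR x).2 (sq_nonneg _)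
    · rw [integral_const_mul, ← l2_sq S.v_memLp]
      exact mul_le_mul_of_nonneg_left (pow_le_pow_left₀ hu0 huM 2) hL
  have b2 : ∫ x, fderiv ℝ (cutoff R) x (kconv k (u t) x) * ‖u t x‖ ^ 2
      ≤ C / R * (M * (M * M)) := by
    refine (le_abs_self _).trans ((S.abs_transport_le (fun x => (hcut R hR x).1)
      (H.norm_le t ht)).trans (mul_le_mul_of_nonneg_left ?_ hL))
    refine mul_le_mul huM ?_ (l2_nonneg _) hM0
    refine (l2_le_of_norm_le hM0 S.v_memLp (Eventually.of_forall fun x => ?_)).trans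
      (mul_le_mul_of_nonneg_left huM hM0)
    rw [norm_pow, norm_norm, pow_two]
    exact mul_le_mul_of_nonneg_right (H.norm_le t ht x) (norm_nonneg _)
  have b3 : ∫ x, p t x * fderiv ℝ (cutoff R) x (u t x) ≤ B * (C / R * M) :=
    (le_abs_self _).trans ((H.abs_integral_pressure_le (contDiff_cutoff R (n := 1)) hs
      (fun x => (hcut R hR x).1) ht).trans (mul_le_mul (hB t ht)
        (mul_le_mul_of_nonneg_left huM hL) (mul_nonneg hL hu0) hB0))
  have b4 : MA * (C / R) * l2 (u t) * ∑ j, gradMoment k j * l2 (pd j (kconv k (u t)))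
      ≤ MA * (C / R) * M * (g * M) := by
    refine mul_le_mul (mul_le_mul_of_nonneg_left huM (by positivity)) ?_
      (Finset.sum_nonneg fun j _ => mul_nonneg (gradMoment_nonneg k j) (l2_nonneg _))
      (by positivity)
    rw [hg, Finset.sum_mul]
    refine Finset.sum_le_sum fun j _ => ?_
    rw [mul_assoc]
    refine mul_le_mul_of_nonneg_left ((S.l2_pd_w_le j).trans ?_) (gradMoment_nonneg k j)
    exact mul_le_mul_of_nonneg_left huM (integral_nonneg fun z => abs_nonneg _)
  have b1' := mul_le_mul_of_nonneg_left ((le_abs_self _).trans b1) hν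
  have e : (ν * (1 / 2 * (C * M ^ 2)) + 1 / 2 * (C * (M * (M * M))) + B * (C * M)
      + MA * C * M * (g * M)) / R = 1 / 2 * (ν * (C / R * M ^ 2))
        + 1 / 2 * (C / R * (M * (M * M))) + B * (C / R * M) + MA * (C / R) * M * (g * M) := by
    ring
  rw [e, dissip]
  linarith

lemma integral_energy_rate_eq {ζ : R3 → ℝ} (hζ : Continuous ζ) (hc : HasCompactSupport ζ)
    {s t : ℝ} (hs : 0 < s) (hst : s ≤ t) (ht : t < τ) :
    IntervalIntegrable
      (fun r => ∫ x, (inner ℝ (ζ x • u r x) (deriv (fun q => u q x) r) : ℝ)) volume s t ∧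
    ∫ r in s..t, (∫ x, (inner ℝ (ζ x • u r x) (deriv (fun q => u q x) r) : ℝ))
      = (∫ x, 1 / 2 * (ζ x * ‖u t x‖ ^ 2)) - ∫ x, 1 / 2 * (ζ x * ‖u s x‖ ^ 2) := by
  have hsub : uIcc s t ⊆ Ioo 0 τ := by
    rw [uIcc_of_le hst]; exact fun r hr => ⟨hs.trans_le hr.1, hr.2.trans_lt ht⟩
  have hi := ((H.continuousOn_integral_energy_rate hζ hc).mono hsub).intervalIntegrable
    (μ := volume)
  exact ⟨hi, intervalIntegral.integral_eq_sub_of_hasDerivAt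
    (fun r hr => H.hasDerivAt_energy hζ hc (hsub hr)) hi⟩

lemma continuousOn_dissip {R : ℝ} (hR : 0 < R) :
    ContinuousOn (fun t => dissip R (u t)) (Ioo 0 τ) := by
  refine continuousOn_integral_of_compact_support (hasCompactSupport_cutoff hR) ?_ ?_
  · refine ContinuousOn.mul ((contDiff_cutoff R (n := 0)).continuous.comp
      continuous_snd).continuousOn ?_
    refine continuousOn_finsetSum _ fun j _ => ?_
    exact (H.cont_grad.clm_apply continuousOn_const).norm.pow 2
  · intro t x _ hx
    simp [image_eq_zero_of_notMem_tsupport hx]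

lemma exists_energy_inequality (hν : 0 ≤ ν) : ∃ B : ℝ, 0 ≤ B ∧ ∀ R : ℝ, 1 ≤ R → ∀ s t : ℝ, 0 < s →
    s ≤ t → t < τ → 1 / 2 * (∫ x, cutoff R x * ‖u t x‖ ^ 2) + ν * (∫ r in s..t, dissip R (u r))
      ≤ 1 / 2 * l2 (u s) ^ 2 + B / R := by
  obtain ⟨B, hB0, hB⟩ := H.exists_energy_rate_le hν
  refine ⟨B * |τ|, by positivity, fun R hR s t hs hst ht => ?_⟩
  have hR0 : 0 < R := by linarith
  have hsub : Icc s t ⊆ Ioo 0 τ := fun r hr => ⟨hs.trans_le hr.1, hr.2.trans_lt ht⟩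
  obtain ⟨hi, he⟩ := H.integral_energy_rate_eq (contDiff_cutoff R (n := 0)).continuous
    (hasCompactSupport_cutoff hR0) hs hst ht
  have hd : IntervalIntegrable (fun r => dissip R (u r)) volume s t :=
    ((H.continuousOn_dissip hR0).mono (by rwa [uIcc_of_le hst])).intervalIntegrable
  have h1 := intervalIntegral.integral_mono_on hst (hi.add (hd.const_mul ν))
    (intervalIntegrable_const (μ := volume) (c := B / R)) fun r hr => hB R hR r (hsub hr)
  rw [intervalIntegral.integral_add hi (hd.const_mul ν), he, intervalIntegral.integral_const_mul,
    intervalIntegral.integral_const, integral_const_mul, integral_const_mul, smul_eq_mul] at h1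
  have hsτ : s ∈ Ioo 0 τ := hsub ⟨le_rfl, hst⟩
  have S := H.slice s hsτ
  have h2 : ∫ x, cutoff R x * ‖u s x‖ ^ 2 ≤ l2 (u s) ^ 2 := by
    rw [l2_sq S.v_memLp]
    refine integral_mono_of_nonneg (Eventually.of_forall fun x =>
      mul_nonneg (cutoff_nonneg _ _) (sq_nonneg _)) (integrable_norm_sq S.v_memLp)
      (Eventually.of_forall fun x => mul_le_of_le_one_left (sq_nonneg _) (cutoff_le_one _ _))
  have h3 : (t - s) * (B / R) ≤ B * |τ| / R := by
    rw [mul_comm, div_mul_eq_mul_div]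
    gcongr
    exact (by linarith : t - s ≤ τ).trans (le_abs_self τ)
  linarith

/-- Drop the dissipation in `exists_energy_inequality` and let R → ∞. -/
lemma l2_le_l2_of_le (hν : 0 ≤ ν) {s t : ℝ} (hs : 0 < s) (hst : s ≤ t) (ht : t < τ) :
    l2 (u t) ≤ l2 (u s) := by
  obtain ⟨B, hB0, hB⟩ := H.exists_energy_inequality hν
  have hu := (H.slice t ⟨hs.trans_le hst, ht⟩).v_memLp
  have hd : ∀ n : ℕ, 0 ≤ ∫ r in s..t, dissip (n + 1) (u r) := fun n =>
    intervalIntegral.integral_nonneg hst fun r _ => integral_nonneg fun x =>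
      mul_nonneg (cutoff_nonneg _ _) (sum_sq_pd_nonneg _ x)
  have h1 : ∀ n : ℕ, 1 / 2 * (∫ x, cutoff (n + 1) x * ‖u t x‖ ^ 2)
      ≤ 1 / 2 * l2 (u s) ^ 2 + B * (1 / ((n : ℝ) + 1)) := by
    intro n
    have := hB (n + 1) (by simp) s t hs hst ht
    rw [mul_one_div]
    linarith [mul_nonneg hν (hd n)]
  have h2 := le_of_tendsto_of_tendsto'
    ((tendsto_integral_cutoff_mul (integrable_norm_sq hu)).const_mul (1 / 2))
    ((tendsto_one_div_add_atTop_nhds_zero_nat.const_mul B).const_add (1 / 2 * l2 (u s) ^ 2)) h1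
  rw [← l2_sq hu] at h2
  exact (sq_le_sq₀ (l2_nonneg _) (l2_nonneg _)).1 (by linarith)

/-- Monotonicity holds between positive times only; L² convergence as s → 0⁺ extends it to the datum
and replaces `M` by a quantity independent of ε. -/
lemma l2_le_initial (hν : 0 ≤ ν) {w : R3 → R3} (hw : MemLp w 2 volume)
    (h0 : Tendsto (fun s => l2 (fun x => u s x - w x)) (𝓝[>] 0) (𝓝 0)) {t : ℝ}
    (ht : t ∈ Ioo 0 τ) : l2 (u t) ≤ l2 w := by
  have h1 : Tendsto (fun s => l2 w + l2 (fun x => u s x - w x)) (𝓝[>] 0) (𝓝 (l2 w + 0)) :=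
    h0.const_add _
  rw [add_zero] at h1
  refine ge_of_tendsto h1 ?_
  filter_upwards [Ioo_mem_nhdsGT ht.1] with s hs
  have hu := (H.slice s ⟨hs.1, hs.2.trans ht.2⟩).v_memLp
  have := (le_abs_self _).trans (abs_l2_sub_l2_le hu hw)
  linarith [H.l2_le_l2_of_le hν hs.1 hs.2.le ht.2]

/-- The dissipation is integrable in time, with a bound that depends only on the energy. -/
lemma lintegral_gradEnergy_le (hν : 0 < ν) {N : ℝ} (hN : ∀ t ∈ Ioo 0 τ, l2 (u t) ≤ N) {s t : ℝ}
    (hs : 0 < s) (hst : s ≤ t) (ht : t < τ) :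
    ∫⁻ r in Ioc s t, gradEnergy (u r) ≤ ENNReal.ofReal (N ^ 2 / (2 * ν)) := by
  obtain ⟨B, hB0, hB⟩ := H.exists_energy_inequality hν.le
  have hsub : Icc s t ⊆ Ioo 0 τ := fun r hr => ⟨hs.trans_le hr.1, hr.2.trans_lt ht⟩
  have hR : ∀ n : ℕ, (0 : ℝ) < n + 1 := fun n => by positivity
  have hc : ∀ n : ℕ, ContinuousOn (fun r => dissip (n + 1) (u r)) (Icc s t) := fun n =>
    (H.continuousOn_dissip (hR n)).mono hsub
  have hnn : ∀ (n : ℕ) r, 0 ≤ dissip (n + 1) (u r) := fun n r => integral_nonneg fun x =>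
    mul_nonneg (cutoff_nonneg _ _) (sum_sq_pd_nonneg _ x)
  have hn : ∀ n : ℕ, ∫⁻ r in Ioc s t, ENNReal.ofReal (dissip (n + 1) (u r))
      ≤ ENNReal.ofReal (N ^ 2 / (2 * ν) + B / ν * (1 / ((n : ℝ) + 1))) := by
    intro n
    rw [← ofReal_integral_eq_lintegral_ofReal
      ((hc n).integrableOn_Icc.mono_set Ioc_subset_Icc_self) (Eventually.of_forall (hnn n)),
      ← intervalIntegral.integral_of_le hst]
    refine ENNReal.ofReal_le_ofReal ?_
    have h1 := hB (n + 1) (by simp) s t hs hst ht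
    have h2 : 0 ≤ ∫ x, cutoff (n + 1) x * ‖u t x‖ ^ 2 := integral_nonneg fun x =>
      mul_nonneg (cutoff_nonneg _ _) (sq_nonneg _)
    have h3 : l2 (u s) ^ 2 ≤ N ^ 2 :=
      pow_le_pow_left₀ (l2_nonneg _) (hN s (hsub ⟨le_rfl, hst⟩)) 2
    rw [← mul_le_mul_iff_right₀ hν]
    have e : ν * (N ^ 2 / (2 * ν) + B / ν * (1 / ((n : ℝ) + 1)))
        = 1 / 2 * N ^ 2 + B / ((n : ℝ) + 1) := by
      have := hR n
      field_simp
    rw [e]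
    linarith
  have hlim : Tendsto (fun n : ℕ => ENNReal.ofReal (N ^ 2 / (2 * ν) + B / ν * (1 / ((n : ℝ) + 1))))
      atTop (𝓝 (ENNReal.ofReal (N ^ 2 / (2 * ν)))) := by
    refine (ENNReal.continuous_ofReal.tendsto _).comp ?_
    simpa using (tendsto_one_div_add_atTop_nhds_zero_nat.const_mul (B / ν)).const_add
      (N ^ 2 / (2 * ν))
  -- Fatou is applied in space, then in time. Only the truncated dissipations, which are continuous
  -- in time, have to be measurable.
  calc ∫⁻ r in Ioc s t, gradEnergy (u r)
      ≤ ∫⁻ r in Ioc s t, liminf (fun n : ℕ => ENNReal.ofReal (dissip (n + 1) (u r))) atTop :=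
        setLIntegral_mono_ae' measurableSet_Ioc (Eventually.of_forall fun r hr =>
          gradEnergy_le_liminf (H.slice r (hsub (Ioc_subset_Icc_self hr))).v_one)
    _ ≤ liminf (fun n : ℕ => ∫⁻ r in Ioc s t, ENNReal.ofReal (dissip (n + 1) (u r))) atTop :=
        lintegral_liminf_le' fun n =>
          (((hc n).mono Ioc_subset_Icc_self).aemeasurable measurableSet_Ioc).ennreal_ofReal
    _ ≤ liminf (fun n : ℕ => ENNReal.ofReal (N ^ 2 / (2 * ν) + B / ν * (1 / ((n : ℝ) + 1))))
          atTop := liminf_le_liminf (Eventually.of_forall hn)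
    _ = _ := hlim.liminf_eq

end IsEvolution

/-! ### Weighted energies near the initial time and under mollification. -/

section InitialDatum

lemma l2_sqrt_smul_sq {ζ : R3 → ℝ} (hζ : Continuous ζ) (h0 : ∀ x, 0 ≤ ζ x) (h1 : ∀ x, ζ x ≤ 1)
    {f : R3 → R3} (hf : MemLp f 2 volume) :
    MemLp (fun x => Real.sqrt (ζ x) • f x) 2 volume ∧
      l2 (fun x => Real.sqrt (ζ x) • f x) ^ 2 = ∫ x, ζ x * ‖f x‖ ^ 2 := by
  have hm : MemLp (fun x => Real.sqrt (ζ x) • f x) 2 volume := by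
    refine hf.mono (hζ.sqrt.aestronglyMeasurable.smul hf.1) (Eventually.of_forall fun x => ?_)
    rw [norm_smul, Real.norm_of_nonneg (Real.sqrt_nonneg _)]
    exact mul_le_of_le_one_left (norm_nonneg _) (Real.sqrt_le_one.2 (h1 x))
  refine ⟨hm, ?_⟩
  rw [l2_sq hm]
  simp only [norm_smul, mul_pow, Real.norm_of_nonneg (Real.sqrt_nonneg _), Real.sq_sqrt (h0 _)]

/-- The triangle inequality for √ζ f and √ζ g. It lets the weighted energy at time s be compared
with that of the datum as s → 0⁺. -/
lemma integral_weight_le_sq {ζ : R3 → ℝ} (hζ : Continuous ζ) (h0 : ∀ x, 0 ≤ ζ x)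
    (h1 : ∀ x, ζ x ≤ 1) {f g : R3 → R3} (hf : MemLp f 2 volume) (hg : MemLp g 2 volume) :
    ∫ x, ζ x * ‖f x‖ ^ 2
      ≤ (Real.sqrt (∫ x, ζ x * ‖g x‖ ^ 2) + l2 (fun x => f x - g x)) ^ 2 := by
  obtain ⟨mf, ef⟩ := l2_sqrt_smul_sq hζ h0 h1 hf
  obtain ⟨mg, eg⟩ := l2_sqrt_smul_sq hζ h0 h1 hg
  rw [← ef, ← eg, Real.sqrt_sq (l2_nonneg _)]
  refine pow_le_pow_left₀ (l2_nonneg _) ?_ 2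
  have h := (le_abs_self _).trans (abs_l2_sub_l2_le mf mg)
  have h' : l2 (fun x => Real.sqrt (ζ x) • f x - Real.sqrt (ζ x) • g x)
      ≤ l2 (fun x => f x - g x) := by
    refine l2_mono (hf.sub hg) (Eventually.of_forall fun x => ?_)
    rw [← smul_sub, norm_smul, Real.norm_of_nonneg (Real.sqrt_nonneg _)]
    exact mul_le_of_le_one_left (norm_nonneg _) (Real.sqrt_le_one.2 (h1 x))
  linarith

lemma integral_scaledKernel_mul_norm (ρ : R3 → ℝ) {ε : ℝ} (hε : 0 < ε) :
    ∫ z, scaledKernel ρ ε z * ‖z‖ = ε * ∫ z, ρ z * ‖z‖ := by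
  have h : ∀ z : R3, scaledKernel ρ ε z * ‖z‖
      = (ε ^ 3)⁻¹ * (ε * (ρ (ε⁻¹ • z) * ‖ε⁻¹ • z‖)) := by
    intro z
    rw [norm_smul, norm_inv, Real.norm_of_nonneg hε.le, scaledKernel]
    field_simp
  simp only [h]
  rw [integral_const_mul, integral_const_mul, Measure.integral_comp_inv_smul_of_nonneg volume
    (fun z : R3 => ρ z * ‖z‖) hε.le]
  simp
  field_simp

/-- Mollification moves the weighted energy by at most the first moment of the kernel. -/
lemma integral_weight_kconv_le {k : R3 → ℝ} (hk : IsMollifier k) {χ : R3 → ℝ}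
    (hχ : ContDiff ℝ 1 χ) (h0 : ∀ x, 0 ≤ χ x) (h1 : ∀ x, χ x ≤ 1) {L : ℝ}
    (hb : ∀ x, ‖fderiv ℝ χ x‖ ≤ L) {f : R3 → R3} (hf : MemLp f 2 volume) :
    ∫ x, χ x * ‖kconv k f x‖ ^ 2
      ≤ (∫ x, χ x * ‖f x‖ ^ 2) + L * ((∫ z, k z * ‖z‖) * l2 f ^ 2) := by
  have hg := integrable_norm_sq hf
  have hχg : Integrable fun x => χ x * ‖f x‖ ^ 2 := by
    refine hg.mono' (hχ.continuous.aestronglyMeasurable.mul hg.1) (Eventually.of_forall fun x => ?_)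
    rw [norm_mul, Real.norm_of_nonneg (h0 x), norm_pow, norm_norm]
    exact mul_le_of_le_one_left (sq_nonneg _) (h1 x)
  have hkm : Continuous fun z : R3 => k z * ‖z‖ := hk.continuous.mul continuous_norm
  have hkmc : HasCompactSupport fun z : R3 => k z * ‖z‖ := hk.compactSupport.mul_right
  obtain ⟨i1, e1⟩ := integrable_integral_kconv
    (integrable_of_compactSupport hk.continuous hk.compactSupport) hχg
  obtain ⟨i2, e2⟩ := integrable_integral_kconv (integrable_of_compactSupport hkm hkmc) hg
  rw [hk.integral_eq_one, one_mul] at e1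
  have hpt : ∀ x, χ x * ‖kconv k f x‖ ^ 2 ≤ kconv k (fun y => χ y * ‖f y‖ ^ 2) x
      + L * kconv (fun z => k z * ‖z‖) (fun y => ‖f y‖ ^ 2) x := by
    intro x
    have a1 := norm_kconv_le k f x
    simp only [abs_of_nonneg (hk.nonneg _)] at a1
    have a2 := sq_kconv_norm_le hk.continuous hk.compactSupport hk.nonneg hf x
    rw [hk.integral_eq_one, one_mul] at a2
    have a3 := (pow_le_pow_left₀ (norm_nonneg _) a1 2).trans a2
    refine (mul_le_mul_of_nonneg_left a3 (h0 x)).trans ?_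
    have j0 := integrable_kconv hk.continuous hk.compactSupport hg.locallyIntegrable x
    have j1 := integrable_kconv hk.continuous hk.compactSupport hχg.locallyIntegrable x
    have j2 := integrable_kconv hkm hkmc hg.locallyIntegrable x
    simp only [kconv]
    rw [← integral_const_mul, ← integral_const_mul, ← integral_add j1 (j2.const_mul L)]
    refine integral_mono (j0.const_mul _) (j1.add (j2.const_mul L)) fun y => ?_
    -- Moving the weight inside the average costs L |x - y|, which turns `k` into the kernel k |z|
    -- and hence produces its first moment.
    have hχxy : χ x ≤ χ y + L * ‖x - y‖ := by
      have := (le_abs_self _).trans (abs_sub_le_of_fderiv_le hχ hb x y)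
      linarith
    have hn : 0 ≤ k (x - y) * ‖f y‖ ^ 2 := mul_nonneg (hk.nonneg _) (sq_nonneg _)
    have := mul_le_mul_of_nonneg_right hχxy hn
    simp only [smul_eq_mul]
    linarith
  calc ∫ x, χ x * ‖kconv k f x‖ ^ 2
      ≤ ∫ x, (kconv k (fun y => χ y * ‖f y‖ ^ 2) x
          + L * kconv (fun z => k z * ‖z‖) (fun y => ‖f y‖ ^ 2) x) :=
        integral_mono_of_nonneg (Eventually.of_forall fun x => mul_nonneg (h0 x) (sq_nonneg _))
          (i1.add (i2.const_mul L)) (Eventually.of_forall hpt)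
    _ = _ := by
        rw [integral_add i1 (i2.const_mul L), integral_const_mul, e1, e2, l2_sq hf]

end InitialDatum

/-- The energy rate has no sign; an upper bound needs only its positive part, which is what
`ENNReal.ofReal` retains. -/
lemma integral_le_of_lintegral_le {f : ℝ → ℝ} {s t c : ℝ} (hst : s ≤ t)
    (hf : IntervalIntegrable f volume s t) (hc : 0 ≤ c)
    (h : ∫⁻ r in Ioc s t, ENNReal.ofReal (f r) ≤ ENNReal.ofReal c) : ∫ r in s..t, f r ≤ c := by
  rw [intervalIntegral.integral_of_le hst, integral_eq_lintegral_pos_part_sub_lintegral_neg_part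
    ((intervalIntegrable_iff_integrableOn_Ioc_of_le hst).1 hf)]
  have h1 := ENNReal.toReal_mono ENNReal.ofReal_ne_top h
  rw [ENNReal.toReal_ofReal hc] at h1
  linarith [ENNReal.toReal_nonneg (a := ∫⁻ r in Ioc s t, ENNReal.ofReal (-f r))]

/-! ### Growth of weighted energies. -/

namespace IsEvolution

variable {ν MA τ M : ℝ} {A : ℝ → R3 → ℝ} {k : R3 → ℝ} {u : ℝ → R3 → R3} {p : ℝ → R3 → ℝ}
  (H : IsEvolution ν MA τ M A k u p)
include H

/-- The rate of change of a weighted energy is controlled by the gradient of the weight and by the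
dissipation. -/
lemma weighted_rate_le (hν : 0 ≤ ν) {K : ℝ} (hK0 : 0 ≤ K)
    (hK : ∀ (v : R3 → R3) (M : ℝ), ContDiff ℝ 1 v → MemLp v 2 volume →
      (∀ j, MemLp (pd j v) 2 volume) → (∀ x, ‖v x‖ ≤ M) →
      l2 (fun x => ‖v x‖ ^ 2) ≤ K * (l2 v + ∑ j, l2 (pd j v)) ^ 2)
    {c : ℝ} (hc : ν + MA + MA * ∑ j, gradMoment k j ≤ c) {ζ : R3 → ℝ}
    (hζ : ContDiff ℝ 1 ζ) (hcs : HasCompactSupport ζ) (h0 : ∀ x, 0 ≤ ζ x) {L : ℝ} (hL : 0 < L)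
    (hb : ∀ x, ‖fderiv ℝ ζ x‖ ≤ L) {N : ℝ} {t : ℝ} (ht : t ∈ Ioo 0 τ) (hN : l2 (u t) ≤ N) :
    ENNReal.ofReal (∫ x, (inner ℝ (ζ x • u t x) (deriv (fun s => u s x) t) : ℝ)) ≤
      ENNReal.ofReal L * (ENNReal.ofReal (N * (c + 8 * K * N ^ 2))
        + ENNReal.ofReal (N * (3 * c + 24 * K) + 1) * gradEnergy (u t)) := by
  have S := H.slice t ht
  have hu0 := l2_nonneg (u t)
  have hN0 : 0 ≤ N := hu0.trans hN
  have hMA0 := S.MA_nonneg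
  have hκ0 : 0 ≤ ∑ j, gradMoment k j := Finset.sum_nonneg fun j _ => gradMoment_nonneg k j
  have hc0 : 0 ≤ c := le_trans (by positivity) hc
  -- The summand 1 keeps the coefficient positive even for N = 0, so that the right side is
  -- infinite, and the claim trivial, at times of infinite dissipation.
  have hβ : 0 < N * (3 * c + 24 * K) + 1 := by positivity
  by_cases hd : gradEnergy (u t) = ⊤
  · rw [hd, ENNReal.mul_top (ENNReal.ofReal_pos.2 hβ).ne', add_top,
      ENNReal.mul_top (ENNReal.ofReal_pos.2 hL).ne']
    exact le_top
  obtain ⟨hp, hsum⟩ := memLp_pd_of_gradEnergy_ne_top S.v_one hd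
  have hSob := hK (u t) M S.v_one S.v_memLp hp (H.norm_le t ht)
  have hE := S.local_energy hζ hcs h0 hb
  have b0 : 0 ≤ ν * ∫ x, ζ x * ∑ j, ‖pd j (u t) x‖ ^ 2 := mul_nonneg hν
    (integral_nonneg fun x => mul_nonneg (h0 x) (sum_sq_pd_nonneg _ x))
  have b1 := S.abs_grad_energy_le hb hp
  have b2 := S.abs_transport_le hb (H.norm_le t ht)
  have b3 := H.abs_integral_pressure_le hζ hcs hb ht
  have b5 := S.fluxNorm_le (H.norm_le t ht) hp
  have b4 : ∑ j, gradMoment k j * l2 (pd j (kconv k (u t)))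
      ≤ (∑ j, gradMoment k j) * ∑ j, l2 (pd j (u t)) := by
    rw [Finset.sum_mul]
    refine Finset.sum_le_sum fun j _ => mul_le_mul_of_nonneg_left
      ((S.l2_pd_w_le' j (hp j)).trans ?_) (gradMoment_nonneg k j)
    exact Finset.single_le_sum (f := fun j => l2 (pd j (u t))) (fun i _ => l2_nonneg _)
      (Finset.mem_univ j)
  have hG0 : 0 ≤ ∑ j, l2 (pd j (u t)) := Finset.sum_nonneg fun j _ => l2_nonneg _
  have hG2 : (∑ j, l2 (pd j (u t))) ^ 2 ≤ 3 * (gradEnergy (u t)).toReal := by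
    rw [← hsum]
    simpa using sq_sum_le_card_mul_sum_sq (s := Finset.univ) (f := fun j => l2 (pd j (u t)))
  have hq0 := l2_nonneg fun x => ‖u t x‖ ^ 2
  have hF0 := fluxNorm_nonneg k (A t) (u t)
  rw [← ENNReal.ofReal_toReal hd, ← ENNReal.ofReal_mul hβ.le,
    ← ENNReal.ofReal_add (by positivity) (by positivity), ← ENNReal.ofReal_mul hL.le]
  refine ENNReal.ofReal_le_ofReal (hE.trans ?_)
  generalize (gradEnergy (u t)).toReal = d at *
  generalize ∑ j, l2 (pd j (u t)) = G at *
  generalize fluxNorm k (A t) (u t) = F at *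
  generalize l2 (fun x => ‖u t x‖ ^ 2) = Q at *
  generalize l2 (u t) = n at *
  generalize ∑ j, gradMoment k j = κ at *
  generalize ∑ j, gradMoment k j * l2 (pd j (kconv k (u t))) = W at *
  -- From (n + G)² ≤ 2 n² + 2 G² with n ≤ N and G² ≤ 3 d; likewise G ≤ 1 + 3 d below since 2 G ≤ 1 +
  -- G².
  have hQ : Q ≤ K * (2 * N ^ 2 + 6 * d) := by
    refine hSob.trans (mul_le_mul_of_nonneg_left ?_ hK0)
    nlinarith [sq_nonneg (n - G), pow_le_pow_left₀ hu0 hN 2]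
  have hG1 : G ≤ 1 + 3 * d := by nlinarith [sq_nonneg (G - 1)]
  have c1 : -ν * (∫ x, ∑ j, pd j ζ x * (inner ℝ (u t x) (pd j (u t) x) : ℝ))
      ≤ L * N * (ν * G) := by
    have := mul_le_mul_of_nonneg_left ((neg_le_abs _).trans b1) hν
    have h2 : ν * (L * (n * G)) ≤ ν * (L * (N * G)) := by gcongr
    linarith
  have c2 : 1 / 2 * (∫ x, fderiv ℝ ζ x (kconv k (u t) x) * ‖u t x‖ ^ 2) ≤ L * N * Q := by
    have h1 := (le_abs_self _).trans b2
    have h2 : L * (n * Q) ≤ L * (N * Q) := by gcongr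
    have h3 : 0 ≤ L * (N * Q) := by positivity
    linarith
  have c3 : ∫ x, p t x * fderiv ℝ ζ x (u t x) ≤ L * N * (3 * Q + MA * G) := by
    refine ((le_abs_self _).trans b3).trans ?_
    rw [mul_comm]
    exact mul_le_mul (mul_le_mul_of_nonneg_left hN hL.le) b5 hF0 (by positivity)
  have c4 : MA * L * n * W ≤ L * N * (MA * κ * G) := by
    calc MA * L * n * W ≤ MA * L * n * (κ * G) := mul_le_mul_of_nonneg_left b4 (by positivity)
      _ ≤ MA * L * N * (κ * G) := by gcongr
      _ = _ := by ring
  -- The four copies of Q are one from transport and three from the flux in the pressure term.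
  have c5 : (ν + MA + MA * κ) * G + 4 * Q
      ≤ c + 8 * K * N ^ 2 + (3 * c + 24 * K) * d := by
    have h1 : (ν + MA + MA * κ) * G ≤ c * (1 + 3 * d) :=
      mul_le_mul hc hG1 hG0 hc0
    linarith
  have hd0 : 0 ≤ d := by nlinarith [sq_nonneg G]
  have c6 := mul_le_mul_of_nonneg_left c5 (mul_nonneg hL.le hN0)
  have c7 : 0 ≤ L * d := by positivity
  linarith

/-- The growth of a weighted energy, for compactly supported weights. -/
lemma weighted_energy_le (hν : 0 < ν) {K : ℝ} (hK0 : 0 ≤ K)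
    (hK : ∀ (v : R3 → R3) (M : ℝ), ContDiff ℝ 1 v → MemLp v 2 volume →
      (∀ j, MemLp (pd j v) 2 volume) → (∀ x, ‖v x‖ ≤ M) →
      l2 (fun x => ‖v x‖ ^ 2) ≤ K * (l2 v + ∑ j, l2 (pd j v)) ^ 2)
    {c : ℝ} (hc0 : 0 ≤ c) (hc : ν + MA + MA * ∑ j, gradMoment k j ≤ c) {ζ : R3 → ℝ}
    (hζ : ContDiff ℝ 1 ζ) (hcs : HasCompactSupport ζ) (h0 : ∀ x, 0 ≤ ζ x) (h1 : ∀ x, ζ x ≤ 1)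
    {L : ℝ} (hL : 0 < L) (hb : ∀ x, ‖fderiv ℝ ζ x‖ ≤ L) {w : R3 → R3} (hw : MemLp w 2 volume)
    (hlim : Tendsto (fun s => l2 (fun x => u s x - w x)) (𝓝[>] 0) (𝓝 0)) {N : ℝ} (hN : l2 w ≤ N)
    {t : ℝ} (ht : t ∈ Ioo 0 τ) :
    1 / 2 * (∫ x, ζ x * ‖u t x‖ ^ 2) ≤ 1 / 2 * (∫ x, ζ x * ‖w x‖ ^ 2)
      + L * (N * (c + 8 * K * N ^ 2) * t
        + (N * (3 * c + 24 * K) + 1) * (N ^ 2 / (2 * ν))) := by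
  have hN0 : 0 ≤ N := (l2_nonneg w).trans hN
  have huN : ∀ s ∈ Ioo 0 τ, l2 (u s) ≤ N := fun s hs => (H.l2_le_initial hν.le hw hlim hs).trans hN
  set α := N * (c + 8 * K * N ^ 2) with hα
  set β := N * (3 * c + 24 * K) + 1 with hβ
  have hα0 : 0 ≤ α := by positivity
  have hβ0 : 0 ≤ β := by positivity
  set D := N ^ 2 / (2 * ν) with hD
  have hD0 : 0 ≤ D := by positivity
  -- The equation holds for positive times only, so the rate is integrated from s > 0 and the limit
  -- s → 0⁺ is taken at the end.
  have hstep : ∀ s ∈ Ioo 0 t, 1 / 2 * (∫ x, ζ x * ‖u t x‖ ^ 2)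
      ≤ 1 / 2 * (Real.sqrt (∫ x, ζ x * ‖w x‖ ^ 2) + l2 (fun x => u s x - w x)) ^ 2
        + L * (α * t + β * D) := by
    intro s hs
    have hsub : Icc s t ⊆ Ioo 0 τ := fun r hr => ⟨hs.1.trans_le hr.1, hr.2.trans_lt ht.2⟩
    obtain ⟨hi, he⟩ := H.integral_energy_rate_eq hζ.continuous hcs hs.1 hs.2.le ht.2
    have hle := integral_le_of_lintegral_le (c := L * (α * (t - s) + β * D)) hs.2.le hi
      (mul_nonneg hL.le (add_nonneg (mul_nonneg hα0 (by linarith [hs.2])) (mul_nonneg hβ0 hD0))) ?_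
    · rw [he, integral_const_mul, integral_const_mul] at hle
      have hw2 := integral_weight_le_sq hζ.continuous h0 h1
        (H.slice s (hsub ⟨le_rfl, hs.2.le⟩)).v_memLp hw
      have h3 : L * (α * (t - s) + β * D) ≤ L * (α * t + β * D) := by
        have : t - s ≤ t := by linarith [hs.1]
        gcongr
      linarith
    · calc ∫⁻ r in Ioc s t, ENNReal.ofReal
            (∫ x, (inner ℝ (ζ x • u r x) (deriv (fun q => u q x) r) : ℝ))
          ≤ ∫⁻ r in Ioc s t, ENNReal.ofReal L * (ENNReal.ofReal α
              + ENNReal.ofReal β * gradEnergy (u r)) :=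
            setLIntegral_mono_ae' measurableSet_Ioc (Eventually.of_forall fun r hr =>
              H.weighted_rate_le hν.le hK0 hK hc hζ hcs h0 hL hb
                (hsub (Ioc_subset_Icc_self hr)) (huN r (hsub (Ioc_subset_Icc_self hr))))
        _ = ENNReal.ofReal L * (ENNReal.ofReal α * ENNReal.ofReal (t - s)
              + ENNReal.ofReal β * ∫⁻ r in Ioc s t, gradEnergy (u r)) := by
            rw [lintegral_const_mul' _ _ ENNReal.ofReal_ne_top, lintegral_add_left measurable_const,
              lintegral_const_mul' _ _ ENNReal.ofReal_ne_top, setLIntegral_const, Real.volume_Ioc]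
        _ ≤ ENNReal.ofReal L * (ENNReal.ofReal α * ENNReal.ofReal (t - s)
              + ENNReal.ofReal β * ENNReal.ofReal D) := by
            gcongr
            exact H.lintegral_gradEnergy_le hν huN hs.1 hs.2.le ht.2
        _ = _ := by
            rw [← ENNReal.ofReal_mul hα0, ← ENNReal.ofReal_mul hβ0,
              ← ENNReal.ofReal_add (mul_nonneg hα0 (by linarith [hs.2])) (mul_nonneg hβ0 hD0),
              ← ENNReal.ofReal_mul hL.le]
  have hl := ((((hlim.const_add (Real.sqrt (∫ x, ζ x * ‖w x‖ ^ 2))).pow 2).const_mul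
    (1 / 2)).add_const (L * (α * t + β * D)))
  rw [add_zero, Real.sq_sqrt (integral_nonneg fun x => mul_nonneg (h0 x) (sq_nonneg _))] at hl
  refine ge_of_tendsto hl ?_
  filter_upwards [Ioo_mem_nhdsGT ht.1] with s hs using hstep s hs

/-- The growth of a weighted energy, for weights with bounded gradient. -/
lemma exterior_energy_le (hν : 0 < ν) {K : ℝ} (hK0 : 0 ≤ K)
    (hK : ∀ (v : R3 → R3) (M : ℝ), ContDiff ℝ 1 v → MemLp v 2 volume →
      (∀ j, MemLp (pd j v) 2 volume) → (∀ x, ‖v x‖ ≤ M) →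
      l2 (fun x => ‖v x‖ ^ 2) ≤ K * (l2 v + ∑ j, l2 (pd j v)) ^ 2)
    {c : ℝ} (hc0 : 0 ≤ c) (hc : ν + MA + MA * ∑ j, gradMoment k j ≤ c) {χ : R3 → ℝ}
    (hχ : ContDiff ℝ 1 χ) (h0 : ∀ x, 0 ≤ χ x) (h1 : ∀ x, χ x ≤ 1)
    {L : ℝ} (hb : ∀ x, ‖fderiv ℝ χ x‖ ≤ L) {w : R3 → R3} (hw : MemLp w 2 volume)
    (hlim : Tendsto (fun s => l2 (fun x => u s x - w x)) (𝓝[>] 0) (𝓝 0)) {N : ℝ} (hN : l2 w ≤ N)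
    {t : ℝ} (ht : t ∈ Ioo 0 τ) :
    1 / 2 * (∫ x, χ x * ‖u t x‖ ^ 2) ≤ 1 / 2 * (∫ x, χ x * ‖w x‖ ^ 2)
      + L * (N * (c + 8 * K * N ^ 2) * t
        + (N * (3 * c + 24 * K) + 1) * (N ^ 2 / (2 * ν))) := by
  obtain ⟨C, hC, hcut⟩ := exists_cutoff_bound
  have hL : 0 ≤ L := (norm_nonneg _).trans (hb 0)
  have hi : ∀ {f : R3 → R3}, MemLp f 2 volume → Integrable fun x => χ x * ‖f x‖ ^ 2 := by
    intro f hf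
    have hg := integrable_norm_sq hf
    refine hg.mono' (hχ.continuous.aestronglyMeasurable.mul hg.1) (Eventually.of_forall fun x => ?_)
    rw [norm_mul, Real.norm_of_nonneg (h0 x), norm_pow, norm_norm]
    exact mul_le_of_le_one_left (sq_nonneg _) (h1 x)
  have hn : ∀ n : ℕ, 1 / 2 * (∫ x, cutoff (n + 1) x * (χ x * ‖u t x‖ ^ 2))
      ≤ 1 / 2 * (∫ x, cutoff (n + 1) x * (χ x * ‖w x‖ ^ 2))
        + (L + (C + 1) * (1 / ((n : ℝ) + 1))) * (N * (c + 8 * K * N ^ 2) * t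
        + (N * (3 * c + 24 * K) + 1) * (N ^ 2 / (2 * ν))) := by
    intro n
    have hn1 : (1 : ℝ) ≤ n + 1 := by simp
    have hη : ContDiff ℝ 1 (cutoff (n + 1)) := contDiff_cutoff _ (n := 1)
    -- The product has gradient at most L + C / (n + 1). Using C + 1 keeps the slope strictly
    -- positive, as `weighted_energy_le` requires, even if L = C = 0.
    have h := H.weighted_energy_le hν hK0 hK hc0 hc (ζ := fun x => cutoff (n + 1) x * χ x)
      (hη.mul hχ) (hasCompactSupport_cutoff (by positivity)).mul_right
      (fun x => mul_nonneg (cutoff_nonneg _ _) (h0 x))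
      (fun x => mul_le_one₀ (cutoff_le_one _ _) (h0 x) (h1 x))
      (L := L + (C + 1) * (1 / ((n : ℝ) + 1))) (by positivity) (fun x => ?_) hw hlim hN ht
    · simpa only [mul_assoc] using h
    · rw [fderiv_fun_mul (hη.differentiable (by norm_num) x) (hχ.differentiable (by norm_num) x)]
      refine (norm_add_le _ _).trans (add_le_add ?_ ?_)
      · rw [norm_smul, Real.norm_of_nonneg (cutoff_nonneg _ _)]
        exact (mul_le_of_le_one_left (norm_nonneg _) (cutoff_le_one _ _)).trans (hb x)
      · rw [norm_smul, Real.norm_of_nonneg (h0 x)]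
        refine (mul_le_of_le_one_left (norm_nonneg _) (h1 x)).trans ((hcut _ hn1 x).1.trans ?_)
        rw [mul_one_div]
        gcongr
        linarith
  have hl := (((tendsto_one_div_add_atTop_nhds_zero_nat.const_mul (C + 1)).const_add L).mul_const
    (N * (c + 8 * K * N ^ 2) * t + (N * (3 * c + 24 * K) + 1) * (N ^ 2 / (2 * ν))))
  rw [mul_zero, add_zero] at hl
  exact le_of_tendsto_of_tendsto'
    ((tendsto_integral_cutoff_mul (hi (H.slice t ht).v_memLp)).const_mul (1 / 2))
    (((tendsto_integral_cutoff_mul (hi hw)).const_mul (1 / 2)).add hl) hn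

end IsEvolution

end

theorem mainTheorem5 (ν : ℝ) (hν : 0 < ν)
    (ρ : R3 → ℝ) (hρ : IsMollifier ρ)
    (A : ℝ → R3 → ℝ) (hA : IsEddyViscosity A) (hA_supp : HasUniformCompactSupport A)
    (u₀ : R3 → R3) (hu₀ : MemLp u₀ 2 volume) (hdiv : IsWeaklyDivFree u₀)
    (ε₀ : ℝ) (hε₀ : 0 < ε₀) :
    ∃ φ : ℝ → ℝ, ContinuousOn φ (Ici 0) ∧ MonotoneOn φ (Ici 0) ∧
      ∀ (ε : ℝ), 0 < ε → ε ≤ ε₀ →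
      ∀ (T : EReal) (u : ℝ → R3 → R3) (p : ℝ → R3 → ℝ),
        IsRegularSolution ν A ρ ε u₀ T u p →
      ∀ (R₁ R₂ : ℝ), 0 < R₁ → R₁ < R₂ →
      ∀ t : ℝ, 0 ≤ t → (t : EReal) < T →
        (1 / 2 : ℝ) * (∫ x in {x : R3 | R₂ ≤ ‖x‖}, ‖u t x‖ ^ 2)
          ≤ (1 / 2 : ℝ) * (∫ x in {x : R3 | R₁ ≤ ‖x‖}, ‖u₀ x‖ ^ 2)
            + φ t / (R₂ - R₁) := by
  obtain ⟨K, hK0, hK⟩ := exists_sobolev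
  obtain ⟨C, hC, hext⟩ := exists_exterior_cutoff
  obtain ⟨MA, hMA, hAM⟩ := hA.exists_bound
  have hκ : 0 ≤ ∑ j, gradMoment ρ j := Finset.sum_nonneg fun j _ => gradMoment_nonneg ρ j
  set c := ν + MA + MA * ∑ j, gradMoment ρ j with hc
  have hc0 : 0 ≤ c := by positivity
  set N := l2 u₀ with hN
  have hN0 : 0 ≤ N := l2_nonneg _
  set m := ∫ z, ρ z * ‖z‖ with hm
  have hm0 : 0 ≤ m := integral_nonneg fun z => mul_nonneg (hρ.nonneg z) (norm_nonneg z)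
  set α := N * (c + 8 * K * N ^ 2) with hα
  set β := (N * (3 * c + 24 * K) + 1) * (N ^ 2 / (2 * ν)) with hβ
  have hα0 : 0 ≤ α := by positivity
  have hβ0 : 0 ≤ β := by positivity
  -- C comes from the slope of the exterior cutoff, ε₀ m N² from mollifying the datum, α t + β from
  -- the integrated growth rate.
  refine ⟨fun t => C * (1 / 2 * (ε₀ * m * N ^ 2) + (α * t + β)), ?_, ?_, ?_⟩
  · exact Continuous.continuousOn (by fun_prop)
  · intro s _ t _ hst
    simp only
    gcongr
  intro ε hε hεε₀ T u p h R₁ R₂ hR₁ hR₂ t ht htT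
  obtain ⟨χ, hχ, hχ0, hχ1, hχin, hχout, hχd⟩ := hext R₁ R₂ hR₁ hR₂
  have hχ' : ContDiff ℝ 1 χ := contDiff_one hχ
  have hR : 0 < R₂ - R₁ := sub_pos.2 hR₂
  have hk := isMollifier_scaledKernel hρ hε
  obtain ⟨hw, hwN⟩ := memLp_kconv hk.continuous hk.compactSupport hu₀
  rw [hk.integral_abs, one_mul] at hwN
  have hlim : Tendsto (fun s => l2 (fun x => u s x - kconv (scaledKernel ρ ε) u₀ x))
      (𝓝[>] 0) (𝓝 0) :=
    (ENNReal.tendsto_toReal ENNReal.zero_ne_top).comp h.L2_initial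
  have hmain : MemLp (u t) 2 volume ∧ 1 / 2 * (∫ x, χ x * ‖u t x‖ ^ 2)
      ≤ 1 / 2 * (∫ x, χ x * ‖kconv (scaledKernel ρ ε) u₀ x‖ ^ 2)
        + C / (R₂ - R₁) * (α * t + β) := by
    -- At t = 0 the field is the mollified datum itself; the evolution estimates cover positive
    -- times only.
    rcases ht.eq_or_lt with rfl | ht0
    · rw [h.initial, mollify_eq_kconv]
      exact ⟨hw, le_add_of_nonneg_right (by positivity)⟩
    · obtain ⟨τ, htτ, hτT⟩ := EReal.lt_iff_exists_real_btwn.1 htT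
      rw [EReal.coe_lt_coe_iff] at htτ
      obtain ⟨M, -, H⟩ := h.isEvolution hρ hε hA hMA hAM (ht.trans htτ.le) hτT
      refine ⟨(H.slice t ⟨ht0, htτ⟩).v_memLp, H.exterior_energy_le hν hK0 hK hc0 ?_ hχ' hχ0 hχ1 hχd
        hw hlim hwN ⟨ht0, htτ⟩⟩
      -- The constant `c` was defined with `ρ`; scale invariance of the moment makes it admissible
      -- for every ε.
      simp only [gradMoment_scaledKernel hρ hε]
      exact le_rfl
  obtain ⟨hu, hmain⟩ := hmain
  have hi : ∀ {f : R3 → R3}, MemLp f 2 volume → Integrable fun x => χ x * ‖f x‖ ^ 2 := by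
    intro f hf
    have hg := integrable_norm_sq hf
    refine hg.mono' (hχ.continuous.aestronglyMeasurable.mul hg.1) (Eventually.of_forall fun x => ?_)
    rw [norm_mul, Real.norm_of_nonneg (hχ0 x), norm_pow, norm_norm]
    exact mul_le_of_le_one_left (sq_nonneg _) (hχ1 x)
  have hmeas : ∀ r : ℝ, MeasurableSet {x : R3 | r ≤ ‖x‖} := fun r =>
    measurableSet_le measurable_const measurable_norm
  have hout : ∫ x in {x : R3 | R₂ ≤ ‖x‖}, ‖u t x‖ ^ 2 ≤ ∫ x, χ x * ‖u t x‖ ^ 2 := by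
    rw [← integral_indicator (hmeas R₂)]
    refine integral_mono ((integrable_norm_sq hu).indicator (hmeas R₂)) (hi hu) fun x => ?_
    by_cases hx : R₂ ≤ ‖x‖
    · rw [indicator_of_mem (s := {x : R3 | R₂ ≤ ‖x‖}) hx, hχout x hx, one_mul]
    · rw [indicator_of_notMem (s := {x : R3 | R₂ ≤ ‖x‖}) hx]
      exact mul_nonneg (hχ0 x) (sq_nonneg _)
  have hin : ∫ x, χ x * ‖u₀ x‖ ^ 2 ≤ ∫ x in {x : R3 | R₁ ≤ ‖x‖}, ‖u₀ x‖ ^ 2 := by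
    rw [← integral_indicator (hmeas R₁)]
    refine integral_mono (hi hu₀) ((integrable_norm_sq hu₀).indicator (hmeas R₁)) fun x => ?_
    by_cases hx : R₁ ≤ ‖x‖
    · rw [indicator_of_mem (s := {x : R3 | R₁ ≤ ‖x‖}) hx]
      exact mul_le_of_le_one_left (sq_nonneg _) (hχ1 x)
    · rw [indicator_of_notMem (s := {x : R3 | R₁ ≤ ‖x‖}) hx, hχin x (not_le.1 hx).le, zero_mul]
  have hinit := integral_weight_kconv_le hk hχ' hχ0 hχ1 hχd hu₀
  rw [integral_scaledKernel_mul_norm ρ hε, ← hm, ← hN] at hinit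
  have hεm : C / (R₂ - R₁) * (ε * m * N ^ 2) ≤ C / (R₂ - R₁) * (ε₀ * m * N ^ 2) := by
    gcongr
  have e : C * (1 / 2 * (ε₀ * m * N ^ 2) + (α * t + β)) / (R₂ - R₁)
      = 1 / 2 * (C / (R₂ - R₁) * (ε₀ * m * N ^ 2)) + C / (R₂ - R₁) * (α * t + β) := by
    ring
  rw [e]
  linarith
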